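/- Conventions. Let $K$ be a finite simplicial complex. It is \emph{flag-no-square} (fns) if its faces are exactly the cliques of its $1$-skeleton and its $1$-skeleton has no induced $4$-cycle. It is a \emph{simplicial $4$-manifold} if its geometric realization $|K|$ is a closed topological $4$-manifold and the link of every face with $k$ vertices ($1\le k\le 5$) is homeomorphic to the sphere $S^{4-k}$ (with $S^{-1}=\emptyset$). An \emph{orientation} of such a $K$ gives a sign to every ordering of the vertices of every $4$-face, alternating under permutations, such that two distinct $4$-faces with a common $3$-face induce opposite orientations on it; the link of a vertex $p$ is then oriented by giving $(w_1,\dots,w_4)$ the sign of $(p,w_1,\dots,w_4)$. The Euler characteristic $\chi(K)$ is the alternating sum of the face numbers. A topological space $Y$ is \emph{a $4$-manifold $X$ with a hollow $1$-handle attached} if there are open embeddings $e_0,e_1:\mathbb{R}^4\to X$ for which the images $e_0(D^4)$ and $e_1(D^4)$ of the closed unit ball are disjoint, such that $Y$ is obtained from $X\setminus\big(e_0(\operatorname{int}D^4)\cup e_1(\operatorname{int}D^4)\big)$ and $S^3\times[0,1]$ by gluing $(p,i)$ to $e_i(p)$ for all $p\in S^3$ and $i=0,1$. Lemma. Let $N$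 be a fns connected simplicial $4$-manifold with an orientation, let $v,u$ be vertices of $N$ at distance at least $7$ in the graph metric of the $1$-skeleton of $N$, and let $\phi:\operatorname{lk}_v(N)\to\operatorname{lk}_u(N)$ be a combinatorial isomorphism (a bijection of the vertex sets that preserves faces in both directions) that reverses orientation. Let $h_\phi(N)$ be the star handled complex: the simplicial complex obtained from the subcomplex $(N-v)-u$ of all faces of $N$ containing neither $v$ nor $u$ by identifying each vertex $w$ of $\operatorname{lk}_v(N)$ with $\phi(w)$. Then (i) $h_\phi(N)$ is a fns simplicial $4$-manifold, it is orientable, and its realization is homeomorphic to $|N|$ with a hollow $1$-handle attached; (ii) $\chi(h_\phi(N))=\chi(N)-2$. -/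

import Mathlib

/-! Finite abstract simplicial complexes are modelled by Mathlib's `PreAbstractSimplicialComplex V`
(the faces are nonempty finite subsets of `V`; not every element of `V` has to be a vertex). -/

namespace PreAbstractSimplicialComplex

/-- The set of vertices of `K`. -/
def vertexSet {V : Type*} (K : PreAbstractSimplicialComplex V) : Set V :=
  {w | {w} ∈ K.faces}

/-- The graph (1-skeleton) of `K`: two distinct elements are adjacent if they lie in a common
face. Elements of `V` that are not vertices of `K` are isolated. -/
def skeletonGraph {V : Type*} (K : PreAbstractSimplicialComplex V) : SimpleGraph V where
  Adj a b := a ≠ b ∧ ∃ s ∈ K.faces, a ∈ s ∧ b ∈ s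
  symm := ⟨fun _ _ h => ⟨h.1.symm, h.2.imp fun _ hs => ⟨hs.1, hs.2.2, hs.2.1⟩⟩⟩
  loopless := ⟨fun _ h => h.1 rfl⟩

/-- `K` is flag: its faces are exactly the (nonempty, finite) cliques of its 1-skeleton. -/
def IsFlag {V : Type*} (K : PreAbstractSimplicialComplex V) : Prop :=
  ∀ s : Finset V, s ∈ K.faces ↔
    s.Nonempty ∧ (∀ a ∈ s, a ∈ K.vertexSet) ∧ K.skeletonGraph.IsClique (s : Set V)

/-- `K` is flag-no-square (fns): flag, and the 1-skeleton has no induced 4-cycle. -/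
def IsFns {V : Type*} (K : PreAbstractSimplicialComplex V) : Prop :=
  K.IsFlag ∧ IsEmpty (SimpleGraph.cycleGraph 4 ↪g K.skeletonGraph)

open scoped Classical in
/-- The link of a finite set `s` of vertices (usually a face): the nonempty `t` disjoint from `s`
with `s ∪ t ∈ K`. -/
def link {V : Type*} (K : PreAbstractSimplicialComplex V) (s : Finset V) :
    PreAbstractSimplicialComplex V where
  faces := {t | t.Nonempty ∧ Disjoint s t ∧ s ∪ t ∈ K.faces}
  isRelLowerSet_faces := by
    rintro t ⟨ht, hd, hu⟩
    refine ⟨ht, fun r hr hrn => ⟨hrn, hd.mono_right hr, ?_⟩⟩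
    exact (K.isRelLowerSet_faces hu).2 (Finset.union_subset_union_right hr)
      (hrn.mono Finset.subset_union_right)

/-- The deletion (antistar) `K - v`: all faces of `K` that do not contain `v`. -/
def deletion {V : Type*} (K : PreAbstractSimplicialComplex V) (v : V) :
    PreAbstractSimplicialComplex V where
  faces := {t | t ∈ K.faces ∧ v ∉ t}
  isRelLowerSet_faces := by
    rintro t ⟨ht, hv⟩
    exact ⟨(K.isRelLowerSet_faces ht).1, fun r hr hrn =>
      ⟨(K.isRelLowerSet_faces ht).2 hr hrn, fun h => hv (hr h)⟩⟩

/-- A combinatorial isomorphism: a bijection between the vertex sets under which a set of vertices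
is a face of the source if and only if its image is a face of the target. -/
structure Iso {V W : Type*} (K : PreAbstractSimplicialComplex V)
    (L : PreAbstractSimplicialComplex W) where
  toEquiv : K.vertexSet ≃ L.vertexSet
  mem_faces_iff : ∀ s : Finset K.vertexSet,
    s.map (Function.Embedding.subtype _) ∈ K.faces ↔
      (s.map toEquiv.toEmbedding).map (Function.Embedding.subtype _) ∈ L.faces

/-- The geometric realization of `K` in barycentric coordinates, with the topology induced from
the product `V → ℝ` (for complexes with finitely many faces this is the usual topology). -/
def realization {V : Type*} (K : PreAbstractSimplicialComplex V) : Set (V → ℝ) :=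
  {x | (∀ w, 0 ≤ x w) ∧ ∃ s ∈ K.faces, (∀ w, w ∉ s → x w = 0) ∧ ∑ w ∈ s, x w = 1}

/-- The Euler characteristic: the alternating sum of the face numbers. (A face with `n` vertices
has dimension `n - 1`, and `(-1) ^ (n - 1) = (-1) ^ (n + 1)`.) -/
noncomputable def eulerChar {V : Type*} (K : PreAbstractSimplicialComplex V) : ℤ :=
  ∑ᶠ s ∈ K.faces, (-1 : ℤ) ^ (s.card + 1)

end PreAbstractSimplicialComplex

/-- `X` is a closed (compact, without boundary) topological `d`-manifold, not necessarily
connected. -/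
structure IsClosedTopManifold (d : ℕ) (X : Type*) [TopologicalSpace X] : Prop where
  t2 : T2Space X
  compact : CompactSpace X
  charted : Nonempty (ChartedSpace (EuclideanSpace ℝ (Fin d)) X)

namespace PreAbstractSimplicialComplex

/-- `K` is a simplicial closed `d`-manifold: a finite complex whose realization is a closed
topological `d`-manifold, and in which every face with `k` vertices has at most `d + 1` vertices
and a link homeomorphic to the sphere of dimension `d - k`
(the unit sphere in a Euclidean space of dimension `d + 1 - k`; empty for `k = d + 1`). -/
structure IsSimplicialManifold {V : Type*} (K : PreAbstractSimplicialComplex V) (d : ℕ) :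
    Prop where
  finite : K.faces.Finite
  isManifold : IsClosedTopManifold d K.realization
  card_le : ∀ s ∈ K.faces, s.card ≤ d + 1
  link_sphere : ∀ s ∈ K.faces, Nonempty ((K.link s).realization ≃ₜ
    Metric.sphere (0 : EuclideanSpace ℝ (Fin (d + 1 - s.card))) 1)

/-- `x` lists, without repetition, the vertices of a face of `K`. -/
def IsOrderedFace {V : Type*} (K : PreAbstractSimplicialComplex V) {n : ℕ} (x : Fin n → V) :
    Prop :=
  Function.Injective x ∧ ∃ s ∈ K.faces, (s : Set V) = Set.range x

/-- An orientation of a `d`-dimensional simplicial manifold: every ordering of the vertices of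
every `d`-face gets a sign, which is multiplied by the sign of a permutation when the vertices are
permuted, so that two distinct `d`-faces with a common `(d-1)`-face induce opposite orientations
on it. The values of `sign` on other tuples carry no information. -/
structure Orientation {V : Type*} (K : PreAbstractSimplicialComplex V) (d : ℕ) where
  sign : (Fin (d + 1) → V) → ℤˣ
  sign_comp_perm : ∀ x : Fin (d + 1) → V, K.IsOrderedFace x →
    ∀ σ : Equiv.Perm (Fin (d + 1)), sign (x ∘ σ) = Equiv.Perm.sign σ * sign x
  coherent : ∀ (a b : V) (y : Fin d → V), a ≠ b →
    K.IsOrderedFace (Fin.cons a y : Fin (d + 1) → V) →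
    K.IsOrderedFace (Fin.cons b y : Fin (d + 1) → V) →
    sign (Fin.cons b y) = -sign (Fin.cons a y)

/-- `K` is orientable as a `d`-dimensional simplicial manifold. -/
def IsOrientable {V : Type*} (K : PreAbstractSimplicialComplex V) (d : ℕ) : Prop :=
  Nonempty (K.Orientation d)

/-- `φ : lk v → lk u` reverses orientation, where the link of a vertex `p` is oriented by giving
`(w₁, …, w_d)` the sign of `(p, w₁, …, w_d)`. -/
def Orientation.IsReversedBy {V : Type*} {K : PreAbstractSimplicialComplex V} {d : ℕ}
    (o : K.Orientation d) {v u : V} (φ : (K.link {v}).Iso (K.link {u})) : Prop :=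
  ∀ w : Fin d → (K.link {v}).vertexSet,
    (K.link {v}).IsOrderedFace (fun i => (w i : V)) →
    o.sign (Fin.cons u fun i => (φ.toEquiv (w i) : V)) = -o.sign (Fin.cons v fun i => (w i : V))

/-- The relation that identifies each vertex `w` of `lk v` with `φ w`. -/
def HandleRel {V : Type*} {K : PreAbstractSimplicialComplex V} {v u : V}
    (φ : (K.link {v}).Iso (K.link {u})) (a b : V) : Prop :=
  ∃ h : a ∈ (K.link {v}).vertexSet, b = φ.toEquiv ⟨a, h⟩

open scoped Classical in
/-- The star handled complex `h_φ(K)`: the quotient of `(K - v) - u` by the identification of `w`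
with `φ w` for all vertices `w` of `lk v`. Its faces are the images of the faces of
`(K - v) - u` in the set of classes of vertices. -/
noncomputable def starHandle {V : Type*} (K : PreAbstractSimplicialComplex V) {v u : V}
    (φ : (K.link {v}).Iso (K.link {u})) : PreAbstractSimplicialComplex (Quot (HandleRel φ)) :=
  ((K.deletion v).deletion u).map (Quot.mk (HandleRel φ))

end PreAbstractSimplicialComplex

/-- Data for attaching a hollow 1-handle to a `d`-dimensional manifold `X`: two disjoint tame
closed `d`-balls, given as the images of the closed unit ball under open embeddings of `ℝ^d`. -/
structure HollowHandleData (d : ℕ) (X : Type*) [TopologicalSpace X] where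
  e₀ : EuclideanSpace ℝ (Fin d) → X
  e₁ : EuclideanSpace ℝ (Fin d) → X
  isOpenEmbedding₀ : Topology.IsOpenEmbedding e₀
  isOpenEmbedding₁ : Topology.IsOpenEmbedding e₁
  disjoint : Disjoint (e₀ '' Metric.closedBall 0 1) (e₁ '' Metric.closedBall 0 1)

namespace HollowHandleData

/-- `X` without the two open balls. -/
def complement {d : ℕ} {X : Type*} [TopologicalSpace X] (D : HollowHandleData d X) : Set X :=
  (D.e₀ '' Metric.ball 0 1 ∪ D.e₁ '' Metric.ball 0 1)ᶜ

/-- The gluing of the hollow handle `S^{d-1} × [0,1]` to the complement of the two open balls: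
`(p, 0)` is glued to `e₀ p` and `(p, 1)` to `e₁ p`. -/
inductive Rel {d : ℕ} {X : Type*} [TopologicalSpace X] (D : HollowHandleData d X) :
    D.complement ⊕ (Metric.sphere (0 : EuclideanSpace ℝ (Fin d)) 1 × unitInterval) →
    D.complement ⊕ (Metric.sphere (0 : EuclideanSpace ℝ (Fin d)) 1 × unitInterval) → Prop
  | zero (x : D.complement) (p : Metric.sphere (0 : EuclideanSpace ℝ (Fin d)) 1)
      (h : (x : X) = D.e₀ p) : Rel D (Sum.inl x) (Sum.inr (p, 0))
  | one (x : D.complement) (p : Metric.sphere (0 : EuclideanSpace ℝ (Fin d)) 1)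
      (h : (x : X) = D.e₁ p) : Rel D (Sum.inl x) (Sum.inr (p, 1))

/-- The space obtained from `X` by attaching the hollow 1-handle, with the quotient topology. -/
abbrev Attached {d : ℕ} {X : Type*} [TopologicalSpace X] (D : HollowHandleData d X) : Type _ :=
  Quot D.Rel

end HollowHandleData

/-- `Y` is homeomorphic to the `d`-manifold `X` with a hollow 1-handle attached. -/
def IsHollowHandleAttachment (d : ℕ) (X Y : Type*) [TopologicalSpace X] [TopologicalSpace Y] :
    Prop :=
  ∃ D : HollowHandleData d X, Nonempty (Y ≃ₜ D.Attached)

/-! The star handled complex is studied through two sections `σ` and `τ` of the quotient map: `σ`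
picks representatives outside the link of u, `τ` representatives outside the link of v. A set of
classes is a face exactly when one of these two pictures of it is a face of N that avoids v and u
(`IsStarGluing`).

Flagness and squares. If a clique or an induced square of the quotient does not live on one side, it
contains an edge leaving the common link on the v-side and another one leaving it on the u-side. For
a clique this yields a walk from v to u that is too short. For a square, either such a walk appears,
with at most six edges, or the square has one corner near v, the opposite corner near u and the two
others in the common link. In the latter case v replaces the corner near u and gives an induced
square of N.

Links. They are only assumed to be topological spheres, so no piecewise linear tool applies. The
link of a face of the common link is the union of two complexes along a sphere, each of them a
sphere complex with one vertex deleted. The point is that such a deletion is a ball bounded by the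
link of the deleted vertex (`IsSphereComplex.exists_ball`). This goes by induction on the dimension.
The induction hypothesis in the links of the neighbours of v supplies charts in which the link of v
is a hyperplane. Sliding along these charts with weights that add up to 1 moves the link of v into
the interior of its star (`exists_collar`). What remains is the complement of a tame open ball in a
sphere, which is a ball by Brown's proof of the generalized Schoenflies theorem
(`exists_homeomorph_complement_ball`).

The handle. The same collars, applied in N around v and u, turn the complement of the two open stars
into the complement of two tame open balls. Gluing the two boundary spheres is then the same as
inserting the product of a sphere with an interval, because a shell around v absorbs the product.

Orientation. The sign of an ordered facet is read off on a side where the facet lives. The only new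
coherence check concerns two facets on different sides that share a ridge in the common link:
passing from one to the other through u and v, the reversal of orientation by φ gives the required
sign.

Euler characteristic. Write M for N without v and u. Inclusion and exclusion give χ(h) = χ(M) - χ(lk
v) and χ(N) = χ(M) + 2 - χ(lk v) - χ(lk u), so it remains to see that a triangulated 3-sphere has
Euler characteristic 0. Double counting over vertex links reduces this to Euler's formula for
2-spheres, which is linear algebra modulo 2. Its one topological input is that a 1-cocycle is a
coboundary: the cocycle defines a double cover, and this has a section over the sphere minus a point
off the 1-skeleton (`exists_potential`). -/

open Set Filter Topology Metric

/-! ### Extending and comparing maps of compact Hausdorff spaces. -/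

section Extension

variable {Z X : Type*} [TopologicalSpace Z] [TopologicalSpace X]

/-- A continuous bijection of `Z` with compact support extends by the identity along an open
embedding of `Z` into a compact Hausdorff space. -/
theorem Topology.IsOpenEmbedding.exists_homeomorph_extend [T2Space X] [CompactSpace X] {e : Z → X}
    (he : IsOpenEmbedding e) {f : Z → Z} (hf : Continuous f) (hbij : Function.Bijective f)
    {C : Set Z} (hC : IsCompact C) (hfC : ∀ z, z ∉ C → f z = z) :
    ∃ F : X ≃ₜ X, (∀ z, F (e z) = e (f z)) ∧ ∀ x, x ∉ e '' C → F x = x := by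
  classical
  set g : X → X := Function.extend e (e ∘ f) id with hg
  have hge : ∀ z, g (e z) = e (f z) := fun z => he.injective.extend_apply _ _ z
  have hgr : ∀ x, x ∉ range e → g x = x := fun x hx =>
    Function.extend_apply' _ _ _ (by simpa using hx)
  have hgC : ∀ x, x ∉ e '' C → g x = x := by
    intro x hx
    by_cases hxr : x ∈ range e
    · obtain ⟨z, rfl⟩ := hxr
      rw [hge, hfC z fun hz => hx ⟨z, hz, rfl⟩]
    · exact hgr x hxr
  have hcont : Continuous g := by
    rw [continuous_iff_continuousAt]
    intro x
    by_cases hx : x ∈ e '' C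
    · obtain ⟨z, -, rfl⟩ := hx
      rw [← he.continuousAt_iff]
      have : g ∘ e = e ∘ f := funext hge
      rw [this]
      exact (he.continuous.comp hf).continuousAt
    · have ho : (e '' C)ᶜ ∈ 𝓝 x := (hC.image he.continuous).isClosed.isOpen_compl.mem_nhds hx
      exact continuousAt_id.congr (by filter_upwards [ho] with y hy using (hgC y hy).symm)
  have hb : Function.Bijective g := by
    constructor
    · intro x y hxy
      by_cases hx : x ∈ range e <;> by_cases hy : y ∈ range e
      · obtain ⟨a, rfl⟩ := hx
        obtain ⟨b, rfl⟩ := hy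
        rw [hge, hge] at hxy
        rw [hbij.1 (he.injective hxy)]
      · obtain ⟨a, rfl⟩ := hx
        rw [hge, hgr y hy] at hxy
        exact absurd ⟨_, hxy⟩ hy
      · obtain ⟨b, rfl⟩ := hy
        rw [hge, hgr x hx] at hxy
        exact absurd ⟨_, hxy.symm⟩ hx
      · rwa [hgr x hx, hgr y hy] at hxy
    · intro y
      by_cases hy : y ∈ range e
      · obtain ⟨b, rfl⟩ := hy
        obtain ⟨a, rfl⟩ := hbij.2 b
        exact ⟨e a, hge a⟩
      · exact ⟨y, hgr y hy⟩
  exact ⟨(Equiv.ofBijective g hb).toHomeomorphOfContinuousClosed hcont hcont.isClosedMap,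
    hge, hgC⟩

end Extension

/-- Two continuous surjections from a compact space to Hausdorff spaces with the same fibres have
homeomorphic targets. -/
theorem exists_homeomorph_of_same_fibers {Z A B : Type*} [TopologicalSpace Z] [TopologicalSpace A]
    [TopologicalSpace B] [CompactSpace Z] [T2Space A] [T2Space B] {f : Z → A} {g : Z → B}
    (hf : Continuous f) (hg : Continuous g) (hfs : Function.Surjective f)
    (hgs : Function.Surjective g) (hfg : ∀ z z', f z = f z' ↔ g z = g z') :
    ∃ h : A ≃ₜ B, ∀ z, h (f z) = g z := by
  have hqf : IsQuotientMap f := hf.isClosedMap.isQuotientMap hf hfs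
  have hcA : CompactSpace A := ⟨by rw [← hfs.range_eq]; exact isCompact_range hf⟩
  set h : A → B := fun a => g (hfs a).choose with hh
  have hhf : ∀ z, h (f z) = g z := fun z => (hfg _ _).1 (hfs (f z)).choose_spec
  have hcont : Continuous h := by
    rw [hqf.continuous_iff]
    exact hg.congr fun z => (hhf z).symm
  have hb : Function.Bijective h := by
    constructor
    · intro a b hab
      obtain ⟨z, rfl⟩ := hfs a
      obtain ⟨z', rfl⟩ := hfs b
      rw [hhf, hhf] at hab
      exact (hfg _ _).2 hab
    · intro b
      obtain ⟨z, rfl⟩ := hgs b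
      exact ⟨f z, hhf z⟩
  exact ⟨(Equiv.ofBijective h hb).toHomeomorphOfContinuousClosed hcont hcont.isClosedMap, hhf⟩

/-! ### Radial homeomorphisms with compact support. -/

section Radial

variable {E : Type*} [NormedAddCommGroup E] [NormedSpace ℝ E]

/-- The radial map of a normed space with profile `ρ`. -/
noncomputable def radialMap (ρ : ℝ → ℝ) (x : E) : E := (ρ ‖x‖ / ‖x‖) • x

theorem radialMap_smul {ρ : ℝ → ℝ} (h0 : ρ 0 = 0) {r : ℝ} (hr : 0 ≤ r) {x : E} (hx : ‖x‖ = 1) :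
    radialMap ρ (r • x) = ρ r • x := by
  rcases hr.eq_or_lt with rfl | hr
  · simp [radialMap, h0]
  · rw [radialMap, norm_smul, hx, Real.norm_of_nonneg hr.le, mul_one, smul_smul,
      div_mul_cancel₀ _ hr.ne']

theorem radialMap_of_eq {ρ : ℝ → ℝ} {x : E} (h : ρ ‖x‖ = ‖x‖) : radialMap ρ x = x := by
  rcases eq_or_ne x 0 with rfl | hx
  · simp [radialMap]
  · rw [radialMap, h, div_self (norm_ne_zero_iff.2 hx), one_smul]

theorem norm_radialMap {ρ : ℝ → ℝ} (h0 : ρ 0 = 0) (hpos : ∀ t, 0 ≤ t → 0 ≤ ρ t) (x : E) :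
    ‖radialMap ρ x‖ = ρ ‖x‖ := by
  rcases eq_or_ne x 0 with rfl | hx
  · simp [radialMap, h0]
  · rw [radialMap, norm_smul, Real.norm_of_nonneg (div_nonneg (hpos _ (norm_nonneg _))
      (norm_nonneg _)), div_mul_cancel₀ _ (norm_ne_zero_iff.2 hx)]

theorem continuous_radialMap {ρ : ℝ → ℝ} (hρ : Continuous ρ) (h0 : ρ 0 = 0)
    (hpos : ∀ t, 0 ≤ t → 0 ≤ ρ t) : Continuous (radialMap ρ : E → E) := by
  rw [continuous_iff_continuousAt]
  intro x
  rcases eq_or_ne x 0 with rfl | hx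
  · have : radialMap ρ (0 : E) = 0 := by simp [radialMap]
    rw [ContinuousAt, this, tendsto_zero_iff_norm_tendsto_zero]
    simp_rw [norm_radialMap h0 hpos]
    have : Continuous fun x : E => ρ ‖x‖ := by fun_prop
    simpa [h0] using this.tendsto 0
  · unfold radialMap
    have : ‖x‖ ≠ 0 := norm_ne_zero_iff.2 hx
    fun_prop (disch := assumption)

theorem bijective_radialMap {ρ : ℝ → ℝ} (hρ : Continuous ρ) (hmono : StrictMono ρ) (h0 : ρ 0 = 0)
    {R : ℝ} (hR : ∀ t, R ≤ t → ρ t = t) : Function.Bijective (radialMap ρ : E → E) := by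
  have hpos : ∀ t, 0 ≤ t → 0 ≤ ρ t := fun t ht => h0 ▸ hmono.monotone ht
  constructor
  · intro x y hxy
    have hn : ‖x‖ = ‖y‖ := hmono.injective <| by
      rw [← norm_radialMap h0 hpos x, ← norm_radialMap h0 hpos y, hxy]
    rcases eq_or_ne x 0 with rfl | hx
    · exact (norm_eq_zero.1 (by simpa using hn.symm)).symm
    · have hx' : 0 < ‖x‖ := norm_pos_iff.2 hx
      have : ρ ‖x‖ / ‖x‖ ≠ 0 := (div_pos (h0 ▸ hmono hx') hx').ne'
      unfold radialMap at hxy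
      rw [← hn] at hxy
      exact smul_right_injective E this hxy
  · intro y
    rcases eq_or_ne y 0 with rfl | hy
    · exact ⟨0, by simp [radialMap]⟩
    have hy' : 0 < ‖y‖ := norm_pos_iff.2 hy
    obtain ⟨t, ht, hty⟩ : ∃ t ∈ Icc 0 (max R ‖y‖), ρ t = ‖y‖ := by
      refine intermediate_value_Icc (le_max_of_le_right hy'.le) hρ.continuousOn ?_
      rw [h0, hR _ (le_max_left _ _)]
      exact ⟨hy'.le, le_max_right _ _⟩
    refine ⟨t • (‖y‖⁻¹ • y), ?_⟩
    have hn : ‖(‖y‖⁻¹ • y)‖ = 1 := by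
      rw [norm_smul, norm_inv, norm_norm, inv_mul_cancel₀ hy'.ne']
    rw [radialMap_smul h0 ht.1 hn, hty, smul_smul,
      mul_inv_cancel₀ hy'.ne', one_smul]

/-- A radial homeomorphism with compact support, extended along an open embedding. -/
theorem Topology.IsOpenEmbedding.exists_radial_homeomorph [ProperSpace E] {X : Type*}
    [TopologicalSpace X] [T2Space X] [CompactSpace X] {e : E → X} (he : IsOpenEmbedding e)
    {ρ : ℝ → ℝ} (hρ : Continuous ρ) (hmono : StrictMono ρ) (h0 : ρ 0 = 0) {R : ℝ}
    (hR : ∀ t, R ≤ t → ρ t = t) :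
    ∃ F : X ≃ₜ X, (∀ z, F (e z) = e (radialMap ρ z)) ∧ ∀ x, x ∉ range e → F x = x := by
  have hpos : ∀ t, 0 ≤ t → 0 ≤ ρ t := fun t ht => h0 ▸ hmono.monotone ht
  obtain ⟨F, hF, hF'⟩ := he.exists_homeomorph_extend (continuous_radialMap hρ h0 hpos)
    (bijective_radialMap hρ hmono h0 hR) (isCompact_closedBall (0 : E) R) (fun z hz => by
      refine radialMap_of_eq (hR _ ?_)
      simpa using le_of_lt (by simpa using hz))
  exact ⟨F, hF, fun x hx => hF' x fun h => hx (image_subset_range _ _ h)⟩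

end Radial

/-! ### Homogeneous extension of homeomorphisms to cones. -/

section Cone

variable {G G' : Type*} [AddCommGroup G'] [Module ℝ G'] [AddCommGroup G] [Module ℝ G]

/-- The cone with apex `0` over a set `T`. -/
def coneOver (T : Set G) : Set G := {x | x = 0 ∨ ∃ r : ℝ, 0 < r ∧ ∃ t ∈ T, x = r • t}

/-- The homogeneous extension of a map between level sets. -/
noncomputable def homExt (ℓ : G → ℝ) {T : Set G} (f : T → G') (x : G) : G' :=
  open scoped Classical in
  if h : (ℓ x)⁻¹ • x ∈ T then ℓ x • f ⟨_, h⟩ else 0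

variable {ℓ : G → ℝ} {ℓ' : G' → ℝ} {T : Set G} {T' : Set G'}

theorem homExt_smul (hℓ : ∀ (r : ℝ) x, 0 ≤ r → ℓ (r • x) = r * ℓ x) (hT : ∀ t ∈ T, ℓ t = 1)
    (f : T → G') {r : ℝ} (hr : 0 < r) (t : T) : homExt ℓ f (r • (t : G)) = r • f t := by
  have h1 : ℓ (r • (t : G)) = r := by rw [hℓ _ _ hr.le, hT _ t.2, mul_one]
  have h2 : (ℓ (r • (t : G)))⁻¹ • r • (t : G) = t := by
    rw [h1, smul_smul, inv_mul_cancel₀ hr.ne', one_smul]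
  unfold homExt
  rw [dif_pos (by rw [h2]; exact t.2)]
  congr 1
  exact congrArg f (Subtype.ext h2)

theorem homExt_zero (h0 : ℓ 0 = 0) (f : T → G') : homExt ℓ f 0 = 0 := by
  unfold homExt
  split_ifs <;> simp [h0]

/-- Away from the apex the defining formula is a composition of continuous maps. At the apex the
factor `ℓ x` tends to 0 while the other factor stays in the bounded set formed by 0 and the compact
range of `f`; this is where compactness of the level set enters. -/
theorem continuousOn_homExt [TopologicalSpace G] [TopologicalSpace G']
    [IsTopologicalAddGroup G] [ContinuousSMul ℝ G]
    [IsTopologicalAddGroup G'] [ContinuousSMul ℝ G']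
    (hℓc : Continuous ℓ) (hℓ : ∀ (r : ℝ) x, 0 ≤ r → ℓ (r • x) = r * ℓ x)
    (hT : ∀ t ∈ T, ℓ t = 1) (hTc : IsCompact T) {f : T → G'} (hf : Continuous f) :
    ContinuousOn (homExt ℓ f) (coneOver T) := by
  have h0 : ℓ 0 = 0 := by simpa using hℓ 0 0 le_rfl
  have hpos : ∀ x ∈ coneOver T, 0 < ℓ x → (ℓ x)⁻¹ • x ∈ T := by
    rintro x (rfl | ⟨r, hr, t, ht, rfl⟩) hx
    · simp [h0] at hx
    · rwa [hℓ _ _ hr.le, hT t ht, mul_one, smul_smul, inv_mul_cancel₀ hr.ne', one_smul]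
  intro x hx
  have hx' := hx
  rcases hx with rfl | ⟨r, hr, t, ht, rfl⟩
  · have hb : Bornology.IsVonNBounded ℝ (insert 0 (range f)) := by
      have : IsCompact (range f) := by
        have := isCompact_iff_compactSpace.1 hTc
        exact isCompact_range hf
      exact (this.insert 0).isVonNBounded ℝ
    rw [ContinuousWithinAt, homExt_zero h0]
    classical
    have : homExt ℓ f = fun x => ℓ x • (if h : (ℓ x)⁻¹ • x ∈ T then f ⟨_, h⟩ else 0) := by
      funext x
      unfold homExt
      split_ifs <;> simp
    rw [this]
    refine hb.smul_tendsto_zero (Eventually.of_forall fun x => ?_) ?_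
    · split_ifs
      · exact mem_insert_of_mem _ (mem_range_self _)
      · exact mem_insert _ _
    · exact (h0 ▸ hℓc.tendsto 0).mono_left nhdsWithin_le_nhds
  · set S : Set G := coneOver T ∩ {x | 0 < ℓ x} with hS
    have hxS : r • t ∈ S := ⟨hx', by
      rw [mem_ofPred_eq, hℓ _ _ hr.le, hT t ht, mul_one]; exact hr⟩
    have hSo : ContinuousOn (homExt ℓ f) S := by
      rw [continuousOn_iff_continuous_domRestrict]
      have h1 : Continuous fun y : S => (⟨(ℓ (y : G))⁻¹ • (y : G), hpos _ y.2.1 y.2.2⟩ : T) := by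
        refine Continuous.subtype_mk ?_ _
        refine Continuous.smul (Continuous.inv₀ (hℓc.comp continuous_subtype_val) ?_)
          continuous_subtype_val
        exact fun y => (y.2.2 : 0 < ℓ (y : G)).ne'
      refine ((hℓc.comp continuous_subtype_val).smul (hf.comp h1)).congr fun y => ?_
      rw [Set.domRestrict_apply, homExt, dif_pos (hpos _ y.2.1 y.2.2)]
      rfl
    refine (hSo _ hxS).mono_of_mem_nhdsWithin ?_
    exact inter_mem_nhdsWithin _ ((isOpen_lt continuous_const hℓc).mem_nhds hxS.2)

/-- A homeomorphism between compact level sets extends homogeneously to the cones over them. -/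
theorem exists_cone_homeomorph [TopologicalSpace G] [TopologicalSpace G']
    [IsTopologicalAddGroup G] [ContinuousSMul ℝ G]
    [IsTopologicalAddGroup G'] [ContinuousSMul ℝ G']
    (hℓc : Continuous ℓ) (hℓ : ∀ (r : ℝ) x, 0 ≤ r → ℓ (r • x) = r * ℓ x)
    (hT : ∀ t ∈ T, ℓ t = 1) (hTc : IsCompact T)
    (hℓc' : Continuous ℓ') (hℓ' : ∀ (r : ℝ) x, 0 ≤ r → ℓ' (r • x) = r * ℓ' x)
    (hT' : ∀ t ∈ T', ℓ' t = 1) (hTc' : IsCompact T') (f : T ≃ₜ T') :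
    ∃ Φ : coneOver T ≃ₜ coneOver T', (∀ x : coneOver T, ℓ' (Φ x) = ℓ x) ∧
      (∀ x : coneOver T, (x : G) = 0 → (Φ x : G') = 0) ∧
      ∀ (x : coneOver T) (r : ℝ) (t : T), 0 < r → (x : G) = r • (t : G) →
        (Φ x : G') = r • (f t : G') := by
  have h0 : ℓ 0 = 0 := by simpa using hℓ 0 0 le_rfl
  have h0' : ℓ' 0 = 0 := by simpa using hℓ' 0 0 le_rfl
  set g : G → G' := homExt ℓ fun t : T => (f t : G') with hg
  set g' : G' → G := homExt ℓ' fun t : T' => (f.symm t : G) with hg'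
  have e1 : ∀ (r : ℝ) (t : T), 0 < r → g (r • (t : G)) = r • (f t : G') := fun r t hr =>
    homExt_smul hℓ hT _ hr t
  have e2 : ∀ (r : ℝ) (t : T'), 0 < r → g' (r • (t : G')) = r • (f.symm t : G) := fun r t hr =>
    homExt_smul hℓ' hT' _ hr t
  have z1 : g 0 = 0 := homExt_zero h0 _
  have z2 : g' 0 = 0 := homExt_zero h0' _
  have m1 : ∀ x ∈ coneOver T, g x ∈ coneOver T' := by
    rintro x (rfl | ⟨r, hr, t, ht, rfl⟩)
    · exact Or.inl z1
    · exact Or.inr ⟨r, hr, f ⟨t, ht⟩, (f _).2, e1 r ⟨t, ht⟩ hr⟩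
  have m2 : ∀ x ∈ coneOver T', g' x ∈ coneOver T := by
    rintro x (rfl | ⟨r, hr, t, ht, rfl⟩)
    · exact Or.inl z2
    · exact Or.inr ⟨r, hr, f.symm ⟨t, ht⟩, (f.symm _).2, e2 r ⟨t, ht⟩ hr⟩
  have i1 : ∀ x ∈ coneOver T, g' (g x) = x := by
    rintro x (rfl | ⟨r, hr, t, ht, rfl⟩)
    · rw [z1, z2]
    · rw [e1 r ⟨t, ht⟩ hr, e2 r _ hr, f.symm_apply_apply]
  have i2 : ∀ x ∈ coneOver T', g (g' x) = x := by
    rintro x (rfl | ⟨r, hr, t, ht, rfl⟩)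
    · rw [z2, z1]
    · rw [e2 r ⟨t, ht⟩ hr, e1 r _ hr, f.apply_symm_apply]
  have c1 : ContinuousOn g (coneOver T) :=
    continuousOn_homExt hℓc hℓ hT hTc (continuous_subtype_val.comp f.continuous)
  have c2 : ContinuousOn g' (coneOver T') :=
    continuousOn_homExt hℓc' hℓ' hT' hTc' (continuous_subtype_val.comp f.symm.continuous)
  refine ⟨⟨⟨fun x => ⟨g x, m1 x x.2⟩, fun x => ⟨g' x, m2 x x.2⟩, fun x => Subtype.ext (i1 x x.2),
    fun x => Subtype.ext (i2 x x.2)⟩, ?_, ?_⟩, ?_, ?_, ?_⟩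
  · exact Continuous.subtype_mk (continuousOn_iff_continuous_domRestrict.1 c1) _
  · exact Continuous.subtype_mk (continuousOn_iff_continuous_domRestrict.1 c2) _
  · rintro ⟨x, rfl | ⟨r, hr, t, ht, rfl⟩⟩
    · change ℓ' (g 0) = ℓ 0
      rw [z1, h0, h0']
    · change ℓ' (g (r • t)) = _
      rw [e1 r ⟨t, ht⟩ hr, hℓ' _ _ hr.le, hT' _ (f _).2, hℓ _ _ hr.le, hT t ht]
  · rintro ⟨x, hx⟩ h
    change g x = 0
    rw [show x = 0 from h, z1]
  · rintro ⟨x, hx⟩ r t hr h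
    change g x = _
    rw [show x = r • (t : G) from h, e1 r t hr]

end Cone

/-! ### Brown's collapsing argument and the generalized Schoenflies theorem. -/

/-- A compact set that is the intersection of the iterated images `T^i R` of a set that can be
squeezed into small neighbourhoods of a point can be collapsed: there is a continuous surjection
whose only nontrivial fibre is this set. -/
theorem exists_collapse {X : Type*} [MetricSpace X] [CompactSpace X] {A R : Set X} (T : X ≃ₜ X)
    (hA : A.Nonempty) (hR : IsClosed R) (hRA : ∀ a ∈ A, R ∈ 𝓝 a) (hTA : ∀ a ∈ A, T a = a)
    (hTR : ∀ x ∈ R, T x ∈ R) (hinter : ∀ x, x ∉ A → ∃ i : ℕ, ∀ y ∈ R, T^[i] y ≠ x) (c : X)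
    (hsq : ∀ W ∈ 𝓝 c, ∃ S : X ≃ₜ X, (∀ x, x ∉ R → S x = x) ∧ ∀ x ∈ R, S (T x) ∈ W) :
    ∃ F : X → X, Continuous F ∧ Function.Surjective F ∧
      (∀ x y, F x = F y ↔ x = y ∨ (x ∈ A ∧ y ∈ A)) ∧ ∀ x, x ∉ R → F x = x := by
  classical
  have hsq' : ∀ (P : X ≃ₜ X) (i : ℕ), ∃ S : X ≃ₜ X, (∀ x, x ∉ R → S x = x) ∧
      ∀ x ∈ R, dist (P (S (T x))) (P c) < 1 / ((i : ℝ) + 1) := fun P i =>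
    hsq {z | dist (P z) (P c) < 1 / ((i : ℝ) + 1)}
      ((isOpen_lt (by fun_prop) continuous_const).mem_nhds (by
        simp only [mem_ofPred_eq, dist_self]; positivity))
  choose S hS1 hS2 using hsq'
  -- Recursively P_{i+1} = P_i ∘ S_i ∘ T, and U_i = T^i. The approximations h_i = P_i ∘ T^{-i}
  -- satisfy h_{i+1} = P_i ∘ S_i ∘ T^{-i}, so h_{i+1} and h_i differ only on T^i R, where `S` acts.
  let P : ℕ → X ≃ₜ X := fun i => Nat.rec (Homeomorph.refl X)
    (fun i Q => (T.trans (S Q i)).trans Q) i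
  have hP : ∀ i x, P (i + 1) x = P i (S (P i) i (T x)) := fun i x => rfl
  let U : ℕ → X ≃ₜ X := fun i => Nat.rec (Homeomorph.refl X) (fun _ Q => Q.trans T) i
  have hU : ∀ i x, U (i + 1) x = T (U i x) := fun i x => rfl
  have hUi : ∀ i x, U i x = T^[i] x := by
    intro i
    induction i with
    | zero => intro x; rfl
    | succ i ih => intro x; rw [hU, ih, Function.iterate_succ_apply']
  have hU' : ∀ i x, U (i + 1) x = U i (T x) := fun i x => by
    rw [hUi (i + 1), hUi i, Function.iterate_succ_apply]
  have hTS : ∀ i (y : X), (U (i + 1)).symm y = T.symm ((U i).symm y) := by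
    intro i y
    rw [Homeomorph.symm_apply_eq, hU', T.apply_symm_apply, (U i).apply_symm_apply]
  let h : ℕ → X → X := fun i x => P i ((U i).symm x)
  -- B_i = T^i R is a decreasing sequence with intersection `A`. D_i = P_i R is its image under h_i,
  -- and it shrinks to a point because each S_i was chosen to squeeze T R so far that P_i makes it
  -- small.
  let B : ℕ → Set X := fun i => {x | (U i).symm x ∈ R}
  let D : ℕ → Set X := fun i => {x | (P i).symm x ∈ R}
  have hbij : ∀ i, Function.Bijective (h i) := fun i =>
    (P i).bijective.comp (U i).symm.bijective
  have hhc : ∀ i, Continuous (h i) := fun i => (P i).continuous.comp (U i).symm.continuous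
  have hSR : ∀ Q i x, x ∈ R → S Q i x ∈ R := by
    intro Q i x hx
    by_contra hn
    have := hS1 Q i _ hn
    rw [(S Q i).injective this] at hn
    exact hn hx
  have hBmono : ∀ i, B (i + 1) ⊆ B i := by
    intro i x hx
    change (U (i + 1)).symm x ∈ R at hx
    change (U i).symm x ∈ R
    rw [hTS] at hx
    simpa using hTR _ hx
  have hBanti : Antitone B := antitone_nat_of_succ_le hBmono
  have hDmono : ∀ i, D (i + 1) ⊆ D i := by
    intro i x hx
    change (P (i + 1)).symm x ∈ R at hx
    change (P i).symm x ∈ R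
    have := hSR (P i) i _ (hTR _ hx)
    rwa [← (P i).symm_apply_apply (S (P i) i _), ← hP, Homeomorph.apply_symm_apply] at this
  have hDanti : Antitone D := antitone_nat_of_succ_le hDmono
  have hDdist : ∀ i, ∀ x ∈ D (i + 1), dist x (P i c) < 1 / ((i : ℝ) + 1) := by
    intro i x hx
    have := hS2 (P i) i _ hx
    rwa [← hP, Homeomorph.apply_symm_apply] at this
  have hstep : ∀ i x, x ∉ B i → h (i + 1) x = h i x := by
    intro i x hx
    change P (i + 1) ((U (i + 1)).symm x) = P i ((U i).symm x)
    rw [hP, hTS, T.apply_symm_apply, hS1 _ _ _ hx]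
  have hstable : ∀ i j x, i ≤ j → x ∉ B i → h j x = h i x := by
    intro i j x hij hx
    induction j, hij using Nat.le_induction with
    | base => rfl
    | succ j hj ih => rw [hstep j x fun hxj => hx (hBanti hj hxj), ih]
  have hBD : ∀ i x, h i x ∈ D i ↔ x ∈ B i := by
    intro i x
    change (P i).symm (P i ((U i).symm x)) ∈ R ↔ _
    rw [Homeomorph.symm_apply_apply]
    rfl
  have hBD' : ∀ i j x, i ≤ j → x ∈ B i → h j x ∈ D i := by
    intro i j x hij hx
    by_contra hn
    obtain ⟨y, hy⟩ := (hbij i).2 (h j x)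
    have hyB : y ∉ B i := fun hyB => hn (hy ▸ (hBD i y).2 hyB)
    rw [← hstable i j y hij hyB] at hy
    exact hyB ((hbij j).1 hy ▸ hx)
  have hAB : ∀ i, ∀ a ∈ A, (U i).symm a = a := by
    intro i a ha
    rw [Homeomorph.symm_apply_eq, hUi]
    exact ((Function.IsFixedPt.iterate (hTA a ha) i)).symm
  have hexit : ∀ x, x ∉ A → ∃ i, x ∉ B i := by
    intro x hx
    obtain ⟨i, hi⟩ := hinter x hx
    refine ⟨i, fun hxB => hi _ hxB ?_⟩
    rw [← hUi, Homeomorph.apply_symm_apply]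
  obtain ⟨a₀, ha₀⟩ := hA
  have hDc : ∀ i, IsClosed (D i) := fun i => hR.preimage (P i).symm.continuous
  have hDne : ∀ i, (D i).Nonempty := fun i =>
    ⟨h i a₀, (hBD i a₀).2 (by
      change (U i).symm a₀ ∈ R
      rw [hAB i a₀ ha₀]
      exact mem_of_mem_nhds (hRA a₀ ha₀))⟩
  obtain ⟨pt, hpt⟩ := IsCompact.nonempty_iInter_of_sequence_nonempty_isCompact_isClosed D hDmono
    hDne (hDc 0).isCompact hDc
  rw [mem_iInter] at hpt
  have hDsmall : ∀ ε > 0, ∃ i, ∀ x ∈ D i, dist x pt < ε := by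
    intro ε hε
    obtain ⟨i, hi⟩ := exists_nat_one_div_lt (half_pos hε)
    refine ⟨i + 1, fun x hx => ?_⟩
    have h1 := hDdist i x hx
    have h2 := hDdist i pt (hpt (i + 1))
    have := dist_triangle_right x pt (P i c)
    linarith
  have hptuniq : ∀ y, y ≠ pt → ∃ i, y ∉ D i := by
    intro y hy
    obtain ⟨i, hi⟩ := hDsmall (dist y pt) (dist_pos.2 hy)
    exact ⟨i, fun hyD => lt_irrefl _ (hi y hyD)⟩
  -- Off `A` the sequence h_i is eventually stationary, and its limit is taken; all of `A` goes to
  -- the common point of the sets D_i. Continuity at `A` holds because the neighbourhood B_i of `A`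
  -- is mapped into the small set D_i.
  let F : X → X := fun x => if hx : x ∈ A then pt else h (hexit x hx).choose x
  have hFA : ∀ x ∈ A, F x = pt := fun x hx => dif_pos hx
  have hAB' : ∀ i, ∀ a ∈ A, a ∈ B i := fun i a ha => by
    change (U i).symm a ∈ R
    rw [hAB i a ha]
    exact mem_of_mem_nhds (hRA a ha)
  have hF : ∀ i x, x ∉ B i → F x = h i x := by
    intro i x hx
    have hxA : x ∉ A := fun hxA => hx (hAB' i x hxA)
    have hs := (hexit x hxA).choose_spec
    have e : F x = h (hexit x hxA).choose x := dif_neg hxA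
    rw [e]
    rcases le_total i (hexit x hxA).choose with hle | hle
    · exact hstable _ _ _ hle hx
    · exact (hstable _ _ _ hle hs).symm
  have hFD : ∀ i x, x ∈ B i → F x ∈ D i := by
    intro i x hx
    by_cases hxA : x ∈ A
    · rw [hFA x hxA]; exact hpt i
    · obtain ⟨j, hj⟩ := hexit x hxA
      have hj' : x ∉ B (max i j) := fun hn => hj (hBanti (le_max_right i j) hn)
      rw [hF _ x hj']
      exact hBD' _ _ _ (le_max_left _ _) hx
  have hFne : ∀ x, x ∉ A → F x ≠ pt := by
    intro x hx hxp
    obtain ⟨i, hi⟩ := hexit x hx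
    rw [hF i x hi] at hxp
    exact hi ((hBD i x).1 (hxp ▸ hpt i))
  refine ⟨F, ?_, ?_, ?_, ?_⟩
  · rw [continuous_iff_continuousAt]
    intro x
    by_cases hx : x ∈ A
    · rw [Metric.continuousAt_iff']
      intro ε hε
      obtain ⟨i, hi⟩ := hDsmall ε hε
      have hBn : B i ∈ 𝓝 x := by
        refine (U i).symm.continuous.continuousAt.preimage_mem_nhds ?_
        rw [hAB i x hx]
        exact hRA x hx
      filter_upwards [hBn] with y hy
      rw [hFA x hx]
      exact hi _ (hFD i y hy)
    · obtain ⟨i, hi⟩ := hexit x hx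
      have hBo : IsOpen (B i)ᶜ := (hR.preimage (U i).symm.continuous).isOpen_compl
      refine (hhc i).continuousAt.congr ?_
      filter_upwards [hBo.mem_nhds hi] with y hy using (hF i y hy).symm
  · intro y
    by_cases hy : y = pt
    · exact ⟨a₀, by rw [hFA a₀ ha₀, hy]⟩
    · obtain ⟨i, hi⟩ := hptuniq y hy
      obtain ⟨x, rfl⟩ := (hbij i).2 y
      exact ⟨x, hF i x fun hxB => hi ((hBD i x).2 hxB)⟩
  · intro x y
    constructor
    · intro hxy
      by_cases hx : x ∈ A <;> by_cases hy : y ∈ A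
      · exact Or.inr ⟨hx, hy⟩
      · rw [hFA x hx] at hxy
        exact absurd hxy.symm (hFne y hy)
      · rw [hFA y hy] at hxy
        exact absurd hxy (hFne x hx)
      · obtain ⟨i, hi⟩ := hexit x hx
        obtain ⟨j, hj⟩ := hexit y hy
        rw [hF (max i j) x fun hn => hi (hBanti (le_max_left i j) hn),
          hF (max i j) y fun hn => hj (hBanti (le_max_right i j) hn)] at hxy
        exact Or.inl ((hbij _).1 hxy)
    · rintro (rfl | ⟨hx, hy⟩)
      · rfl
      · rw [hFA x hx, hFA y hy]
  · intro x hx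
    exact hF 0 x hx

/-- The profile of a push towards the unit sphere. The steep line passes through (ε/2, ε/2) and
exceeds 1 at t = ε, so for ε < 1 every t in [ε, 1] moves at least half of the way to 1, while 0 and
all t ≥ 1 stay fixed. -/
theorem strictMono_squeezeOut {ε : ℝ} (hε : 0 < ε) :
    StrictMono fun t : ℝ => max t (min (ε / 2 + (2 / ε) * (t - ε / 2)) ((1 + t) / 2)) := by
  intro a b hab
  have : (2 / ε) * (a - ε / 2) < (2 / ε) * (b - ε / 2) := by gcongr
  exact max_lt_max hab (min_lt_min (by linarith) (by linarith))

/-- The profile of a contraction: slope `c` near the origin, then a line of slope `C` through (r, r)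
that returns to the identity, which for C ≥ 1 holds from `r` on. -/
theorem strictMono_squeezeIn {c r C : ℝ} (hc : 0 < c) (hC : 0 < C) :
    StrictMono fun t : ℝ => min t (max (c * t) (r + C * (t - r))) := by
  intro a b hab
  have : C * (a - r) < C * (b - r) := by gcongr
  exact min_lt_min hab (max_lt_max (by gcongr) (by linarith))

/-- A profile that, for ε in (0, 1), takes radius ε to radius 1 and is the identity from radius 2
on. -/
theorem strictMono_stretch {ε : ℝ} (hε : 0 < ε) :
    StrictMono fun t : ℝ => max t (min (t / ε) (1 + (t - ε) / 2)) := by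
  intro a b hab
  exact max_lt_max hab (min_lt_min (by gcongr) (by linarith))

section Brown

variable {E X : Type*} [NormedAddCommGroup E] [NormedSpace ℝ E] [ProperSpace E]

/-- The complement of an open tame ball in a space that is a Euclidean space after removing
a point can be collapsed. -/
theorem exists_collapse_complement_ball [MetricSpace X] [CompactSpace X] {e θ : E → X}
    (he : IsOpenEmbedding e) (hθ : IsOpenEmbedding θ) (hθr : range θ = {e 0}ᶜ) :
    ∃ ε : ℝ, 0 < ε ∧ ε < 1 ∧ ((e '' ball 0 1)ᶜ : Set X).Nonempty ∧
      ∃ F : X → X, Continuous F ∧ Function.Surjective F ∧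
      (∀ x y, F x = F y ↔ x = y ∨ (x ∈ (e '' ball 0 1)ᶜ ∧ y ∈ (e '' ball 0 1)ᶜ)) ∧
      ∀ z ∈ closedBall (0 : E) ε, F (e z) = e z := by
  have hnotball : ∀ (r : ℝ) (z : E), e z ∈ e '' ball 0 r ↔ ‖z‖ < r := by
    intro r z
    rw [he.injective.mem_set_image, mem_ball_zero_iff]
  have hne : ((e '' ball 0 1)ᶜ : Set X).Nonempty := by
    have h0 : θ 0 ≠ e 0 := by
      have : θ 0 ∈ range θ := mem_range_self 0
      rw [hθr] at this
      exact this
    by_cases hc : θ 0 ∈ range e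
    · obtain ⟨z, hz⟩ := hc
      have hz0 : z ≠ 0 := by rintro rfl; exact h0 hz.symm
      refine ⟨e (‖z‖⁻¹ • z), ?_⟩
      rw [mem_compl_iff, hnotball, norm_smul, norm_inv, norm_norm,
        inv_mul_cancel₀ (norm_ne_zero_iff.2 hz0)]
      exact lt_irrefl _
    · exact ⟨θ 0, fun h => hc (image_subset_range _ _ h)⟩
  have hAr : ∀ r : ℝ, 0 < r → ((e '' ball 0 r)ᶜ : Set X) ⊆ range θ := by
    intro r hr x hx
    rw [hθr]
    rintro rfl
    exact hx ((hnotball r 0).2 (by simpa using hr))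
  -- Through the chart `θ` the complement of the half ball is a compact subset of the normed space,
  -- hence bounded. Radius 1/2 instead of 1 leaves room for a neighbourhood of the complement of the
  -- unit ball.
  obtain ⟨r₀, hr₀, hr₀A⟩ : ∃ r₀ : ℝ, 0 < r₀ ∧
      ∀ x ∈ ((e '' ball 0 (1 / 2))ᶜ : Set X), ∃ z, ‖z‖ < r₀ ∧ θ z = x := by
    have hcomp : IsCompact (θ ⁻¹' (e '' ball 0 (1 / 2))ᶜ) :=
      hθ.isInducing.isCompact_preimage_iff (hAr _ one_half_pos) |>.2
        (he.isOpenMap _ isOpen_ball).isClosed_compl.isCompact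
    obtain ⟨r, hr⟩ := hcomp.isBounded.subset_ball (0 : E)
    refine ⟨max r 1, by positivity, fun x hx => ?_⟩
    obtain ⟨z, rfl⟩ := hAr _ one_half_pos hx
    exact ⟨z, lt_of_lt_of_le (by simpa using hr hx) (le_max_left _ _), rfl⟩
  set R : Set X := θ '' closedBall 0 (r₀ + 1) with hR
  have hRc : IsClosed R := ((isCompact_closedBall _ _).image hθ.continuous).isClosed
  have hRq : e 0 ∉ R := by
    intro h
    have : e 0 ∈ range θ := image_subset_range _ _ h
    rw [hθr] at this
    exact this rfl
  obtain ⟨ε', hε', hε'R⟩ : ∃ ε' : ℝ, 0 < ε' ∧ ∀ z, ‖z‖ < ε' → e z ∉ R := by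
    have : e ⁻¹' Rᶜ ∈ 𝓝 (0 : E) :=
      he.continuous.continuousAt.preimage_mem_nhds (hRc.isOpen_compl.mem_nhds hRq)
    obtain ⟨ε', hε', h⟩ := Metric.mem_nhds_iff.1 this
    exact ⟨ε', hε', fun z hz => h (by simpa using hz)⟩
  obtain ⟨ε, hε, hε1, hεR⟩ : ∃ ε : ℝ, 0 < ε ∧ ε < 1 ∧ ∀ z, ‖z‖ ≤ ε → e z ∉ R := by
    refine ⟨min (ε' / 2) (1 / 2), by positivity, by
      have := min_le_right (ε' / 2) (1 / 2); linarith, fun z hz => hε'R z ?_⟩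
    have := min_le_left (ε' / 2) (1 / 2)
    linarith
  -- One application of `T` brings `R` into the complement of the half ball, where `θ` has norm
  -- below `r₀`. Iterating it halves the distance to radius 1 each time, so the images of `R` shrink
  -- to the complement of the unit ball.
  set τ : ℝ → ℝ := fun t => max t (min (ε / 2 + (2 / ε) * (t - ε / 2)) ((1 + t) / 2)) with hτ
  have hτc : Continuous τ := by fun_prop
  have hτm : StrictMono τ := strictMono_squeezeOut hε
  have hτ1 : ∀ t, 1 ≤ t → τ t = t := fun t ht =>
    max_eq_left ((min_le_right _ _).trans (by linarith))
  have hτ0 : τ 0 = 0 := by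
    refine max_eq_left ((min_le_left _ _).trans ?_)
    have : (2 / ε) * (0 - ε / 2) = -1 := by field_simp; norm_num
    rw [this]
    linarith
  have hτpos : ∀ t, 0 ≤ t → 0 ≤ τ t := fun t ht => hτ0 ▸ hτm.monotone ht
  have hτε : ∀ a t : ℝ, ε ≤ a → a ≤ 1 → a ≤ t → (1 + a) / 2 ≤ τ t := by
    intro a t ha ha1 hat
    refine le_trans ?_ (hτm.monotone hat)
    refine le_trans (le_min ?_ le_rfl) (le_max_right _ _)
    have h2 : (2 / ε) * (ε / 2) ≤ (2 / ε) * (a - ε / 2) := by gcongr; linarith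
    have h3 : (2 / ε) * (ε / 2) = 1 := by field_simp
    linarith
  obtain ⟨T, hT, hT'⟩ := he.exists_radial_homeomorph hτc hτm hτ0 hτ1
  have hRe : ∀ z, e z ∈ R → ε ≤ ‖z‖ := fun z hz => by
    by_contra hn
    exact hεR z (not_le.1 hn).le hz
  have hTA : ∀ x ∈ ((e '' ball 0 1)ᶜ : Set X), T x = x := by
    intro x hx
    by_cases hxr : x ∈ range e
    · obtain ⟨z, rfl⟩ := hxr
      rw [mem_compl_iff, hnotball, not_lt] at hx
      rw [hT, radialMap_of_eq (hτ1 _ hx)]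
    · exact hT' x hxr
  have hTR' : ∀ x ∈ R, T x ∈ ((e '' ball 0 (1 / 2))ᶜ : Set X) := by
    intro x hx
    by_cases hxr : x ∈ range e
    · obtain ⟨z, rfl⟩ := hxr
      rw [hT, mem_compl_iff, hnotball, norm_radialMap hτ0 hτpos, not_lt]
      refine le_trans ?_ (hτε ε ‖z‖ le_rfl hε1.le (hRe z hx))
      linarith
    · rw [hT' x hxr]
      exact fun h => hxr (image_subset_range _ _ h)
  have hhalf : ((e '' ball 0 (1 / 2))ᶜ : Set X) ⊆ R := by
    intro x hx
    obtain ⟨z, hz, rfl⟩ := hr₀A x hx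
    exact ⟨z, by simpa using (by linarith : ‖z‖ ≤ r₀ + 1), rfl⟩
  have hRA : ∀ a ∈ ((e '' ball 0 1)ᶜ : Set X), R ∈ 𝓝 a := by
    intro a ha
    have ha' : a ∈ ((e '' ball 0 (1 / 2))ᶜ : Set X) := fun h =>
      ha (image_mono (ball_subset_ball (by norm_num)) h)
    obtain ⟨z, hz, rfl⟩ := hr₀A a ha'
    refine Filter.mem_of_superset ((hθ.isOpenMap _ isOpen_ball).mem_nhds
      (mem_image_of_mem θ (show z ∈ ball 0 (r₀ + 1) by simpa using by linarith)))
      (image_mono ball_subset_closedBall)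
  have hiter : ∀ (i : ℕ) (y : X), y ∈ R → (y ∉ range e ∧ T^[i] y = y) ∨
      ∃ z, T^[i] y = e z ∧ 1 - (1 - ε) / 2 ^ i ≤ ‖z‖ := by
    intro i y hy
    by_cases hyr : y ∈ range e
    · right
      obtain ⟨z, rfl⟩ := hyr
      induction i with
      | zero => exact ⟨z, rfl, by simpa using hRe z hy⟩
      | succ i ih =>
        obtain ⟨z', hz', hn⟩ := ih
        refine ⟨radialMap τ z', by rw [Function.iterate_succ_apply', hz', hT], ?_⟩
        rw [norm_radialMap hτ0 hτpos]
        have h2 : (1 - ε) / 2 ^ i ≤ 1 - ε :=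
          div_le_self (by linarith) (one_le_pow₀ (by norm_num))
        have h3 : 0 ≤ (1 - ε) / 2 ^ i := div_nonneg (by linarith) (by positivity)
        refine le_trans (le_of_eq ?_) (hτε _ _ (by linarith) (by linarith) hn)
        rw [pow_succ]
        ring
    · left
      exact ⟨hyr, Function.IsFixedPt.iterate (hT' y hyr) i⟩
  obtain ⟨F, hF1, hF2, hF3, hF4⟩ := exists_collapse T hne hRc hRA hTA
    (fun x hx => hhalf (hTR' x hx)) (by
      intro x hx
      rw [mem_compl_iff, not_not] at hx
      obtain ⟨z, hz, rfl⟩ := hx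
      rw [mem_ball_zero_iff] at hz
      obtain ⟨i, hi⟩ : ∃ i : ℕ, (1 - ε) / 2 ^ i < 1 - ‖z‖ := by
        obtain ⟨i, hi⟩ := exists_pow_lt_of_lt_one (show 0 < 1 - ‖z‖ by linarith)
          (show (1 / 2 : ℝ) < 1 by norm_num)
        refine ⟨i, lt_of_le_of_lt ?_ hi⟩
        rw [one_div, inv_pow, div_eq_mul_inv]
        exact mul_le_of_le_one_left (by positivity) (by linarith)
      refine ⟨i, fun y hy hyz => ?_⟩
      rcases hiter i y hy with ⟨h1, h2⟩ | ⟨z', h1, h2⟩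
      · exact h1 ⟨z, by rw [← hyz, h2]⟩
      · rw [h1] at hyz
        rw [he.injective hyz] at h2
        linarith) (θ 0) (by
      intro W hW
      have hW' : θ ⁻¹' W ∈ 𝓝 (0 : E) := hθ.continuous.continuousAt.preimage_mem_nhds hW
      obtain ⟨l', hl', hlW⟩ := Metric.nhds_basis_closedBall.mem_iff.1 hW'
      set l := min l' r₀ with hl
      have hl0 : 0 < l := lt_min hl' hr₀
      -- The slope r₀ + 1 makes the second line vanish at `r₀`. Hence σ r₀ ≤ l, and the radial map
      -- of `σ` squeezes T R into `W` without moving anything outside `R`.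
      set σ : ℝ → ℝ := fun t =>
        min t (max ((l / r₀) * t) ((r₀ + 1) + (r₀ + 1) * (t - (r₀ + 1)))) with hσ
      have hσm : StrictMono σ := strictMono_squeezeIn (by positivity) (by positivity)
      have hσR : ∀ t, r₀ + 1 ≤ t → σ t = t := by
        intro t ht
        refine min_eq_left (le_trans ?_ (le_max_right _ _))
        nlinarith
      have hσ0 : σ 0 = 0 := by
        refine min_eq_left (le_trans ?_ (le_max_left _ _))
        simp
      have hσpos : ∀ t, 0 ≤ t → 0 ≤ σ t := fun t ht => hσ0 ▸ hσm.monotone ht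
      have hσr : σ r₀ ≤ l := by
        refine (min_le_right _ _).trans (max_le ?_ ?_)
        · rw [div_mul_cancel₀ _ hr₀.ne']
        · nlinarith
      obtain ⟨S, hS, hS'⟩ := hθ.exists_radial_homeomorph (by fun_prop : Continuous σ) hσm hσ0 hσR
      refine ⟨S, fun x hx => ?_, fun x hx => ?_⟩
      · by_cases hxr : x ∈ range θ
        · obtain ⟨z, rfl⟩ := hxr
          rw [hS, radialMap_of_eq (hσR _ ?_)]
          rw [hR, hθ.injective.mem_set_image, mem_closedBall_zero_iff, not_le] at hx
          exact hx.le
        · exact hS' x hxr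
      · obtain ⟨z, hz, hzx⟩ := hr₀A _ (hTR' x hx)
        rw [← hzx, hS]
        refine hlW (mem_closedBall_zero_iff.2 ?_)
        rw [norm_radialMap hσ0 hσpos]
        exact ((hσm.monotone hz.le).trans hσr).trans (min_le_left _ _))
  refine ⟨ε, hε, hε1, hne, F, hF1, hF2, hF3, fun z hz => hF4 _ (hεR z ?_)⟩
  simpa using hz

/-- The complement of an open tame ball in a space that is a Euclidean space after removing
a point is a closed ball. -/
theorem exists_homeomorph_complement_ball_of_range [MetricSpace X] [CompactSpace X] {e θ : E → X}
    (he : IsOpenEmbedding e) (hθ : IsOpenEmbedding θ) (hθr : range θ = {e 0}ᶜ) :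
    ∃ f : ((e '' ball 0 1)ᶜ : Set X) ≃ₜ closedBall (0 : E) 1,
      ∀ x, ((f x : E) ∈ sphere (0 : E) 1 ↔ (x : X) ∈ e '' sphere 0 1) := by
  obtain ⟨ε, hε, hε1, hne, F, hFc, hFs, hFinj, hFε⟩ := exists_collapse_complement_ball he hθ hθr
  have hnotball : ∀ (r : ℝ) (z : E), e z ∈ e '' ball 0 r ↔ ‖z‖ < r := by
    intro r z
    rw [he.injective.mem_set_image, mem_ball_zero_iff]
  set A : Set X := (e '' ball 0 1)ᶜ with hA
  set A' : Set X := (e '' ball 0 ε)ᶜ with hA'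
  have hAA' : A ⊆ A' := fun x hx h => hx (image_mono (ball_subset_ball hε1.le) h)
  have hFA' : ∀ x, F x ∈ A' ↔ x ∈ A' := by
    intro x
    rw [hA', mem_compl_iff, mem_compl_iff, not_iff_not]
    constructor
    · rintro ⟨z, hz, hzx⟩
      have h1 := hFε z (ball_subset_closedBall hz)
      rw [hzx] at h1
      rcases (hFinj _ _).1 h1 with h | ⟨h, -⟩
      · rw [← h]; exact ⟨z, hz, hzx⟩
      · rw [← hzx, hA, mem_compl_iff, hnotball] at h
        rw [mem_ball_zero_iff] at hz
        linarith
    · rintro ⟨z, hz, rfl⟩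
      rw [hFε z (ball_subset_closedBall hz)]
      exact ⟨z, hz, rfl⟩
  -- This map turns the shell ε ≤ ‖p‖ ≤ 1 inside out: radius ε goes to 1 and radius 1 to 0. So `g`,
  -- just like `F`, collapses `A` inside `A'` to one point and nothing else, but its image is
  -- visibly a closed ball.
  let m : E → E := fun p => (max 0 ((1 - ‖p‖) / (1 - ε)) * ‖p‖⁻¹) • p
  let g : X → E := Function.extend e m 0
  have hge : ∀ z, g (e z) = m z := fun z => he.injective.extend_apply _ _ z
  have hgA : ∀ x ∈ A, g x = 0 := by
    intro x hx
    by_cases hxr : x ∈ range e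
    · obtain ⟨z, rfl⟩ := hxr
      rw [hA, mem_compl_iff, hnotball, not_lt] at hx
      have : max 0 ((1 - ‖z‖) / (1 - ε)) = 0 :=
        max_eq_left (div_nonpos_of_nonpos_of_nonneg (by linarith) (by linarith))
      rw [hge]
      simp [m, this]
    · exact Function.extend_apply' _ _ _ (by simpa using hxr)
  have hmn : ∀ z : E, z ≠ 0 → ‖m z‖ = max 0 ((1 - ‖z‖) / (1 - ε)) := by
    intro z hz
    rw [norm_smul, norm_mul, norm_inv, norm_norm, mul_assoc,
      inv_mul_cancel₀ (norm_ne_zero_iff.2 hz), mul_one,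
      Real.norm_of_nonneg (le_max_left _ _)]
  have hz0 : ∀ z, e z ∈ A' → ε ≤ ‖z‖ ∧ z ≠ 0 := by
    intro z hz
    rw [hA', mem_compl_iff, hnotball, not_lt] at hz
    exact ⟨hz, norm_pos_iff.1 (hε.trans_le hz)⟩
  have hAr : ∀ x, x ∉ A → ∃ z, ‖z‖ < 1 ∧ e z = x := by
    intro x hx
    rw [hA, mem_compl_iff, not_not] at hx
    obtain ⟨z, hz, rfl⟩ := hx
    exact ⟨z, by simpa using hz, rfl⟩
  have hgn : ∀ x ∈ A', ‖g x‖ ≤ 1 := by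
    intro x hx
    by_cases hxA : x ∈ A
    · rw [hgA x hxA]; simp
    · obtain ⟨z, hz, rfl⟩ := hAr x hxA
      rw [hge, hmn z (hz0 z hx).2]
      refine max_le zero_le_one ?_
      rw [div_le_one (by linarith)]
      linarith [(hz0 z hx).1]
  have hgc : ContinuousOn g A' := by
    intro x hx
    refine ContinuousAt.continuousWithinAt ?_
    by_cases hxr : x ∈ range e
    · obtain ⟨z, rfl⟩ := hxr
      rw [← he.continuousAt_iff, show g ∘ e = m from funext hge]
      have : ‖z‖ ≠ 0 := norm_ne_zero_iff.2 (hz0 z hx).2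
      have h2 : 1 - ε ≠ 0 := by linarith
      fun_prop (disch := assumption)
    · have hcl : IsClosed (e '' closedBall (0 : E) 1) :=
        ((isCompact_closedBall _ _).image he.continuous).isClosed
      refine (continuousAt_const (y := (0 : E))).congr ?_
      filter_upwards [hcl.isOpen_compl.mem_nhds fun h => hxr (image_subset_range _ _ h)] with y hy
      exact (hgA y fun h => hy (image_mono ball_subset_closedBall h)).symm
  have hgpos : ∀ z : E, ‖z‖ < 1 → z ≠ 0 → m z ≠ 0 := by
    intro z hz hz0 h
    have := hmn z hz0
    rw [h, norm_zero, max_eq_right (div_nonneg (by linarith) (by linarith))] at this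
    have h3 : (1 - ‖z‖) / (1 - ε) > 0 := div_pos (by linarith) (by linarith)
    linarith
  have hginj : ∀ x ∈ A', ∀ y ∈ A', (g x = g y ↔ x = y ∨ (x ∈ A ∧ y ∈ A)) := by
    intro x hx y hy
    constructor
    · intro hxy
      by_cases hxA : x ∈ A <;> by_cases hyA : y ∈ A
      · exact Or.inr ⟨hxA, hyA⟩
      · obtain ⟨z, hz, rfl⟩ := hAr y hyA
        rw [hgA x hxA, hge] at hxy
        exact absurd hxy.symm (hgpos z hz (hz0 z hy).2)
      · obtain ⟨z, hz, rfl⟩ := hAr x hxA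
        rw [hgA y hyA, hge] at hxy
        exact absurd hxy (hgpos z hz (hz0 z hx).2)
      · left
        obtain ⟨z, hz, rfl⟩ := hAr x hxA
        obtain ⟨w, hw, rfl⟩ := hAr y hyA
        rw [hge, hge] at hxy
        have hz' := (hz0 z hx).2
        have hw' := (hz0 w hy).2
        have hn : ‖z‖ = ‖w‖ := by
          have h1 := hmn z hz'
          rw [hxy, hmn w hw', max_eq_right (div_nonneg (by linarith) (by linarith)),
            max_eq_right (div_nonneg (by linarith) (by linarith)),
            div_left_inj' (by linarith)] at h1
          linarith
        have hmz : m z = (max 0 ((1 - ‖z‖) / (1 - ε)) * ‖z‖⁻¹) • z := rfl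
        have hmw : m w = (max 0 ((1 - ‖w‖) / (1 - ε)) * ‖w‖⁻¹) • w := rfl
        rw [hmz, hmw, ← hn] at hxy
        have hc : max 0 ((1 - ‖z‖) / (1 - ε)) * ‖z‖⁻¹ ≠ 0 := by
          refine mul_ne_zero ?_ (inv_ne_zero (norm_ne_zero_iff.2 hz'))
          have h3 : (1 - ‖z‖) / (1 - ε) > 0 := div_pos (by linarith) (by linarith)
          rw [max_eq_right h3.le]
          exact h3.ne'
        rw [smul_right_injective E hc hxy]
    · rintro (rfl | ⟨hx, hy⟩)
      · rfl
      · rw [hgA x hx, hgA y hy]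
  have hcA' : CompactSpace A' :=
    isCompact_iff_compactSpace.1 (he.isOpenMap _ isOpen_ball).isClosed_compl.isCompact
  -- The quotient of `A'` by `A` is `A'` itself by means of `F`, and the closed ball by means of
  -- `g`.
  obtain ⟨k, hk⟩ := exists_homeomorph_of_same_fibers (Z := A') (A := A')
    (B := closedBall (0 : E) 1) (f := fun x => ⟨F x, (hFA' x).2 x.2⟩)
    (g := fun x => ⟨g x, mem_closedBall_zero_iff.2 (hgn x x.2)⟩)
    ((hFc.comp continuous_subtype_val).subtype_mk _)
    ((continuousOn_iff_continuous_domRestrict.1 hgc).subtype_mk _)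
    (by
      rintro ⟨y, hy⟩
      obtain ⟨x, rfl⟩ := hFs y
      exact ⟨⟨x, (hFA' x).1 hy⟩, rfl⟩)
    (by
      rintro ⟨y, hy⟩
      rw [mem_closedBall_zero_iff] at hy
      by_cases hy0 : y = 0
      · obtain ⟨a, ha⟩ := hne
        exact ⟨⟨a, hAA' ha⟩, Subtype.ext ((hgA a ha).trans hy0.symm)⟩
      · have hyn : 0 < ‖y‖ := norm_pos_iff.2 hy0
        set s : ℝ := 1 - (1 - ε) * ‖y‖ with hs
        have hs1 : ε ≤ s := by nlinarith
        have hs0 : 0 < s := hε.trans_le hs1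
        have hnz : ‖(s * ‖y‖⁻¹) • y‖ = s := by
          rw [norm_smul, norm_mul, norm_inv, norm_norm, mul_assoc, inv_mul_cancel₀ hyn.ne',
            mul_one, Real.norm_of_nonneg hs0.le]
        refine ⟨⟨e ((s * ‖y‖⁻¹) • y), ?_⟩, Subtype.ext ?_⟩
        · rw [hA', mem_compl_iff, hnotball, hnz]
          exact not_lt.2 hs1
        · change g (e _) = y
          have hm : m ((s * ‖y‖⁻¹) • y) = (max 0 ((1 - s) / (1 - ε)) * s⁻¹) • (s * ‖y‖⁻¹) • y := by
            simp only [m]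
            rw [hnz]
          have h4 : (1 - s) / (1 - ε) = ‖y‖ := by
            rw [hs]
            have : 1 - ε ≠ 0 := by linarith
            field_simp
            ring
          rw [hge, hm, h4, max_eq_right hyn.le, smul_smul]
          rw [show ‖y‖ * s⁻¹ * (s * ‖y‖⁻¹) = 1 by field_simp, one_smul])
    (by
      rintro ⟨x, hx⟩ ⟨y, hy⟩
      simp only [Subtype.mk.injEq]
      rw [hFinj, hginj x hx y hy])
  have hksphere : ∀ y : A', ((k y : E) ∈ sphere (0 : E) 1 ↔ (y : X) ∈ e '' sphere 0 ε) := by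
    rintro ⟨y, hy⟩
    obtain ⟨x, rfl⟩ := hFs y
    have hx : x ∈ A' := (hFA' x).1 hy
    have h1 : (k ⟨F x, hy⟩ : E) = g x := congrArg Subtype.val (hk ⟨x, hx⟩)
    rw [h1]
    constructor
    · intro h
      rw [mem_sphere_zero_iff_norm] at h
      by_cases hxA : x ∈ A
      · rw [hgA x hxA, norm_zero] at h
        norm_num at h
      · obtain ⟨z, hz, rfl⟩ := hAr x hxA
        rw [hge, hmn z (hz0 z hx).2,
          max_eq_right (div_nonneg (by linarith) (by linarith)), div_eq_one_iff_eq (by linarith)] at h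
        have hzε : ‖z‖ = ε := by linarith
        exact ⟨z, by simpa using hzε, (hFε z (by simpa using hzε.le)).symm⟩
    · rintro ⟨z, hz, hzx⟩
      change e z = F x at hzx
      rw [mem_sphere_zero_iff_norm] at hz
      rw [← hFε z (by simpa using hz.le)] at hzx
      have hzA : e z ∉ A := by
        rw [hA, mem_compl_iff, not_not, hnotball, hz]; exact hε1
      rcases (hFinj _ _).1 hzx with h | ⟨h, -⟩
      · rw [← h, mem_sphere_zero_iff_norm, hge, hmn z (norm_pos_iff.1 (hz ▸ hε)), hz,
          div_self (by linarith)]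
        simp
      · exact absurd h hzA
  -- The ball found so far is the complement of the ball of radius ε; a radial homeomorphism carries
  -- it to the complement of the unit ball.
  set ρ : ℝ → ℝ := fun t => max t (min (t / ε) (1 + (t - ε) / 2)) with hρ
  have hρm : StrictMono ρ := strictMono_stretch hε
  have hρ0 : ρ 0 = 0 := by
    refine max_eq_left ((min_le_left _ _).trans ?_)
    simp
  have hρε : ρ ε = 1 := by
    simp only [hρ, div_self hε.ne', sub_self, zero_div, add_zero, min_self]
    exact max_eq_right hε1.le
  have hρ2 : ∀ t, 2 ≤ t → ρ t = t := fun t ht =>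
    max_eq_left ((min_le_right _ _).trans (by linarith))
  have hρpos : ∀ t, 0 ≤ t → 0 ≤ ρ t := fun t ht => hρ0 ▸ hρm.monotone ht
  obtain ⟨G, hG, hG'⟩ := he.exists_radial_homeomorph (by fun_prop : Continuous ρ) hρm hρ0 hρ2
  have hGA : ∀ x, x ∈ A' ↔ G x ∈ A := by
    intro x
    by_cases hxr : x ∈ range e
    · obtain ⟨z, rfl⟩ := hxr
      rw [hG, hA, hA', mem_compl_iff, mem_compl_iff, hnotball, hnotball,
        norm_radialMap hρ0 hρpos, ← hρε, hρm.lt_iff_lt]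
    · rw [hG' x hxr]
      exact ⟨fun _ h => hxr (image_subset_range _ _ h), fun _ h => hxr (image_subset_range _ _ h)⟩
  have hGS : ∀ x, x ∈ e '' sphere 0 ε ↔ G x ∈ e '' sphere 0 1 := by
    intro x
    by_cases hxr : x ∈ range e
    · obtain ⟨z, rfl⟩ := hxr
      rw [hG, he.injective.mem_set_image, he.injective.mem_set_image, mem_sphere_zero_iff_norm,
        mem_sphere_zero_iff_norm, norm_radialMap hρ0 hρpos, ← hρε, hρm.injective.eq_iff]
    · rw [hG' x hxr]
      exact ⟨fun h => absurd (image_subset_range _ _ h) hxr,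
        fun h => absurd (image_subset_range _ _ h) hxr⟩
  refine ⟨(G.subtype hGA).symm.trans k, fun x => ?_⟩
  obtain ⟨x', rfl⟩ := (G.subtype hGA).surjective x
  rw [Homeomorph.trans_apply, Homeomorph.symm_apply_apply, hksphere, hGS]
  rfl

end Brown

/-- The complement of an open tame ball in a sphere is a closed ball. -/
theorem exists_homeomorph_complement_ball {X : Type*} [TopologicalSpace X] {n : ℕ}
    (hX : X ≃ₜ sphere (0 : EuclideanSpace ℝ (Fin (n + 1))) 1) {e : EuclideanSpace ℝ (Fin n) → X}
    (he : IsOpenEmbedding e) :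
    ∃ f : ((e '' ball 0 1)ᶜ : Set X) ≃ₜ closedBall (0 : EuclideanSpace ℝ (Fin n)) 1,
      ∀ x, ((f x : EuclideanSpace ℝ (Fin n)) ∈ sphere (0 : EuclideanSpace ℝ (Fin n)) 1 ↔
        (x : X) ∈ e '' sphere 0 1) := by
  set S := sphere (0 : EuclideanSpace ℝ (Fin (n + 1))) 1 with hS
  have hfr : Fact (Module.finrank ℝ (EuclideanSpace ℝ (Fin (n + 1))) = n + 1) := ⟨by simp⟩
  have he' : IsOpenEmbedding (hX ∘ e) := hX.isOpenEmbedding.comp he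
  -- Projecting from the centre of the removed ball makes the second chart miss exactly that point.
  set st := stereographic' n (hX (e 0)) with hst
  have hθ : IsOpenEmbedding st.symm :=
    st.symm.isOpenEmbedding (by simp [hst])
  have hθr : range st.symm = {(hX ∘ e) 0}ᶜ := by
    have h1 := st.symm.image_source_eq_target
    rw [st.symm_source, st.symm_target] at h1
    rw [← image_univ, ← stereographic'_target (n := n) (hX (e 0)), ← hst, h1, hst,
      stereographic'_source]
    rfl
  obtain ⟨f, hf⟩ := exists_homeomorph_complement_ball_of_range he' hθ hθr
  have hset : ∀ (s : Set (EuclideanSpace ℝ (Fin n))) (x : X), x ∈ e '' s ↔ hX x ∈ (hX ∘ e) '' s := by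
    intro s x
    rw [image_comp, hX.injective.mem_set_image]
  refine ⟨(hX.subtype fun x => not_congr (hset _ x)).trans f, fun x => ?_⟩
  rw [Homeomorph.trans_apply, hf, hset]
  rfl

/-! ### Realizations, cones over them, links and deletions. -/

namespace PreAbstractSimplicialComplex

section Cone

variable {V : Type*}

/-- The vertex `p` as a point of the realization. -/
noncomputable def vtx (p : V) : V → ℝ := Set.indicator {p} 1

@[simp] theorem vtx_self (p : V) : vtx p p = 1 := by simp [vtx]

theorem vtx_of_ne {p w : V} (h : w ≠ p) : vtx p w = 0 := by simp [vtx, h]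

theorem vtx_nonneg (p w : V) : 0 ≤ vtx p w := by
  rcases eq_or_ne w p with rfl | h
  · simp
  · rw [vtx_of_ne h]

theorem sum_vtx {F : Finset V} {p : V} (hp : p ∈ F) : ∑ w ∈ F, vtx p w = 1 := by
  classical
  rw [Finset.sum_eq_single_of_mem p hp fun w _ h => vtx_of_ne h, vtx_self]

variable (K : PreAbstractSimplicialComplex V)

/-- The cone over the realization of `K` in the space of functions on the vertices. -/
def coneSet : Set (V → ℝ) :=
  {x | (∀ w, 0 ≤ x w) ∧ ∃ s, (s = ∅ ∨ s ∈ K.faces) ∧ ∀ w, w ∉ s → x w = 0}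

/-- All vertices of `K` lie in `F`. -/
def SupportedOn (F : Finset V) : Prop := ∀ s ∈ K.faces, s ⊆ F

variable {K} {F : Finset V} {p : V}

theorem exists_supportedOn (h : K.faces.Finite) : ∃ F : Finset V, K.SupportedOn F := by
  classical
  exact ⟨h.toFinset.biUnion id, fun s hs => Finset.subset_biUnion_of_mem id (h.mem_toFinset.2 hs)⟩

theorem nonempty_of_mem_faces {s : Finset V} (hs : s ∈ K.faces) : s.Nonempty :=
  (K.isRelLowerSet_faces hs).1

theorem mem_faces_of_subset {s t : Finset V} (hs : s ∈ K.faces) (hts : t ⊆ s) (ht : t.Nonempty) :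
    t ∈ K.faces := (K.isRelLowerSet_faces hs).2 hts ht

theorem mem_vertexSet_of_mem {s : Finset V} (hs : s ∈ K.faces) {w : V} (hw : w ∈ s) :
    w ∈ K.vertexSet :=
  mem_faces_of_subset hs (by simpa using hw) (Finset.singleton_nonempty w)

theorem SupportedOn.mem (hF : K.SupportedOn F) {w : V} (hw : w ∈ K.vertexSet) : w ∈ F :=
  hF _ hw (Finset.mem_singleton_self w)

theorem mem_faces_of_pos {x : V → ℝ} (hx : x ∈ K.coneSet) {t : Finset V} (ht : t.Nonempty)
    (hpos : ∀ w ∈ t, 0 < x w) : t ∈ K.faces := by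
  obtain ⟨-, s, hs, hxs⟩ := hx
  have hts : t ⊆ s := fun w hw => by
    by_contra hn
    exact (hpos w hw).ne' (hxs w hn)
  rcases hs with rfl | hs
  · exact absurd (Finset.subset_empty.1 hts) ht.ne_empty
  · exact mem_faces_of_subset hs hts ht

theorem mem_vertexSet_of_pos {x : V → ℝ} (hx : x ∈ K.coneSet) {w : V} (hw : 0 < x w) :
    w ∈ K.vertexSet :=
  mem_faces_of_pos hx (Finset.singleton_nonempty w) (by simpa using hw)

theorem SupportedOn.eq_zero (hF : K.SupportedOn F) {x : V → ℝ} (hx : x ∈ K.coneSet) {w : V}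
    (hw : w ∉ F) : x w = 0 := by
  by_contra hn
  exact hw (hF.mem (mem_vertexSet_of_pos hx ((hx.1 w).lt_of_ne' hn)))

theorem zero_mem_coneSet : (0 : V → ℝ) ∈ K.coneSet :=
  ⟨fun _ => le_rfl, ∅, Or.inl rfl, fun _ _ => rfl⟩

theorem smul_mem_coneSet {x : V → ℝ} (hx : x ∈ K.coneSet) {r : ℝ} (hr : 0 ≤ r) :
    r • x ∈ K.coneSet := by
  obtain ⟨h0, s, hs, hxs⟩ := hx
  exact ⟨fun w => mul_nonneg hr (h0 w), s, hs, fun w hw => by simp [hxs w hw]⟩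

theorem sum_nonneg_of_mem_coneSet {x : V → ℝ} (hx : x ∈ K.coneSet) : 0 ≤ ∑ w ∈ F, x w :=
  Finset.sum_nonneg fun w _ => hx.1 w

theorem SupportedOn.mem_realization_iff (hF : K.SupportedOn F) {x : V → ℝ} :
    x ∈ K.realization ↔ x ∈ K.coneSet ∧ ∑ w ∈ F, x w = 1 := by
  constructor
  · rintro ⟨h0, s, hs, hxs, hsum⟩
    refine ⟨⟨h0, s, Or.inr hs, hxs⟩, ?_⟩
    rw [← hsum]
    exact (Finset.sum_subset (hF s hs) fun w _ hw => hxs w hw).symm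
  · rintro ⟨⟨h0, s, hs, hxs⟩, hsum⟩
    rcases hs with rfl | hs
    · have : ∑ w ∈ F, x w = 0 := Finset.sum_eq_zero fun w _ => hxs w (by simp)
      rw [this] at hsum
      norm_num at hsum
    · refine ⟨h0, s, hs, hxs, ?_⟩
      rw [← hsum]
      exact Finset.sum_subset (hF s hs) fun w _ hw => hxs w hw

theorem mem_coneSet_of_mem_realization {x : V → ℝ} (hx : x ∈ K.realization) : x ∈ K.coneSet :=
  ⟨hx.1, hx.2.imp fun _ h => ⟨Or.inr h.1, h.2.1⟩⟩

theorem exists_pos_of_mem_realization {x : V → ℝ} (hx : x ∈ K.realization) : ∃ w, 0 < x w := by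
  by_contra hn
  push Not at hn
  obtain ⟨h0, s, hs, hxs, hsum⟩ := hx
  rw [Finset.sum_eq_zero fun w _ => le_antisymm (hn w) (h0 w)] at hsum
  norm_num at hsum

theorem SupportedOn.le_one (hF : K.SupportedOn F) {x : V → ℝ} (hx : x ∈ K.realization) (w : V) :
    x w ≤ 1 := by
  obtain ⟨h, hsum⟩ := hF.mem_realization_iff.1 hx
  by_cases hw : w ∈ F
  · rw [← hsum]
    exact Finset.single_le_sum (fun w _ => h.1 w) hw
  · rw [hF.eq_zero h hw]
    exact zero_le_one

theorem SupportedOn.sum_pos (hF : K.SupportedOn F) {x : V → ℝ} (hx : x ∈ K.coneSet) (h0 : x ≠ 0) :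
    0 < ∑ w ∈ F, x w := by
  obtain ⟨w, hw⟩ := Function.ne_iff.1 h0
  have hw' : 0 < x w := (hx.1 w).lt_of_ne' hw
  refine Finset.sum_pos' (fun w _ => hx.1 w) ⟨w, ?_, hw'⟩
  by_contra hn
  exact hw (hF.eq_zero hx hn)

theorem SupportedOn.inv_smul_mem (hF : K.SupportedOn F) {x : V → ℝ} (hx : x ∈ K.coneSet)
    (h0 : x ≠ 0) : (∑ w ∈ F, x w)⁻¹ • x ∈ K.realization := by
  have h := hF.sum_pos hx h0
  refine hF.mem_realization_iff.2 ⟨smul_mem_coneSet hx (inv_nonneg.2 h.le), ?_⟩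
  simp only [Pi.smul_apply, smul_eq_mul]
  rw [← Finset.mul_sum, inv_mul_cancel₀ h.ne']

theorem SupportedOn.coneOver_realization (hF : K.SupportedOn F) :
    coneOver K.realization = K.coneSet := by
  ext x
  constructor
  · rintro (rfl | ⟨r, hr, t, ht, rfl⟩)
    · exact zero_mem_coneSet
    · exact smul_mem_coneSet (mem_coneSet_of_mem_realization ht) hr.le
  · intro hx
    by_cases h0 : x = 0
    · exact Or.inl h0
    · have h := hF.sum_pos hx h0
      exact Or.inr ⟨_, h, _, hF.inv_smul_mem hx h0, by
        rw [smul_smul, mul_inv_cancel₀ h.ne', one_smul]⟩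

/-- Only finitely many faces occur, each cut out by closed conditions, and all coordinates lie in
[0, 1]; Tychonoff's theorem takes care of an ambient set of labels that may be infinite. -/
theorem isCompact_realization (hfin : K.faces.Finite) : IsCompact K.realization := by
  obtain ⟨F, hF⟩ := exists_supportedOn hfin
  have hsub : K.realization ⊆ Set.pi univ fun _ : V => Icc (0 : ℝ) 1 := fun x hx w _ =>
    ⟨hx.1 w, hF.le_one hx w⟩
  refine (isCompact_univ_pi fun _ => isCompact_Icc).of_isClosed_subset ?_ hsub
  have : K.realization = ⋃ s ∈ K.faces,
      ({x : V → ℝ | ∀ w, 0 ≤ x w} ∩ {x | ∀ w, w ∉ s → x w = 0} ∩ {x | ∑ w ∈ s, x w = 1}) := by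
    ext x
    simp only [realization, mem_ofPred_eq, mem_iUnion, mem_inter_iff, exists_prop]
    grind
  rw [this]
  refine hfin.isClosed_biUnion fun s _ => ?_
  refine IsClosed.inter (IsClosed.inter ?_ ?_) ?_
  · simp only [ofPred_forall]
    exact isClosed_iInter fun w => isClosed_le continuous_const (continuous_apply w)
  · simp only [ofPred_forall]
    exact isClosed_iInter fun w => isClosed_iInter fun _ =>
      isClosed_eq (continuous_apply w) continuous_const
  · exact isClosed_eq (by fun_prop) continuous_const

theorem vtx_mem_realization (hp : p ∈ K.vertexSet) : vtx p ∈ K.realization :=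
  ⟨vtx_nonneg p, {p}, hp, fun w hw => vtx_of_ne (by simpa using hw), by simp⟩

theorem SupportedOn.link (hF : K.SupportedOn F) (s : Finset V) : (K.link s).SupportedOn F := by
  classical
  rintro t ⟨-, -, ht⟩
  exact Finset.subset_union_right.trans (hF _ (by convert ht))

theorem SupportedOn.deletion (hF : K.SupportedOn F) (v : V) : (K.deletion v).SupportedOn F :=
  fun t ht => hF t ht.1

theorem finite_link (h : K.faces.Finite) (s : Finset V) : (K.link s).faces.Finite := by
  classical
  obtain ⟨F, hF⟩ := exists_supportedOn h
  exact (F.powerset.finite_toSet).subset fun t ht => by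
    simpa using hF.link s t ht

theorem finite_deletion (h : K.faces.Finite) (v : V) : (K.deletion v).faces.Finite :=
  h.subset fun _ ht => ht.1

theorem mem_link_faces [DecidableEq V] {s t : Finset V} :
    t ∈ (K.link s).faces ↔ t.Nonempty ∧ Disjoint s t ∧ s ∪ t ∈ K.faces := by
  change (t.Nonempty ∧ Disjoint s t ∧ _) ↔ _
  refine and_congr_right fun _ => and_congr_right fun _ => ?_
  convert Iff.rfl

theorem mem_link_singleton_faces [DecidableEq V] {t : Finset V} :
    t ∈ (K.link {p}).faces ↔ t.Nonempty ∧ p ∉ t ∧ insert p t ∈ K.faces := by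
  rw [mem_link_faces, Finset.disjoint_singleton_left, Finset.insert_eq]

theorem link_link [DecidableEq V] {s t : Finset V} (h : Disjoint s t) :
    (K.link s).link t = K.link (s ∪ t) := by
  refine PreAbstractSimplicialComplex.ext (Set.ext fun r => ?_)
  rw [mem_link_faces, mem_link_faces, mem_link_faces, Finset.union_assoc,
    Finset.disjoint_union_right, Finset.disjoint_union_left]
  constructor
  · rintro ⟨h1, h2, -, h3, h4⟩
    exact ⟨h1, ⟨h3.2, h2⟩, h4⟩
  · rintro ⟨h1, h2, h3⟩
    exact ⟨h1, h2.2, h1.mono Finset.subset_union_right, ⟨h, h2.1⟩, h3⟩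

theorem link_link_comm {v : V} (h : p ≠ v) :
    (K.link {p}).link {v} = (K.link {v}).link {p} := by
  classical
  rw [link_link (by simpa using h), link_link (by simpa using h.symm), Finset.union_comm]

theorem deletion_link_singleton {v : V} (h : p ≠ v) :
    (K.deletion v).link {p} = (K.link {p}).deletion v := by
  classical
  refine PreAbstractSimplicialComplex.ext (Set.ext fun r => ?_)
  rw [mem_link_singleton_faces]
  change _ ∧ _ ∧ (_ ∈ K.faces ∧ _) ↔ r ∈ (K.link {p}).faces ∧ _
  rw [mem_link_singleton_faces, Finset.mem_insert]
  have := h.symm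
  tauto

theorem link_faces_subset_deletion : (K.link {p}).faces ⊆ (K.deletion p).faces := by
  classical
  intro t ht
  rw [mem_link_singleton_faces] at ht
  exact ⟨mem_faces_of_subset ht.2.2 (Finset.subset_insert _ _) ht.1, ht.2.1⟩

theorem link_faces_subset {s : Finset V} : (K.link s).faces ⊆ K.faces := by
  classical
  intro t ht
  rw [mem_link_faces] at ht
  exact mem_faces_of_subset ht.2.2 Finset.subset_union_right ht.1

theorem mem_link_vertexSet [DecidableEq V] {v : V} :
    v ∈ (K.link {p}).vertexSet ↔ v ≠ p ∧ {p, v} ∈ K.faces := by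
  change {v} ∈ (K.link {p}).faces ↔ _
  rw [mem_link_singleton_faces]
  simp [eq_comm]

theorem mem_link_vertexSet_comm {v : V} :
    v ∈ (K.link {p}).vertexSet ↔ p ∈ (K.link {v}).vertexSet := by
  classical
  rw [mem_link_vertexSet, mem_link_vertexSet, ne_comm, Finset.pair_comm]

theorem ne_of_mem_link_vertexSet {v : V} (h : v ∈ (K.link {p}).vertexSet) : v ≠ p := by
  classical
  exact (mem_link_vertexSet.1 h).1

theorem coneSet_mono {L : PreAbstractSimplicialComplex V} (h : K.faces ⊆ L.faces) :
    K.coneSet ⊆ L.coneSet := fun _ hx => ⟨hx.1, hx.2.imp fun _ hs => ⟨hs.1.imp_right (@h _), hs.2⟩⟩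

theorem realization_mono {L : PreAbstractSimplicialComplex V} (h : K.faces ⊆ L.faces) :
    K.realization ⊆ L.realization := fun _ hx => ⟨hx.1, hx.2.imp fun _ hs => ⟨h hs.1, hs.2⟩⟩

theorem mem_coneSet_deletion_iff {x : V → ℝ} :
    x ∈ (K.deletion p).coneSet ↔ x ∈ K.coneSet ∧ x p = 0 := by
  classical
  constructor
  · rintro ⟨h0, s, hs, hxs⟩
    refine ⟨⟨h0, s, hs.imp_right And.left, hxs⟩, hxs p ?_⟩
    rcases hs with rfl | hs
    · simp
    · exact hs.2
  · rintro ⟨⟨h0, s, hs, hxs⟩, hp⟩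
    refine ⟨h0, s.erase p, ?_, fun w hw => ?_⟩
    · rcases (s.erase p).eq_empty_or_nonempty with h | h
      · exact Or.inl h
      · rcases hs with rfl | hs
        · simp at h
        · exact Or.inr ⟨mem_faces_of_subset hs (Finset.erase_subset _ _) h,
            Finset.notMem_erase _ _⟩
    · by_cases hwp : w = p
      · rw [hwp, hp]
      · exact hxs w fun h => hw (Finset.mem_erase.2 ⟨hwp, h⟩)

theorem mem_realization_deletion_iff {x : V → ℝ} :
    x ∈ (K.deletion p).realization ↔ x ∈ K.realization ∧ x p = 0 := by
  constructor
  · rintro ⟨h0, s, hs, hxs, hsum⟩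
    exact ⟨⟨h0, s, hs.1, hxs, hsum⟩, hxs p hs.2⟩
  · classical
    rintro ⟨⟨h0, s, hs, hxs, hsum⟩, hp⟩
    have hsum' : ∑ w ∈ s.erase p, x w = 1 := by rw [Finset.sum_erase s hp, hsum]
    refine ⟨h0, s.erase p, ⟨mem_faces_of_subset hs (Finset.erase_subset _ _) ?_,
      Finset.notMem_erase _ _⟩, fun w hw => ?_, hsum'⟩
    · by_contra hn
      rw [Finset.not_nonempty_iff_eq_empty] at hn
      rw [hn] at hsum'
      simp at hsum'
    · by_cases hwp : w = p
      · rw [hwp, hp]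
      · exact hxs w fun h => hw (Finset.mem_erase.2 ⟨hwp, h⟩)

theorem eq_zero_of_mem_coneSet_link {x : V → ℝ} (hx : x ∈ (K.link {p}).coneSet) : x p = 0 :=
  (mem_coneSet_deletion_iff.1 (coneSet_mono link_faces_subset_deletion hx)).2

/-- A support that contains `p` is a face exactly when the rest of it is empty or a face of the
link. Cones are used because the condition on the rest is then free of any normalisation of the
total mass. -/
theorem vtx_add_mem_coneSet_iff (hp : p ∈ K.vertexSet) {y : V → ℝ} (hy : y p = 0) {r : ℝ}
    (hr : 0 < r) : r • vtx p + y ∈ K.coneSet ↔ y ∈ (K.link {p}).coneSet := by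
  classical
  constructor
  · rintro ⟨h0, s, hs, hxs⟩
    have hps : p ∈ s := by
      by_contra hn
      have := hxs p hn
      simp [hy] at this
      exact hr.ne' this
    have hsf : s ∈ K.faces := by
      rcases hs with rfl | hs
      · simp at hps
      · exact hs
    have hne : ∀ w, w ≠ p → (r • vtx p + y) w = y w := fun w hw => by simp [vtx_of_ne hw]
    refine ⟨fun w => ?_, s.erase p, ?_, fun w hw => ?_⟩
    · by_cases hw : w = p
      · rw [hw, hy]
      · rw [← hne w hw]; exact h0 w
    · rcases (s.erase p).eq_empty_or_nonempty with h | h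
      · exact Or.inl h
      · exact Or.inr (mem_link_singleton_faces.2 ⟨h, Finset.notMem_erase _ _, by
          rwa [Finset.insert_erase hps]⟩)
    · by_cases hwp : w = p
      · rw [hwp, hy]
      · rw [← hne w hwp]
        exact hxs w fun h => hw (Finset.mem_erase.2 ⟨hwp, h⟩)
  · rintro ⟨h0, s, hs, hxs⟩
    refine ⟨fun w => add_nonneg (mul_nonneg hr.le (vtx_nonneg p w)) (h0 w), insert p s,
      Or.inr ?_, fun w hw => ?_⟩
    · rcases hs with rfl | hs
      · exact hp
      · exact (mem_link_singleton_faces.1 hs).2.2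
    · rw [Finset.mem_insert, not_or] at hw
      simp [vtx_of_ne hw.1, hxs w hw.2]

theorem sub_vtx_mem_coneSet_deletion (hp : p ∈ K.vertexSet) {x : V → ℝ} (hx : x ∈ K.coneSet) :
    x - x p • vtx p ∈ (K.deletion p).coneSet := by
  have h0 : (x - x p • vtx p) p = 0 := by simp
  rcases (hx.1 p).eq_or_lt with h | h
  · rw [← h, zero_smul, sub_zero]
    exact mem_coneSet_deletion_iff.2 ⟨hx, h.symm⟩
  · refine coneSet_mono link_faces_subset_deletion ((vtx_add_mem_coneSet_iff hp h0 h).1 ?_)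
    simpa using hx

theorem sub_vtx_mem_coneSet_link (hp : p ∈ K.vertexSet) {x : V → ℝ} (hx : x ∈ K.coneSet)
    (h : 0 < x p) : x - x p • vtx p ∈ (K.link {p}).coneSet := by
  have h0 : (x - x p • vtx p) p = 0 := by simp
  exact (vtx_add_mem_coneSet_iff hp h0 h).1 (by simpa using hx)

end Cone

/-! ### Open stars as Euclidean spaces. -/

section Star

variable {V : Type*} {K : PreAbstractSimplicialComplex V} {F : Finset V} {p : V}

/-- The open star of `p` is the open cone over the link of `p`. -/
theorem exists_star_homeomorph (hF : K.SupportedOn F) (hp : p ∈ K.vertexSet) :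
    ∃ Θ : (K.link {p}).coneSet ≃ₜ {x : K.realization | 0 < (x : V → ℝ) p},
      (∀ y : (K.link {p}).coneSet, ((Θ y : K.realization) : V → ℝ) =
        (1 + ∑ w ∈ F, (y : V → ℝ) w)⁻¹ • (vtx p + (y : V → ℝ))) ∧
      ∀ x, (Θ.symm x : V → ℝ) =
        (((x : K.realization) : V → ℝ) p)⁻¹ • ((x : K.realization) : V → ℝ) - vtx p := by
  have hpos : ∀ y ∈ (K.link {p}).coneSet, 0 < 1 + ∑ w ∈ F, y w := fun y hy => by
    have := sum_nonneg_of_mem_coneSet (F := F) hy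
    positivity
  have hmem : ∀ y ∈ (K.link {p}).coneSet,
      (1 + ∑ w ∈ F, y w)⁻¹ • (vtx p + y) ∈ K.realization := by
    intro y hy
    have h := hpos y hy
    refine hF.mem_realization_iff.2 ⟨smul_mem_coneSet ?_ (inv_nonneg.2 h.le), ?_⟩
    · have := (vtx_add_mem_coneSet_iff hp (eq_zero_of_mem_coneSet_link hy) one_pos).2 hy
      rwa [one_smul] at this
    · simp only [Pi.smul_apply, Pi.add_apply, smul_eq_mul]
      rw [← Finset.mul_sum, Finset.sum_add_distrib, sum_vtx (hF.mem hp), inv_mul_cancel₀ h.ne']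
  have hval : ∀ y ∈ (K.link {p}).coneSet,
      ((1 + ∑ w ∈ F, y w)⁻¹ • (vtx p + y)) p = (1 + ∑ w ∈ F, y w)⁻¹ := fun y hy => by
    simp [eq_zero_of_mem_coneSet_link hy]
  have hmem' : ∀ x ∈ K.realization, 0 < x p → (x p)⁻¹ • x - vtx p ∈ (K.link {p}).coneSet := by
    intro x hx hxp
    have h1 : (x p)⁻¹ • x ∈ K.coneSet :=
      smul_mem_coneSet (mem_coneSet_of_mem_realization hx) (inv_nonneg.2 hxp.le)
    have h2 : ((x p)⁻¹ • x) p = 1 := by simp [hxp.ne']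
    have := sub_vtx_mem_coneSet_link hp h1 (by rw [h2]; exact one_pos)
    rwa [h2, one_smul] at this
  -- A point of the open star is rescaled until its `p`-coordinate is 1, and the vertex is
  -- subtracted; conversely the vertex is added and the total mass normalised.
  refine ⟨⟨⟨fun y => ⟨⟨_, hmem y y.2⟩, ?_⟩, fun x => ⟨_, hmem' x.1 x.1.2 x.2⟩, ?_, ?_⟩, ?_, ?_⟩,
    fun y => rfl, fun x => rfl⟩
  · change 0 < ((1 + ∑ w ∈ F, (y : V → ℝ) w)⁻¹ • (vtx p + (y : V → ℝ))) p
    rw [hval y y.2]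
    exact inv_pos.2 (hpos y y.2)
  · rintro ⟨y, hy⟩
    refine Subtype.ext ?_
    change (((1 + ∑ w ∈ F, y w)⁻¹ • (vtx p + y)) p)⁻¹ • ((1 + ∑ w ∈ F, y w)⁻¹ • (vtx p + y)) -
      vtx p = y
    rw [hval y hy, inv_inv, smul_smul, mul_inv_cancel₀ (hpos y hy).ne', one_smul,
      add_sub_cancel_left]
  · rintro ⟨⟨x, hx⟩, hxp⟩
    refine Subtype.ext (Subtype.ext ?_)
    change (1 + ∑ w ∈ F, ((x p)⁻¹ • x - vtx p) w)⁻¹ • (vtx p + ((x p)⁻¹ • x - vtx p)) = x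
    have hxp' : 0 < x p := hxp
    have : ∑ w ∈ F, ((x p)⁻¹ • x - vtx p) w = (x p)⁻¹ - 1 := by
      simp only [Pi.sub_apply, Pi.smul_apply, smul_eq_mul, Finset.sum_sub_distrib]
      rw [← Finset.mul_sum, sum_vtx (hF.mem hp), (hF.mem_realization_iff.1 hx).2, mul_one]
    rw [this, add_sub_cancel, add_sub_cancel, inv_inv, smul_smul, mul_inv_cancel₀ hxp'.ne',
      one_smul]
  · refine Continuous.subtype_mk (Continuous.subtype_mk ?_ _) _
    refine Continuous.smul (Continuous.inv₀ ?_ fun y : (K.link {p}).coneSet => (hpos y y.2).ne') ?_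
    · exact continuous_const.add (continuous_finsetSum _ fun w _ =>
        (continuous_apply w).comp continuous_subtype_val)
    · exact continuous_const.add continuous_subtype_val
  · refine Continuous.subtype_mk ?_ _
    have hc : Continuous fun x : {x : K.realization | 0 < (x : V → ℝ) p} =>
        ((x : K.realization) : V → ℝ) := continuous_subtype_val.comp continuous_subtype_val
    exact (Continuous.smul (Continuous.inv₀ ((continuous_apply p).comp hc)
      fun x => (show 0 < ((x : K.realization) : V → ℝ) p from x.2).ne') hc).sub continuous_const

theorem isOpen_star : IsOpen {x : K.realization | 0 < (x : V → ℝ) p} :=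
  isOpen_lt continuous_const ((continuous_apply p).comp continuous_subtype_val)

/-- If the link of `p` is a sphere, the open star of `p` is a Euclidean space. -/
theorem exists_star_embedding (hF : K.SupportedOn F) (hfin : K.faces.Finite)
    (hp : p ∈ K.vertexSet) {n : ℕ}
    (ψ : sphere (0 : EuclideanSpace ℝ (Fin n)) 1 ≃ₜ (K.link {p}).realization) :
    ∃ e : EuclideanSpace ℝ (Fin n) → K.realization, IsOpenEmbedding e ∧
      range e = {x : K.realization | 0 < (x : V → ℝ) p} ∧
      (∀ w, (e w : V → ℝ) p = (1 + ‖w‖)⁻¹) ∧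
      ∀ (r : ℝ) (z : sphere (0 : EuclideanSpace ℝ (Fin n)) 1), 0 < r →
        (e (r • (z : EuclideanSpace ℝ (Fin n))) : V → ℝ) =
          (1 + r)⁻¹ • (vtx p + r • (ψ z : V → ℝ)) := by
  have hcone : coneOver (sphere (0 : EuclideanSpace ℝ (Fin n)) 1) = univ := by
    refine eq_univ_of_forall fun x => ?_
    by_cases hx : x = 0
    · exact Or.inl hx
    · refine Or.inr ⟨‖x‖, norm_pos_iff.2 hx, ‖x‖⁻¹ • x, ?_, ?_⟩
      · rw [mem_sphere_zero_iff_norm, norm_smul, norm_inv, norm_norm,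
          inv_mul_cancel₀ (norm_ne_zero_iff.2 hx)]
      · rw [smul_smul, mul_inv_cancel₀ (norm_ne_zero_iff.2 hx), one_smul]
  have hFl := hF.link {p}
  obtain ⟨Φ, h1, h2, h3⟩ := exists_cone_homeomorph
    (ℓ := fun x : EuclideanSpace ℝ (Fin n) => ‖x‖) (ℓ' := fun y : V → ℝ => ∑ w ∈ F, y w)
    (T := sphere (0 : EuclideanSpace ℝ (Fin n)) 1) (T' := (K.link {p}).realization)
    continuous_norm (fun r x hr => by rw [norm_smul, Real.norm_of_nonneg hr])
    (fun t ht => by simpa using ht) (isCompact_sphere _ _) (by fun_prop)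
    (fun r x _ => by simp [Finset.mul_sum]) (fun t ht => (hFl.mem_realization_iff.1 ht).2)
    (isCompact_realization (finite_link hfin _)) ψ
  obtain ⟨Θ, hΘ, -⟩ := exists_star_homeomorph hF hp
  let Ψ : EuclideanSpace ℝ (Fin n) ≃ₜ {x : K.realization | 0 < (x : V → ℝ) p} :=
    (Homeomorph.Set.univ _).symm.trans ((Homeomorph.setCongr hcone.symm).trans
      (Φ.trans ((Homeomorph.setCongr hFl.coneOver_realization).trans Θ)))
  have hΨ : ∀ w, ((Ψ w : K.realization) : V → ℝ) =
      (1 + ‖w‖)⁻¹ • (vtx p + (Φ ⟨w, hcone ▸ mem_univ w⟩ : V → ℝ)) := by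
    intro w
    have := hΘ ⟨Φ ⟨w, hcone ▸ mem_univ w⟩, hFl.coneOver_realization ▸ (Φ _).2⟩
    rw [h1 ⟨w, hcone ▸ mem_univ w⟩] at this
    exact this
  refine ⟨fun w => (Ψ w : K.realization),
    isOpen_star.isOpenEmbedding_subtypeVal.comp Ψ.isOpenEmbedding, ?_, ?_, ?_⟩
  · rw [show (fun w => (Ψ w : K.realization)) = Subtype.val ∘ Ψ from rfl, range_comp,
      Ψ.surjective.range_eq, image_univ, Subtype.range_coe]
  · intro w
    rw [hΨ]
    have : (Φ ⟨w, hcone ▸ mem_univ w⟩ : V → ℝ) p = 0 :=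
      eq_zero_of_mem_coneSet_link (hFl.coneOver_realization.subset (Φ _).2)
    simp [this]
  · intro r z hr
    have hn : ‖r • (z : EuclideanSpace ℝ (Fin n))‖ = r := by
      rw [norm_smul, Real.norm_of_nonneg hr.le, norm_eq_of_mem_sphere, mul_one]
    rw [hΨ, hn, h3 _ r z hr rfl]

end Star

end PreAbstractSimplicialComplex

/-! ### Charts that flatten the link of a vertex, and collars. -/

namespace PreAbstractSimplicialComplex

variable {V : Type*} {K : PreAbstractSimplicialComplex V} {F : Finset V} {p v : V}
  {B : Type*} [NormedAddCommGroup B] [NormedSpace ℝ B] [ProperSpace B]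

/-- The cone over a complex whose realization is a closed ball. -/
theorem exists_cone_ball_homeomorph (hF : K.SupportedOn F) (hfin : K.faces.Finite)
    (β : K.realization ≃ₜ closedBall (0 : B) 1) :
    ∃ Φ : K.coneSet ≃ₜ {q : B × ℝ | ‖q.1‖ ≤ q.2},
      (∀ y, (Φ y : B × ℝ).2 = ∑ w ∈ F, (y : V → ℝ) w) ∧
      ∀ (y : K.coneSet) (r : ℝ) (t : K.realization), 0 < r → (y : V → ℝ) = r • (t : V → ℝ) →
        (Φ y : B × ℝ).1 = r • (β t : B) := by
  set T' : Set (B × ℝ) := closedBall 0 1 ×ˢ {1} with hT'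
  have hcone : coneOver T' = {q : B × ℝ | ‖q.1‖ ≤ q.2} := by
    ext ⟨w, ρ⟩
    constructor
    · rintro (h | ⟨r, hr, ⟨a, b⟩, ⟨ha, hb⟩, h⟩)
      · rw [h]; simp
      · rw [h]
        simp only [mem_closedBall_zero_iff, mem_singleton_iff] at ha hb
        simp only [Prod.smul_mk, mem_ofPred_eq, norm_smul, Real.norm_of_nonneg hr.le, hb,
          smul_eq_mul, mul_one]
        exact mul_le_of_le_one_right hr.le ha
    · intro h
      change ‖w‖ ≤ ρ at h
      rcases ((norm_nonneg w).trans h).eq_or_lt with h0 | h0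
      · left
        rw [← h0] at h ⊢
        rw [norm_le_zero_iff.1 h]
        rfl
      · right
        refine ⟨ρ, h0, (ρ⁻¹ • w, 1), ⟨?_, rfl⟩, ?_⟩
        · simp only [mem_closedBall_zero_iff, norm_smul, norm_inv, Real.norm_of_nonneg h0.le]
          rwa [inv_mul_le_iff₀ h0, mul_one]
        · simp [smul_smul, h0.ne']
  let f : K.realization ≃ₜ T' := β.trans
    { toFun := fun x => ⟨(x, 1), x.2, rfl⟩
      invFun := fun q => ⟨q.1.1, q.2.1⟩
      left_inv := fun x => rfl
      right_inv := by
        rintro ⟨⟨a, b⟩, ha, hb⟩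
        exact Subtype.ext (Prod.ext rfl hb.symm)
      continuous_toFun := by fun_prop
      continuous_invFun := by fun_prop }
  obtain ⟨Φ, h1, h2, h3⟩ := exists_cone_homeomorph
    (ℓ := fun y : V → ℝ => ∑ w ∈ F, y w)
    (ℓ' := fun q : B × ℝ => q.2) (T := K.realization) (T' := T')
    (by fun_prop) (fun r x _ => by simp [Finset.mul_sum])
    (fun t ht => (hF.mem_realization_iff.1 ht).2) (isCompact_realization hfin)
    continuous_snd (fun r x _ => rfl) (fun t ht => ht.2)
    ((isCompact_closedBall _ _).prod isCompact_singleton) f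
  refine ⟨(Homeomorph.setCongr hF.coneOver_realization.symm).trans
    (Φ.trans (Homeomorph.setCongr hcone)), fun y => h1 _, fun y r t hr hy => ?_⟩
  exact congrArg Prod.fst (h3 ⟨y, hF.coneOver_realization.symm ▸ y.2⟩ r t hr hy)

/-- The point at height `t` on the segment from `y` to the vertex `v`. -/
noncomputable def push (v : V) (t : ℝ) (y : V → ℝ) : V → ℝ := (1 + t)⁻¹ • (y + t • vtx v)

theorem push_zero (y : V → ℝ) : push v 0 y = y := by simp [push]

theorem push_self {t : ℝ} {y : V → ℝ} (hy : y v = 0) : push v t y v = t / (1 + t) := by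
  simp [push, hy, div_eq_inv_mul]

theorem push_of_ne {t : ℝ} {y : V → ℝ} (h : p ≠ v) : push v t y p = (1 + t)⁻¹ * y p := by
  simp [push, vtx_of_ne h]

theorem push_left_inj {t t' : ℝ} (ht : 0 ≤ t) (ht' : 0 ≤ t') {y y' : V → ℝ} (hy : y v = 0)
    (hy' : y' v = 0) (h : push v t y = push v t' y') : t = t' := by
  have h1 := congrFun h v
  rw [push_self hy, push_self hy', div_eq_div_iff (by positivity) (by positivity)] at h1
  linarith

theorem push_injective {t : ℝ} (ht : 0 ≤ t) {y y' : V → ℝ} (h : push v t y = push v t y') :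
    y = y' := by
  have : (1 + t)⁻¹ ≠ 0 := by positivity
  exact add_right_cancel (smul_right_injective (V → ℝ) this h)

theorem eq_vtx_of_eq_one (hF : K.SupportedOn F) (hv : v ∈ K.vertexSet) {x : V → ℝ}
    (hx : x ∈ K.realization) (h : x v = 1) : x = vtx v := by
  classical
  have hx' := hF.mem_realization_iff.1 hx
  funext w
  by_cases hw : w = v
  · rw [hw, h, vtx_self]
  rw [vtx_of_ne hw]
  by_cases hwF : w ∈ F
  · have h1 := hx'.2
    rw [← Finset.add_sum_erase F x (hF.mem hv), h] at h1
    have h2 : ∑ w ∈ F.erase v, x w = 0 := by linarith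
    exact (Finset.sum_eq_zero_iff_of_nonneg fun w _ => hx.1 w).1 h2 w
      (Finset.mem_erase.2 ⟨hw, hwF⟩)
  · exact hF.eq_zero hx'.1 hwF

/-- Polar coordinates around `v`: the height is the ratio of the `v`-coordinate to the remaining
mass, and the remaining coordinates, normalised, give the foot point in the link. -/
theorem exists_push_eq (hF : K.SupportedOn F) (hv : v ∈ K.vertexSet) {x : V → ℝ}
    (hx : x ∈ K.realization) (h0 : 0 < x v) (h1 : x v < 1) :
    ∃ y ∈ (K.link {v}).realization, x = push v (x v / (1 - x v)) y := by
  have hx' := hF.mem_realization_iff.1 hx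
  have h2 : 0 < 1 - x v := by linarith
  refine ⟨(1 - x v)⁻¹ • (x - x v • vtx v), (hF.link {v}).mem_realization_iff.2
    ⟨smul_mem_coneSet (sub_vtx_mem_coneSet_link hv hx'.1 h0) (by positivity), ?_⟩, ?_⟩
  · simp only [Pi.smul_apply, Pi.sub_apply, smul_eq_mul]
    rw [← Finset.mul_sum, Finset.sum_sub_distrib, ← Finset.mul_sum, hx'.2, sum_vtx (hF.mem hv),
      mul_one, inv_mul_cancel₀ h2.ne']
  · have h3 : (1 + x v / (1 - x v))⁻¹ = 1 - x v := by
      field_simp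
      ring
    rw [push, h3, smul_add, smul_smul, smul_smul, mul_inv_cancel₀ h2.ne', one_smul,
      mul_div_cancel₀ _ h2.ne', sub_add_cancel]

/-- Coordinates on the cone over a complex, in which the cone over the link of a vertex `v` is
a hyperplane and the lines in direction `v` are vertical, if the complex without `v` is a ball
bounded by the link of `v`. -/
theorem exists_cone_chart {L : PreAbstractSimplicialComplex V} (hF : L.SupportedOn F)
    (hfin : L.faces.Finite) (hv : v ∈ L.vertexSet)
    (β : (L.deletion v).realization ≃ₜ closedBall (0 : B) 1)
    (hβ : ∀ x : (L.deletion v).realization, (x : V → ℝ) ∈ (L.link {v}).realization ↔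
      (β x : B) ∈ sphere (0 : B) 1) :
    ∃ (χ : L.coneSet ≃ₜ B × ℝ) (b : B → V → ℝ), (∀ w, b w ∈ (L.link {v}).coneSet) ∧
      (∀ w, ∑ z ∈ F, b w z = ‖w‖) ∧
      (∀ w t, 0 ≤ t → (χ.symm (w, -t) : V → ℝ) = b w + (t * (1 + ‖w‖)) • vtx v) ∧
      (∀ w s, 0 ≤ s → (χ.symm (w, s) : V → ℝ) v = 0) ∧
      ∀ w s, 0 < s → (χ.symm (w, s) : V → ℝ) ∉ (L.link {v}).coneSet := by
  have hFd := hF.deletion v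
  obtain ⟨Φ, hΦ2, hΦ1⟩ := exists_cone_ball_homeomorph hFd (finite_deletion hfin v) β
  have hbd : ∀ y : (L.deletion v).coneSet, (y : V → ℝ) ∈ (L.link {v}).coneSet ↔
      ‖(Φ y : B × ℝ).1‖ = (Φ y : B × ℝ).2 := by
    rintro ⟨y, hy⟩
    rw [hΦ2]
    by_cases h0 : y = 0
    · have h1 : (Φ ⟨y, hy⟩ : B × ℝ).2 = 0 := by rw [hΦ2]; simp [h0]
      have h2 : ‖(Φ ⟨y, hy⟩ : B × ℝ).1‖ ≤ 0 := by
        have : ‖(Φ ⟨y, hy⟩ : B × ℝ).1‖ ≤ (Φ ⟨y, hy⟩ : B × ℝ).2 := (Φ ⟨y, hy⟩).2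
        rwa [h1] at this
      have h3 := le_antisymm h2 (norm_nonneg _)
      rw [h3]
      simp only [h0, Pi.zero_apply, Finset.sum_const_zero, iff_true]
      exact zero_mem_coneSet
    · have hs := hFd.sum_pos hy h0
      have ht := hFd.inv_smul_mem hy h0
      have hyt : y = (∑ w ∈ F, y w) • ((∑ w ∈ F, y w)⁻¹ • y) := by
        rw [smul_smul, mul_inv_cancel₀ hs.ne', one_smul]
      have h1 := hΦ1 ⟨y, hy⟩ _ ⟨_, ht⟩ hs hyt
      rw [h1, norm_smul, Real.norm_of_nonneg hs.le]
      simp only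
      rw [mul_eq_left₀ hs.ne', ← mem_sphere_zero_iff_norm, ← hβ ⟨_, ht⟩]
      simp only
      rw [(hF.link {v}).mem_realization_iff]
      constructor
      · exact fun h => ⟨smul_mem_coneSet h (by positivity), (hFd.mem_realization_iff.1 ht).2⟩
      · intro h
        rw [hyt]
        exact smul_mem_coneSet h.1 hs.le
  have hyv : ∀ y : (L.deletion v).coneSet, (y : V → ℝ) v = 0 := fun y =>
    (mem_coneSet_deletion_iff.1 y.2).2
  have hmem : ∀ q : B × ℝ, ‖(q.1, ‖q.1‖ + max q.2 0).1‖ ≤ (q.1, ‖q.1‖ + max q.2 0).2 := fun q => by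
    simp
  -- For s ≥ 0 the cone over the deletion is parametrised by ball coordinate and excess of the
  -- height over the norm. For s ≤ 0 the point is held on the boundary, which is the cone over the
  -- link of `v`.
  let bs : B × ℝ → (L.deletion v).coneSet := fun q => Φ.symm ⟨(q.1, ‖q.1‖ + max q.2 0), hmem q⟩
  have hbs : ∀ q, (Φ (bs q) : B × ℝ) = (q.1, ‖q.1‖ + max q.2 0) := fun q => by
    simp only [bs, Φ.apply_symm_apply]
  have hbsc : Continuous bs := Φ.symm.continuous.comp (Continuous.subtype_mk (by fun_prop) _)
  have hbs0 : ∀ q : B × ℝ, q.2 ≤ 0 → (bs q : V → ℝ) ∈ (L.link {v}).coneSet := fun q hq => by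
    rw [hbd, hbs]
    simp [hq]
  -- The factor 1 + ‖w‖ is the mass of the boundary point over `w` together with one further vertex
  -- of weight 1. In the star of a neighbour of `v` it makes the coordinate -s agree with the height
  -- used in `push`.
  let inv : B × ℝ → V → ℝ := fun q => (bs q : V → ℝ) + (max (-q.2) 0 * (1 + ‖q.1‖)) • vtx v
  have hinv : ∀ q, inv q ∈ L.coneSet := by
    intro q
    rcases le_or_gt 0 q.2 with h | h
    · simp only [inv, max_eq_right (neg_nonpos.2 h), zero_mul, zero_smul, add_zero]
      exact (mem_coneSet_deletion_iff.1 (bs q).2).1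
    · simp only [inv]
      rw [add_comm, vtx_add_mem_coneSet_iff hv (hyv _)]
      · exact hbs0 q h.le
      · rw [max_eq_left (by linarith)]
        have := norm_nonneg q.1
        exact mul_pos (by linarith) (by linarith)
  let er : L.coneSet → (L.deletion v).coneSet := fun y =>
    ⟨_, sub_vtx_mem_coneSet_deletion hv y.2⟩
  have herc : Continuous er := Continuous.subtype_mk (continuous_subtype_val.sub
    (((continuous_apply v).comp continuous_subtype_val).smul continuous_const)) _
  have hρ0 : ∀ y, 0 ≤ (Φ y : B × ℝ).2 := fun y => (norm_nonneg _).trans (Φ y).2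
  let χ : L.coneSet ≃ₜ B × ℝ :=
    -- At most one of the two terms in the second coordinate is nonzero: a positive `v`-coordinate
    -- forces the remaining coordinates onto the boundary cone, where height and norm agree.
    { toFun := fun y => ((Φ (er y) : B × ℝ).1, (Φ (er y) : B × ℝ).2 - ‖(Φ (er y) : B × ℝ).1‖ -
        (y : V → ℝ) v / (1 + (Φ (er y) : B × ℝ).2))
      invFun := fun q => ⟨inv q, hinv q⟩
      left_inv := by
        intro y
        refine Subtype.ext ?_
        have hery : (er y : V → ℝ) = (y : V → ℝ) - (y : V → ℝ) v • vtx v := rfl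
        have hle : ‖(Φ (er y) : B × ℝ).1‖ ≤ (Φ (er y) : B × ℝ).2 := (Φ (er y)).2
        have h0 := hρ0 (er y)
        rcases (y.2.1 v).eq_or_lt with h | h
        · have h1 : bs ((Φ (er y) : B × ℝ).1, (Φ (er y) : B × ℝ).2 - ‖(Φ (er y) : B × ℝ).1‖ -
              (y : V → ℝ) v / (1 + (Φ (er y) : B × ℝ).2)) = er y := by
            refine Φ.injective (Subtype.ext ?_)
            rw [hbs, ← h, zero_div, sub_zero, max_eq_left (by linarith)]
            exact Prod.ext rfl (by simp)
          change (bs _ : V → ℝ) + _ = _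
          rw [h1, hery]
          simp only
          rw [← h, zero_div, sub_zero, max_eq_right (by linarith)]
          simp
        · have h2 : (er y : V → ℝ) ∈ (L.link {v}).coneSet := sub_vtx_mem_coneSet_link hv y.2 h
          have h3 := (hbd (er y)).1 h2
          have h4 : 0 < (y : V → ℝ) v / (1 + (Φ (er y) : B × ℝ).2) := by positivity
          have h1 : bs ((Φ (er y) : B × ℝ).1, (Φ (er y) : B × ℝ).2 - ‖(Φ (er y) : B × ℝ).1‖ -
              (y : V → ℝ) v / (1 + (Φ (er y) : B × ℝ).2)) = er y := by
            refine Φ.injective (Subtype.ext ?_)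
            rw [hbs, max_eq_right (by linarith)]
            exact Prod.ext rfl (by simp [h3])
          change (bs _ : V → ℝ) + _ = _
          rw [h1, hery]
          simp only
          rw [h3, sub_self, zero_sub, neg_neg, max_eq_left h4.le, div_mul_cancel₀ _ (by positivity),
            sub_add_cancel]
      right_inv := by
        rintro ⟨w, s⟩
        have h1 : inv (w, s) v = max (-s) 0 * (1 + ‖w‖) := by
          simp [inv, hyv]
        have h2 : er ⟨inv (w, s), hinv (w, s)⟩ = bs (w, s) := by
          refine Subtype.ext ?_
          change inv (w, s) - inv (w, s) v • vtx v = _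
          rw [h1]
          simp [inv]
        simp only [h2, hbs, h1]
        refine Prod.ext rfl ?_
        simp only
        rcases le_or_gt 0 s with h | h
        · simp [h]
        · rw [max_eq_right h.le, max_eq_left (by linarith : (0 : ℝ) ≤ -s), add_zero, sub_self,
            mul_div_cancel_right₀ _ (by positivity)]
          ring
      continuous_toFun := by
        have h1 : Continuous fun y : L.coneSet => (Φ (er y) : B × ℝ) :=
          continuous_subtype_val.comp (Φ.continuous.comp herc)
        refine h1.fst.prodMk ((h1.snd.sub h1.fst.norm).sub (Continuous.div
          ((continuous_apply v).comp continuous_subtype_val) (continuous_const.add h1.snd) ?_))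
        intro y
        have := hρ0 (er y)
        positivity
      continuous_invFun := by
        refine Continuous.subtype_mk ?_ _
        have h1 : Continuous fun q : B × ℝ => max (-q.2) 0 * (1 + ‖q.1‖) := by fun_prop
        exact (continuous_subtype_val.comp hbsc).add (h1.smul continuous_const) }
  refine ⟨χ, fun w => bs (w, 0), fun w => hbs0 (w, 0) le_rfl, fun w => ?_, fun w t ht => ?_,
    fun w s hs => ?_, fun w s hs => ?_⟩
  · rw [← hΦ2 (bs (w, 0)), hbs]
    simp
  · have h1 : bs (w, -t) = bs (w, 0) := by
      refine Φ.injective (Subtype.ext ?_)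
      rw [hbs, hbs]
      simp [ht]
    change inv (w, -t) = _
    simp only [inv]
    rw [h1, neg_neg, max_eq_left ht]
  · change inv (w, s) v = 0
    simp [inv, hyv, hs]
  · change inv (w, s) ∉ _
    have h1 : inv (w, s) = bs (w, s) := by simp [inv, hs.le]
    rw [h1, hbd, hbs]
    simp [hs.le, hs.ne']

/-- Coordinates on the open star of a neighbour `p` of `v`, in which the link of `v` is a
hyperplane and the segments to `v` are vertical, if the link of `p` without `v` is a ball bounded
by the link of the edge. -/
theorem exists_collar_chart (hF : K.SupportedOn F) (hfin : K.faces.Finite)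
    (hpv : p ∈ (K.link {v}).vertexSet)
    (β : ((K.link {p}).deletion v).realization ≃ₜ closedBall (0 : B) 1)
    (hβ : ∀ x : ((K.link {p}).deletion v).realization,
      (x : V → ℝ) ∈ ((K.link {p}).link {v}).realization ↔ (β x : B) ∈ sphere (0 : B) 1) :
    ∃ κ : B × ℝ → K.realization, IsOpenEmbedding κ ∧
      range κ = {x : K.realization | 0 < (x : V → ℝ) p} ∧
      (∀ w, (κ (w, 0) : V → ℝ) ∈ (K.link {v}).realization) ∧
      (∀ w t, 0 ≤ t → (κ (w, -t) : V → ℝ) = push v t (κ (w, 0))) ∧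
      (∀ w s, 0 ≤ s → (κ (w, s) : V → ℝ) v = 0) ∧
      ∀ w s, (κ (w, s) : V → ℝ) ∈ (K.link {v}).realization → s ≤ 0 := by
  have hvp : v ∈ (K.link {p}).vertexSet := mem_link_vertexSet_comm.1 hpv
  have hpK : p ∈ K.vertexSet := link_faces_subset hpv
  obtain ⟨χ, b, hb, hbsum, hχ, hχ0, hχ1⟩ := exists_cone_chart (hF.link {p}) (finite_link hfin _) hvp β hβ
  obtain ⟨Θ, hΘ, -⟩ := exists_star_homeomorph hF hpK
  have hχz : ∀ w, (χ.symm (w, 0) : V → ℝ) = b w := fun w => by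
    simpa using hχ w 0 le_rfl
  have hsum : ∀ w t, 0 ≤ t → ∑ z ∈ F, (χ.symm (w, -t) : V → ℝ) z = ‖w‖ + t * (1 + ‖w‖) := by
    intro w t ht
    rw [hχ w t ht]
    simp only [Pi.add_apply, Pi.smul_apply, smul_eq_mul, Finset.sum_add_distrib]
    rw [← Finset.mul_sum, sum_vtx ((hF.link {p}).mem hvp), hbsum, mul_one]
  refine ⟨fun q => (Θ (χ.symm q) : K.realization),
    isOpen_star.isOpenEmbedding_subtypeVal.comp (χ.symm.trans Θ).isOpenEmbedding, ?_, ?_, ?_, ?_, ?_⟩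
  · rw [show (fun q => (Θ (χ.symm q) : K.realization)) = Subtype.val ∘ (χ.symm.trans Θ) from rfl,
      range_comp, (χ.symm.trans Θ).surjective.range_eq, image_univ, Subtype.range_coe]
  · intro w
    refine (hF.link {v}).mem_realization_iff.2 ⟨?_,
      (hF.mem_realization_iff.1 (Θ (χ.symm (w, 0)) : K.realization).2).2⟩
    rw [hΘ]
    refine smul_mem_coneSet ?_ (inv_nonneg.2 ?_)
    · have h1 := hb w
      rw [link_link_comm (ne_of_mem_link_vertexSet hpv)] at h1
      have h2 := (vtx_add_mem_coneSet_iff (K := K.link {v}) hpv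
        (eq_zero_of_mem_coneSet_link h1) one_pos).2 h1
      rwa [one_smul, ← hχz] at h2
    · rw [hχz, hbsum]
      positivity
  · intro w t ht
    rw [hΘ, hΘ, hsum w t ht, hχz, hbsum, hχ w t ht, push]
    have hw : 0 < 1 + ‖w‖ := by positivity
    have ht' : 0 < 1 + t := by positivity
    rw [show 1 + (‖w‖ + t * (1 + ‖w‖)) = (1 + t) * (1 + ‖w‖) by ring, mul_inv, mul_smul, ← add_assoc,
      smul_add (1 + ‖w‖)⁻¹, smul_smul (1 + ‖w‖)⁻¹ (t * (1 + ‖w‖)),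
      show (1 + ‖w‖)⁻¹ * (t * (1 + ‖w‖)) = t by field_simp]
  · intro w s hs
    rw [hΘ]
    simp [hχ0 w s hs, vtx_of_ne (ne_of_mem_link_vertexSet hvp)]
  · intro w s h
    by_contra hs
    rw [not_le] at hs
    rw [hΘ] at h
    have hpos : 0 < 1 + ∑ z ∈ F, (χ.symm (w, s) : V → ℝ) z := by
      have := sum_nonneg_of_mem_coneSet (F := F) (χ.symm (w, s)).2
      positivity
    have h1 := smul_mem_coneSet (mem_coneSet_of_mem_realization h) hpos.le
    rw [smul_smul, mul_inv_cancel₀ hpos.ne', one_smul] at h1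
    have h2 := (vtx_add_mem_coneSet_iff (K := K.link {v}) hpv
      (eq_zero_of_mem_coneSet_link (χ.symm (w, s)).2) one_pos).1 (by rwa [one_smul])
    rw [link_link_comm (ne_of_mem_link_vertexSet hvp)] at h2
    exact hχ1 w s hs h2

end PreAbstractSimplicialComplex

/-- The slide of the line by `-l` near `[-1, 0]`, supported in `[-2, 1]`. -/
noncomputable def slide (l s : ℝ) : ℝ :=
  min s (max (max (s - l) (-2 + (s + 2) / 4)) (1 - 4 * (1 - s)))

theorem continuous_slide : Continuous fun q : ℝ × ℝ => slide q.1 q.2 := by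
  unfold slide
  fun_prop

theorem strictMono_slide (l : ℝ) : StrictMono (slide l) := by
  intro a b hab
  exact min_lt_min hab (max_lt_max (max_lt_max (by linarith) (by linarith)) (by linarith))

theorem slide_of_le {l s : ℝ} (h : s ≤ -2) : slide l s = s :=
  min_eq_left (le_max_of_le_left (le_max_of_le_right (by linarith)))

theorem slide_of_ge {l s : ℝ} (h : 1 ≤ s) : slide l s = s :=
  min_eq_left (le_max_of_le_right (by linarith))

theorem slide_zero (s : ℝ) : slide 0 s = s :=
  min_eq_left (le_max_of_le_left (le_max_of_le_left (by linarith)))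

/-- The two correcting lines, which pin down the points -2 and 1, lie below `s - l` on this range.
-/
theorem slide_of_mem {l s : ℝ} (hl : 0 ≤ l) (h1 : -1 ≤ s - l) (h0 : s ≤ 0) : slide l s = s - l := by
  unfold slide
  rw [max_eq_left (b := 1 - 4 * (1 - s)) (le_max_of_le_left (by linarith)),
    max_eq_left (by linarith), min_eq_right (by linarith)]

theorem bijective_slide (l : ℝ) : Function.Bijective (slide l) := by
  refine ⟨(strictMono_slide l).injective, fun t => ?_⟩
  have hc : Continuous (slide l) := continuous_slide.comp (continuous_const.prodMk continuous_id)
  obtain ⟨s, -, hs⟩ := intermediate_value_Icc (a := min (-2) t) (b := max 1 t)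
    ((min_le_right _ _).trans (le_max_right _ _)) hc.continuousOn (show t ∈ _ by
      rw [slide_of_le (min_le_left _ _), slide_of_ge (le_max_left _ _)]
      exact ⟨min_le_right _ _, le_max_right _ _⟩)
  exact ⟨s, hs⟩

namespace PreAbstractSimplicialComplex

variable {V : Type*} {K : PreAbstractSimplicialComplex V} {F : Finset V} {p v : V}

/-- The points that are not above the graph of `τ`, where heights are measured along the segments
from the link of `v` to `v`. -/
def BelowGraph (K : PreAbstractSimplicialComplex V) (v : V) (τ : (V → ℝ) → ℝ) (x : V → ℝ) : Prop :=
  x ≠ vtx v ∧ ∀ y ∈ (K.link {v}).realization, ∀ t, 0 ≤ t → x = push v t y → t ≤ τ y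

theorem apply_self_of_mem_link {y : V → ℝ} (hy : y ∈ (K.link {v}).realization) : y v = 0 :=
  eq_zero_of_mem_coneSet_link (mem_coneSet_of_mem_realization hy)

theorem belowGraph_congr {τ τ' : (V → ℝ) → ℝ}
    (h : ∀ y ∈ (K.link {v}).realization, τ y = τ' y) (x : V → ℝ) :
    K.BelowGraph v τ x ↔ K.BelowGraph v τ' x :=
  and_congr_right fun _ => forall₂_congr fun y hy => by rw [h y hy]

/-- Height t means `v`-coordinate t / (1 + t), which increases with t. The vertex `v` has infinite
height and is not of the form `push v t y`, which explains the separate clause in `BelowGraph`. -/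
theorem belowGraph_const_iff (hF : K.SupportedOn F) (hv : v ∈ K.vertexSet) {c : ℝ} (hc : 0 ≤ c)
    {x : V → ℝ} (hx : x ∈ K.realization) :
    K.BelowGraph v (fun _ => c) x ↔ x v ≤ c / (1 + c) := by
  have hc1 : c / (1 + c) < 1 := by rw [div_lt_one (by positivity)]; linarith
  constructor
  · rintro ⟨h1, h2⟩
    rcases (hx.1 v).eq_or_lt with h | h
    · rw [← h]; positivity
    · have hlt : x v < 1 := (hF.le_one hx v).lt_of_ne fun h => h1 (eq_vtx_of_eq_one hF hv hx h)
      obtain ⟨y, hy, hxy⟩ := exists_push_eq hF hv hx h hlt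
      have h3 : 0 < 1 - x v := by linarith
      have h4 := h2 y hy _ (by positivity) hxy
      rw [div_le_iff₀ h3] at h4
      rw [le_div_iff₀ (by positivity)]
      linarith
  · intro h
    refine ⟨?_, ?_⟩
    · rintro rfl
      rw [vtx_self] at h
      linarith
    · rintro y hy t ht rfl
      rw [push_self (apply_self_of_mem_link hy), div_le_div_iff₀ (by positivity) (by positivity)] at h
      linarith

/-- Pushing the link of `v` towards `v` inside the open star of a neighbour. -/
theorem exists_slide {B : Type*} [TopologicalSpace B] (hfin : K.faces.Finite) (hpv : p ≠ v) {κ : B × ℝ → K.realization}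
    (hκ : IsOpenEmbedding κ) (hr : range κ = {x : K.realization | 0 < (x : V → ℝ) p})
    (hκ0 : ∀ w, (κ (w, 0) : V → ℝ) ∈ (K.link {v}).realization)
    (hκt : ∀ w t, 0 ≤ t → (κ (w, -t) : V → ℝ) = push v t (κ (w, 0)))
    (hκs : ∀ w s, 0 ≤ s → (κ (w, s) : V → ℝ) v = 0)
    (hκl : ∀ w s, (κ (w, s) : V → ℝ) ∈ (K.link {v}).realization → s ≤ 0)
    {l : (V → ℝ) → ℝ} (hl : Continuous l) (hl0 : ∀ y, 0 ≤ l y) {ε : ℝ} (hε : 0 < ε)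
    (hlε : ∀ y, y p < ε → l y = 0) :
    ∃ h : K.realization ≃ₜ K.realization,
      (∀ x : K.realization, (x : V → ℝ) p = 0 → h x = x) ∧
      ∀ τ : (V → ℝ) → ℝ, (∀ y ∈ (K.link {v}).realization, 0 ≤ τ y ∧ τ y + l y ≤ 1) →
        (∀ y ∈ (K.link {v}).realization, ∀ x : K.realization, (x : V → ℝ) = push v (τ y) y →
          (h x : V → ℝ) = push v (τ y + l y) y) ∧
        ∀ x : K.realization, K.BelowGraph v τ x ↔ K.BelowGraph v (fun y => τ y + l y) (h x) := by
  have hcomp : CompactSpace K.realization :=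
    isCompact_iff_compactSpace.1 (isCompact_realization hfin)
  let L : B → ℝ := fun w => l (κ (w, 0))
  have hL : Continuous L := hl.comp (continuous_subtype_val.comp (hκ.continuous.comp
    (continuous_id.prodMk continuous_const)))
  let f : B × ℝ → B × ℝ := fun q => (q.1, slide (L q.1) q.2)
  have hf : Continuous f := continuous_fst.prodMk
    (continuous_slide.comp ((hL.comp continuous_fst).prodMk continuous_snd))
  have hfb : Function.Bijective f := by
    constructor
    · rintro ⟨w, s⟩ ⟨w', s'⟩ h
      obtain ⟨h1, h2⟩ := Prod.ext_iff.1 h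
      change w = w' at h1
      subst h1
      exact Prod.ext rfl ((strictMono_slide _).injective h2)
    · rintro ⟨w, t⟩
      obtain ⟨s, hs⟩ := (bijective_slide (L w)).2 t
      exact ⟨(w, s), Prod.ext rfl hs⟩
  let D : Set K.realization := {x | ε ≤ (x : V → ℝ) p}
  have hDc : IsCompact D := (isClosed_le continuous_const
    ((continuous_apply p).comp continuous_subtype_val)).isCompact
  have hDr : D ⊆ range κ := by
    rw [hr]
    exact fun x hx => hε.trans_le hx
  have hDκ : IsCompact (κ ⁻¹' D) := (hκ.isInducing.isCompact_preimage_iff hDr).2 hDc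
  -- Only heights in [-2, 1] move, and only over feet with `p`-coordinate at least ε. This set is
  -- compact, so the slide extends by the identity beyond the chart.
  let C : Set (B × ℝ) := (Prod.fst '' (κ ⁻¹' D)) ×ˢ Icc (-2) 1
  have hC : IsCompact C := (hDκ.image continuous_fst).prod isCompact_Icc
  have hfC : ∀ q, q ∉ C → f q = q := by
    rintro ⟨w, s⟩ hq
    refine Prod.ext rfl ?_
    change slide (L w) s = s
    by_cases hw : w ∈ Prod.fst '' (κ ⁻¹' D)
    · have hs : s ∉ Icc (-2 : ℝ) 1 := fun hs => hq ⟨hw, hs⟩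
      rw [mem_Icc, not_and_or, not_le, not_le] at hs
      rcases hs with hs | hs
      · exact slide_of_le hs.le
      · exact slide_of_ge hs.le
    · have : L w = 0 := hlε _ (by
        by_contra hn
        exact hw ⟨(w, 0), not_lt.1 hn, rfl⟩)
      rw [this, slide_zero]
  obtain ⟨h, hh, hh'⟩ := hκ.exists_homeomorph_extend hf hfb hC hfC
  have hfix : ∀ x : K.realization, (x : V → ℝ) p = 0 → h x = x := by
    intro x hx
    refine hh' x fun hxC => ?_
    have : x ∈ range κ := image_subset_range _ _ hxC
    rw [hr] at this
    exact (this : 0 < (x : V → ℝ) p).ne' hx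
  have hrange : ∀ x : K.realization, (x : V → ℝ) p ≠ 0 → x ∈ range κ := by
    intro x hx
    rw [hr]
    exact (x.2.1 p).lt_of_ne' hx
  have hκp : ∀ q, 0 < (κ q : V → ℝ) p := by
    intro q
    have : κ q ∈ range κ := mem_range_self q
    rwa [hr] at this
  refine ⟨h, hfix, fun τ hτ => ?_⟩
  have hl1 : ∀ w, 0 ≤ τ (κ (w, 0)) ∧ τ (κ (w, 0)) + L w ≤ 1 := fun w => hτ _ (hκ0 w)
  -- Height is the negative of the second chart coordinate. A point of the chart is therefore below
  -- a graph exactly when that coordinate is bounded below by the negated value at the foot, and a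
  -- monotone slide preserves such conditions.
  have hkey : ∀ (σ : (V → ℝ) → ℝ), (∀ y ∈ (K.link {v}).realization, 0 ≤ σ y) → ∀ w s,
      K.BelowGraph v σ (κ (w, s)) ↔ -σ (κ (w, 0)) ≤ s := by
    intro σ hσ w s
    constructor
    · rintro ⟨-, h2⟩
      rcases le_or_gt 0 s with hs | hs
      · linarith [hσ _ (hκ0 w)]
      · have h3 := hκt w (-s) (by linarith)
        rw [neg_neg] at h3
        linarith [h2 _ (hκ0 w) (-s) (by linarith) h3]
    · intro hs
      refine ⟨fun he => ?_, fun y hy t ht hyt => ?_⟩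
      · have := hκp (w, s)
        rw [he, vtx_of_ne hpv] at this
        exact lt_irrefl _ this
      · rcases le_or_gt 0 s with hs0 | hs0
        · have h3 := hκs w s hs0
          rw [hyt, push_self (apply_self_of_mem_link hy), div_eq_zero_iff] at h3
          rcases h3 with h3 | h3
          · rw [h3]; exact hσ y hy
          · linarith
        · have h3 := hκt w (-s) (by linarith)
          rw [neg_neg, hyt] at h3
          have h4 := push_left_inj ht (by linarith) (apply_self_of_mem_link hy)
            (apply_self_of_mem_link (hκ0 w)) h3
          rw [h4] at h3 ⊢
          rw [push_injective (by linarith) h3]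
          linarith
  constructor
  · intro y hy x hx
    have h0 := (hτ y hy).1
    by_cases hyp : y p = 0
    · rw [hfix x (by rw [hx, push_of_ne hpv, hyp, mul_zero]), hx,
        hlε y (by rw [hyp]; exact hε), add_zero]
    · obtain ⟨⟨w, s⟩, hws⟩ := hrange ⟨y, realization_mono link_faces_subset hy⟩ hyp
      have hws' : (κ (w, s) : V → ℝ) = y := congrArg Subtype.val hws
      have hs : s = 0 := by
        refine le_antisymm (hκl w s (hws' ▸ hy)) ?_
        by_contra hn
        rw [not_le] at hn
        have h3 := congrFun (hκt w (-s) (by linarith)) v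
        rw [neg_neg, hws', apply_self_of_mem_link hy,
          push_self (apply_self_of_mem_link (hκ0 w))] at h3
        have : 0 < -s / (1 + -s) := div_pos (by linarith) (by linarith)
        linarith
      subst hs
      have hxκ : x = κ (w, -τ y) := by
        refine Subtype.ext ?_
        rw [hκt w _ h0, hws', hx]
      have hLw : L w = l y := by simp only [L, hws']
      have h1 := (hτ y hy).2
      rw [hxκ, hh, show f (w, -τ y) = (w, slide (L w) (-τ y)) from rfl, hLw,
        slide_of_mem (hl0 y) (by linarith) (by linarith),
        show -τ y - l y = -(τ y + l y) by ring, hκt w _ (add_nonneg h0 (hl0 y)), hws']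
  · intro x
    by_cases hxp : (x : V → ℝ) p = 0
    · rw [hfix x hxp]
      refine and_congr_right fun _ => forall₂_congr fun y hy => forall₃_congr fun t ht hxt => ?_
      rw [hxt, push_of_ne hpv, mul_eq_zero] at hxp
      rcases hxp with hxp | hxp
      · exact absurd hxp (by positivity)
      · simp only [hlε y (by rw [hxp]; exact hε), add_zero]
    · obtain ⟨⟨w, s⟩, rfl⟩ := hrange x hxp
      rw [hh, hkey τ (fun y hy => (hτ y hy).1),
        show f (w, s) = (w, slide (L w) s) from rfl,
        hkey _ (fun y hy => add_nonneg (hτ y hy).1 (hl0 y))]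
      have h1 := hl1 w
      have h2 : slide (L w) (-τ (κ (w, 0))) = -τ (κ (w, 0)) - L w :=
        slide_of_mem (hl0 _) (by linarith) (by linarith)
      rw [show -(τ (κ (w, 0)) + l (κ (w, 0))) = slide (L w) (-τ (κ (w, 0))) by
        rw [h2]; change -(_ + L w) = _; ring, (strictMono_slide _).le_iff_le]

/-- If the links of the neighbours of `v` are balls after deleting `v`, then the link of `v` is
collared in the complement of its open star. -/
theorem exists_collar (hF : K.SupportedOn F) (hfin : K.faces.Finite) (hv : v ∈ K.vertexSet)
    (hball : ∀ p ∈ (K.link {v}).vertexSet, ∃ (k : ℕ)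
      (β : ((K.link {p}).deletion v).realization ≃ₜ closedBall (0 : EuclideanSpace ℝ (Fin k)) 1),
      ∀ x : ((K.link {p}).deletion v).realization,
        (x : V → ℝ) ∈ ((K.link {p}).link {v}).realization ↔
          (β x : EuclideanSpace ℝ (Fin k)) ∈ sphere (0 : EuclideanSpace ℝ (Fin k)) 1) :
    ∃ H : K.realization ≃ₜ K.realization,
      (∀ x : K.realization, (∀ p ∈ (K.link {v}).vertexSet, (x : V → ℝ) p = 0) → H x = x) ∧
      (∀ x : K.realization, (x : V → ℝ) ∈ (K.link {v}).realization →
        (H x : V → ℝ) = push v 1 x) ∧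
      ∀ x : K.realization, (x : V → ℝ) v = 0 ↔ (H x : V → ℝ) v ≤ 1 / 2 := by
  classical
  have hFl := hF.link {v}
  have hFpos : 0 < F.card := Finset.card_pos.2 ⟨v, hF.mem hv⟩
  -- Truncating each of the `F.card` coordinates by ε costs at most 1/2 of the total mass 1. The
  -- truncation lets each weight vanish where its coordinate is small, as a slide in a single star
  -- requires.
  obtain ⟨ε, hε, hεF⟩ : ∃ ε : ℝ, 0 < ε ∧ F.card * ε = 1 / 2 :=
    ⟨1 / (2 * F.card), by positivity, by field_simp⟩
  -- The lower bound 1/2 in the denominator keeps the weights continuous on the whole space; on the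
  -- link it is inactive, so the weights form a partition of unity there.
  let l : V → (V → ℝ) → ℝ := fun p y =>
    max (y p - ε) 0 / max (1 / 2) (∑ q ∈ F, max (y q - ε) 0)
  have hden : ∀ y : V → ℝ, 0 < max (1 / 2) (∑ q ∈ F, max (y q - ε) 0) := fun y =>
    lt_max_of_lt_left one_half_pos
  have hlc : ∀ p, Continuous (l p) := fun p =>
    Continuous.div (by fun_prop) (by fun_prop) fun y => (hden y).ne'
  have hl0 : ∀ p y, 0 ≤ l p y := fun p y => div_nonneg (le_max_right _ _) (hden y).le
  have hlε : ∀ p y, y p < ε → l p y = 0 := fun p y h => by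
    simp only [l]
    rw [max_eq_right (by linarith), zero_div]
  have hsum1 : ∀ y ∈ (K.link {v}).realization, ∑ p ∈ F, l p y = 1 := by
    intro y hy
    have h1 : 1 / 2 ≤ ∑ q ∈ F, max (y q - ε) 0 := by
      calc (1 / 2 : ℝ) = ∑ q ∈ F, (y q - ε) := by
            rw [Finset.sum_sub_distrib, (hFl.mem_realization_iff.1 hy).2, Finset.sum_const,
              nsmul_eq_mul, hεF]
            norm_num
        _ ≤ _ := Finset.sum_le_sum fun q _ => le_max_left _ _
    simp only [l]
    rw [← Finset.sum_div, max_eq_right h1, div_self (by linarith)]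
  -- The link is lifted one neighbour at a time. The accumulated height is a partial sum of the
  -- partition of unity, hence at most 1, which is the range in which the slides are exact
  -- translations.
  have hstep : ∀ P : Finset V, (∀ p ∈ P, p ∈ F ∧ p ∈ (K.link {v}).vertexSet) →
      ∃ H : K.realization ≃ₜ K.realization,
      (∀ x : K.realization, (∀ p ∈ P, (x : V → ℝ) p = 0) → H x = x) ∧
      (∀ x : K.realization, (x : V → ℝ) ∈ (K.link {v}).realization →
        (H x : V → ℝ) = push v (∑ p ∈ P, l p x) x) ∧
      ∀ x : K.realization, (x : V → ℝ) v = 0 ↔ K.BelowGraph v (fun y => ∑ p ∈ P, l p y) (H x) := by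
    intro P
    induction P using Finset.induction_on with
    | empty =>
      intro _
      refine ⟨Homeomorph.refl _, fun x _ => rfl, fun x hx => ?_, fun x => ?_⟩
      · rw [Finset.sum_empty, push_zero]
        rfl
      · simp only [Finset.sum_empty]
        rw [belowGraph_const_iff hF hv le_rfl (Subtype.prop _), zero_div]
        exact ⟨fun h => h.le, fun h => le_antisymm h (x.2.1 v)⟩
    | insert q P hq ih =>
      intro hP
      obtain ⟨H, h1, h2, h3⟩ := ih fun p hp => hP p (Finset.mem_insert_of_mem hp)
      obtain ⟨hqF, hqv⟩ := hP q (Finset.mem_insert_self q P)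
      obtain ⟨k, β, hβ⟩ := hball q hqv
      obtain ⟨κ, c1, c2, c3, c4, c5, c6⟩ := exists_collar_chart hF hfin hqv β hβ
      obtain ⟨h, s1, s2⟩ := exists_slide hfin (ne_of_mem_link_vertexSet hqv) c1 c2 c3 c4 c5 c6
        (hlc q) (hl0 q) hε (hlε q)
      have hadd : ∀ y, ∑ p ∈ insert q P, l p y = ∑ p ∈ P, l p y + l q y := fun y => by
        rw [Finset.sum_insert hq, add_comm]
      obtain ⟨s3, s4⟩ := s2 (fun y => ∑ p ∈ P, l p y) fun y hy => by
        refine ⟨Finset.sum_nonneg fun p _ => hl0 p y, ?_⟩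
        rw [← hadd, ← hsum1 y hy]
        exact Finset.sum_le_sum_of_subset_of_nonneg (fun p hp => (hP p hp).1)
          fun p _ _ => hl0 p y
      refine ⟨H.trans h, fun x hx => ?_, fun x hx => ?_, fun x => ?_⟩
      · rw [Homeomorph.trans_apply, h1 x fun p hp => hx p (Finset.mem_insert_of_mem hp),
          s1 x (hx q (Finset.mem_insert_self q P))]
      · rw [Homeomorph.trans_apply, s3 x hx (H x) (h2 x hx), hadd]
      · rw [Homeomorph.trans_apply, h3, s4]
        simp only [hadd]
  obtain ⟨H, h1, h2, h3⟩ := hstep (F.filter fun p => p ∈ (K.link {v}).vertexSet)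
    (fun p hp => Finset.mem_filter.1 hp)
  have hsum2 : ∀ y ∈ (K.link {v}).realization,
      ∑ p ∈ F.filter (fun p => p ∈ (K.link {v}).vertexSet), l p y = 1 := by
    intro y hy
    rw [← hsum1 y hy]
    refine Finset.sum_subset (Finset.filter_subset _ _) fun p hp hp' => hlε p y ?_
    have : ¬ 0 < y p := fun h => hp' (Finset.mem_filter.2
      ⟨hp, mem_vertexSet_of_pos (mem_coneSet_of_mem_realization hy) h⟩)
    linarith
  refine ⟨H, fun x hx => h1 x fun p hp => hx p (Finset.mem_filter.1 hp).2, fun x hx => ?_,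
    fun x => ?_⟩
  · rw [h2 x hx, hsum2 x hx]
  · rw [h3, belowGraph_congr hsum2, belowGraph_const_iff hF hv zero_le_one (Subtype.prop _)]
    norm_num

/-! ### Deleting a vertex from a sphere. -/

/-- A finite complex whose realization is the unit sphere of an `m`-dimensional space and in which
the link of every face with `j` vertices is a sphere of dimension smaller by `j`. -/
structure IsSphereComplex (L : PreAbstractSimplicialComplex V) (m : ℕ) : Prop where
  finite : L.faces.Finite
  sphere : Nonempty (L.realization ≃ₜ Metric.sphere (0 : EuclideanSpace ℝ (Fin m)) 1)
  link : ∀ s ∈ L.faces, ∃ k, k + s.card = m ∧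
    Nonempty ((L.link s).realization ≃ₜ Metric.sphere (0 : EuclideanSpace ℝ (Fin k)) 1)

theorem IsSphereComplex.link_singleton {L : PreAbstractSimplicialComplex V} {m : ℕ}
    (hL : L.IsSphereComplex (m + 1)) (hv : v ∈ L.vertexSet) : (L.link {v}).IsSphereComplex m := by
  classical
  refine ⟨finite_link hL.finite _, ?_, fun s hs => ?_⟩
  · obtain ⟨k, hk, h⟩ := hL.link _ hv
    rw [Finset.card_singleton, Nat.add_right_cancel_iff] at hk
    exact hk ▸ h
  · rw [mem_link_singleton_faces] at hs
    obtain ⟨k, hk, h⟩ := hL.link _ hs.2.2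
    rw [Finset.card_insert_of_notMem hs.2.1] at hk
    refine ⟨k, by omega, ?_⟩
    rwa [link_link (by simpa using hs.2.1), ← Finset.insert_eq]

/-- The collar carries the deletion onto the points with `v`-coordinate at most 1/2, and the link to
height 1. In the star chart these are the complement of the open unit ball and the unit sphere, so
the Schoenflies theorem applies. -/
theorem exists_ball_of_collar {L : PreAbstractSimplicialComplex V} {m : ℕ}
    (hL : L.IsSphereComplex (m + 1)) (hv : v ∈ L.vertexSet)
    (hball : ∀ p ∈ (L.link {v}).vertexSet, ∃ (k : ℕ)
      (β : ((L.link {p}).deletion v).realization ≃ₜ closedBall (0 : EuclideanSpace ℝ (Fin k)) 1),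
      ∀ x : ((L.link {p}).deletion v).realization,
        (x : V → ℝ) ∈ ((L.link {p}).link {v}).realization ↔
          (β x : EuclideanSpace ℝ (Fin k)) ∈ sphere (0 : EuclideanSpace ℝ (Fin k)) 1) :
    ∃ β : (L.deletion v).realization ≃ₜ closedBall (0 : EuclideanSpace ℝ (Fin m)) 1,
      ∀ x : (L.deletion v).realization, (x : V → ℝ) ∈ (L.link {v}).realization ↔
        (β x : EuclideanSpace ℝ (Fin m)) ∈ sphere (0 : EuclideanSpace ℝ (Fin m)) 1 := by
  obtain ⟨F, hF⟩ := exists_supportedOn hL.finite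
  obtain ⟨H, -, H2, H3⟩ := exists_collar hF hL.finite hv hball
  obtain ⟨ψ⟩ := (hL.link_singleton hv).sphere
  obtain ⟨e, e1, e2, e3, e4⟩ := exists_star_embedding hF hL.finite hv ψ.symm
  obtain ⟨g⟩ := hL.sphere
  obtain ⟨f, hf⟩ := exists_homeomorph_complement_ball g e1
  have hball : ∀ x : L.realization, x ∈ ((e '' ball 0 1)ᶜ : Set L.realization) ↔
      (x : V → ℝ) v ≤ 1 / 2 := by
    intro x
    by_cases hx : x ∈ range e
    · obtain ⟨w, rfl⟩ := hx
      rw [mem_compl_iff, e1.injective.mem_set_image, mem_ball_zero_iff, e3, not_lt, one_div,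
        inv_le_inv₀ (by positivity) two_pos]
      constructor <;> intro h <;> linarith
    · have hxv : (x : V → ℝ) v = 0 := by
        rw [e2] at hx
        exact le_antisymm (not_lt.1 hx) (x.2.1 v)
      rw [hxv]
      exact ⟨fun _ => by norm_num, fun _ h => hx (image_subset_range _ _ h)⟩
  let ι : (L.deletion v).realization ≃ₜ {x : L.realization | (x : V → ℝ) v = 0} :=
    { toFun := fun x => ⟨⟨x, (mem_realization_deletion_iff.1 x.2).1⟩,
        (mem_realization_deletion_iff.1 x.2).2⟩
      invFun := fun x => ⟨x.1, mem_realization_deletion_iff.2 ⟨x.1.2, x.2⟩⟩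
      left_inv := fun _ => rfl
      right_inv := fun _ => rfl
      continuous_toFun := by fun_prop
      continuous_invFun := by fun_prop }
  have hset : ∀ x : L.realization, (x : V → ℝ) v = 0 ↔
      H x ∈ ((e '' ball 0 1)ᶜ : Set L.realization) := fun x => (H3 x).trans (hball _).symm
  refine ⟨(ι.trans (H.subtype hset)).trans f, fun x => ?_⟩
  rw [Homeomorph.trans_apply, hf]
  change _ ↔ H ⟨x, _⟩ ∈ e '' sphere 0 1
  constructor
  · intro hx
    refine ⟨(ψ ⟨x, hx⟩ : EuclideanSpace ℝ (Fin m)), (ψ ⟨x, hx⟩).2, Subtype.ext ?_⟩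
    rw [H2 ⟨x, _⟩ hx]
    have := e4 1 (ψ ⟨x, hx⟩) one_pos
    rw [one_smul, ψ.symm_apply_apply, one_smul] at this
    rw [this, push, one_smul, add_comm (vtx v)]
  · rintro ⟨z, hz, hzx⟩
    have h4 := e4 1 ⟨z, hz⟩ one_pos
    simp only [one_smul] at h4
    set y := ψ.symm ⟨z, hz⟩ with hy
    have hyx : H ⟨y, realization_mono link_faces_subset y.2⟩ =
        H ⟨x, (mem_realization_deletion_iff.1 x.2).1⟩ := by
      refine Subtype.ext ?_
      rw [H2 ⟨y, _⟩ y.2, ← hzx, h4, push, one_smul, add_comm (vtx v)]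
    have := congrArg Subtype.val (H.injective hyx)
    change (y : V → ℝ) = x at this
    rw [← this]
    exact y.2

/-- Deleting a vertex from a sphere leaves a ball bounded by the link of the vertex. -/
theorem IsSphereComplex.exists_ball {m : ℕ} : ∀ {L : PreAbstractSimplicialComplex V},
    L.IsSphereComplex (m + 1) → ∀ {v : V}, v ∈ L.vertexSet →
      ∃ β : (L.deletion v).realization ≃ₜ closedBall (0 : EuclideanSpace ℝ (Fin m)) 1,
        ∀ x : (L.deletion v).realization, (x : V → ℝ) ∈ (L.link {v}).realization ↔
          (β x : EuclideanSpace ℝ (Fin m)) ∈ Metric.sphere (0 : EuclideanSpace ℝ (Fin m)) 1 := by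
  induction m with
  | zero =>
    intro L hL v hv
    -- In a 0-sphere the link of `v` has no vertices, and the hypothesis on neighbours is vacuous.
    exact exists_ball_of_collar hL hv fun p hp => by
      obtain ⟨k, hk, -⟩ := (hL.link_singleton hv).link _ hp
      simp at hk
  | succ m ih =>
    intro L hL v hv
    exact exists_ball_of_collar hL hv fun p hp =>
      ⟨m, ih (hL.link_singleton (link_faces_subset hp)) (mem_link_vertexSet_comm.1 hp)⟩

end PreAbstractSimplicialComplex

/-! ### Connectedness and double covers of complexes. -/

namespace PreAbstractSimplicialComplex

variable {V : Type*} {K : PreAbstractSimplicialComplex V} {F : Finset V}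

/-- A function on the vertices of a connected complex that is constant along edges is constant. -/
theorem eq_of_forall_edge_eq (hconn : IsPreconnected K.realization) {α : Type*} (f : V → α)
    (hf : ∀ s ∈ K.faces, ∀ a ∈ s, ∀ b ∈ s, f a = f b) {a b : V} (ha : a ∈ K.vertexSet)
    (hb : b ∈ K.vertexSet) : f a = f b := by
  by_contra hne
  -- The open stars of the vertices with the value `f a` and those of all the others cover the
  -- realization. A common point would have both kinds of vertices in one face.
  let U : Set (V → ℝ) := ⋃ p ∈ {p | f p = f a}, {x | 0 < x p}
  let W : Set (V → ℝ) := ⋃ p ∈ {p | f p ≠ f a}, {x | 0 < x p}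
  have hU : IsOpen U := isOpen_biUnion fun p _ => isOpen_lt continuous_const (continuous_apply p)
  have hW : IsOpen W := isOpen_biUnion fun p _ => isOpen_lt continuous_const (continuous_apply p)
  obtain ⟨x, hxK, hxU, hxW⟩ := hconn U W hU hW
    (fun x hx => by
      obtain ⟨p, hp⟩ := exists_pos_of_mem_realization hx
      by_cases h : f p = f a
      · exact Or.inl (mem_biUnion (show p ∈ {p | f p = f a} from h) hp)
      · exact Or.inr (mem_biUnion (show p ∈ {p | f p ≠ f a} from h) hp))
    ⟨vtx a, vtx_mem_realization ha, mem_biUnion (show a ∈ {p | f p = f a} from rfl)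
      (show 0 < vtx a a by simp)⟩
    ⟨vtx b, vtx_mem_realization hb, mem_biUnion (show b ∈ {p | f p ≠ f a} from Ne.symm hne)
      (show 0 < vtx b b by simp)⟩
  simp only [U, W, mem_iUnion, mem_ofPred_eq, exists_prop] at hxU hxW
  obtain ⟨p, hp, hxp⟩ := hxU
  obtain ⟨q, hq, hxq⟩ := hxW
  classical
  have hface : {p, q} ∈ K.faces := mem_faces_of_pos (mem_coneSet_of_mem_realization hxK)
    (by simp) (by simp [hxp, hxq])
  exact hq ((hf _ hface q (by simp) p (by simp)).trans hp)

section DoubleCover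

variable (K)

/-- The total space of the double cover of `K` defined by a cocycle `c` modulo 2. -/
def doubleCover (c : V → V → ZMod 2) : Set (V × ZMod 2 → ℝ) :=
  {z | (∀ q, 0 ≤ z q) ∧ (fun a => z (a, 0) + z (a, 1)) ∈ K.realization ∧
    ∀ a i b j, j ≠ i + c a b → z (a, i) * z (b, j) = 0}

/-- The projection of the double cover. -/
def doubleCoverProj (c : V → V → ZMod 2) (z : K.doubleCover c) : K.realization :=
  ⟨fun a => (z : V × ZMod 2 → ℝ) (a, 0) + (z : V × ZMod 2 → ℝ) (a, 1), z.2.2.1⟩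

variable {K} {c : V → V → ZMod 2}

theorem continuous_doubleCoverProj : Continuous (K.doubleCoverProj c) := by
  refine Continuous.subtype_mk (continuous_pi fun a => ?_) _
  exact ((continuous_apply _).comp continuous_subtype_val).add
    ((continuous_apply _).comp continuous_subtype_val)

theorem isCompact_doubleCover (hfin : K.faces.Finite) : IsCompact (K.doubleCover c) := by
  obtain ⟨F, hF⟩ := exists_supportedOn hfin
  have hsub : K.doubleCover c ⊆ Set.pi univ fun _ : V × ZMod 2 => Icc (0 : ℝ) 1 := by
    rintro z ⟨h0, h1, -⟩ ⟨a, i⟩ -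
    refine ⟨h0 _, le_trans ?_ (hF.le_one h1 a)⟩
    fin_cases i
    · exact le_add_of_nonneg_right (h0 _)
    · exact le_add_of_nonneg_left (h0 _)
  refine (isCompact_univ_pi fun _ => isCompact_Icc).of_isClosed_subset ?_ hsub
  have h1 : IsClosed {z : V × ZMod 2 → ℝ | ∀ q, 0 ≤ z q} := by
    simp only [ofPred_forall]
    exact isClosed_iInter fun q => isClosed_le continuous_const (continuous_apply q)
  have h2 : IsClosed {z : V × ZMod 2 → ℝ | (fun a => z (a, 0) + z (a, 1)) ∈ K.realization} :=
    (isCompact_realization hfin).isClosed.preimage (by fun_prop)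
  have h3 : IsClosed {z : V × ZMod 2 → ℝ |
      ∀ a i b j, j ≠ i + c a b → z (a, i) * z (b, j) = 0} := by
    simp only [ofPred_forall]
    exact isClosed_iInter fun a => isClosed_iInter fun i => isClosed_iInter fun b =>
      isClosed_iInter fun j => isClosed_iInter fun _ =>
        isClosed_eq (by fun_prop) continuous_const
  exact h1.inter (h2.inter h3)

/-- The sheet of the double cover over the open star of `a` through `(a, i)`. -/
noncomputable def sheet (c : V → V → ZMod 2) (a : V) (i : ZMod 2) (x : V → ℝ) : V × ZMod 2 → ℝ :=
  fun q => if q.2 = i + c a q.1 then x q.1 else 0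

theorem zmod_two_eq_or (i j : ZMod 2) : j = i ∨ j = i + 1 := by
  revert i j
  decide

theorem sheet_add (a : V) (i : ZMod 2) (x : V → ℝ) (b : V) :
    sheet c a i x (b, 0) + sheet c a i x (b, 1) = x b := by
  have : ∀ k : ZMod 2, (if (0 : ZMod 2) = k then x b else 0) +
      (if (1 : ZMod 2) = k then x b else 0) = x b := by
    intro k
    rcases zmod_two_eq_or 0 k with rfl | rfl <;> simp
  exact this _

/-- The support of `x` together with `a` lies in a face, and on that face the cocycle identity makes
the labels transported from `a` compatible with one another. -/
theorem sheet_mem (hc : ∀ s ∈ K.faces, ∀ a ∈ s, ∀ b ∈ s, ∀ d ∈ s, c a b + c b d = c a d)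
    {a : V} {i : ZMod 2} {x : V → ℝ} (hx : x ∈ K.realization) (ha : 0 < x a) :
    sheet c a i x ∈ K.doubleCover c := by
  classical
  refine ⟨fun q => ?_, ?_, fun b j d k hk => ?_⟩
  · unfold sheet
    split_ifs
    · exact hx.1 _
    · exact le_rfl
  · simpa only [sheet_add] using hx
  · by_contra hne
    rw [mul_eq_zero, not_or] at hne
    obtain ⟨h1, h2⟩ := hne
    simp only [sheet, ite_eq_right_iff, not_forall, exists_prop] at h1 h2
    have hface : {a, b, d} ∈ K.faces := mem_faces_of_pos (mem_coneSet_of_mem_realization hx)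
      (by simp) (by
        simp only [Finset.mem_insert, Finset.mem_singleton, forall_eq_or_imp, forall_eq]
        exact ⟨ha, (hx.1 b).lt_of_ne' h1.2, (hx.1 d).lt_of_ne' h2.2⟩)
    apply hk
    rw [h1.1, h2.1, add_assoc, hc _ hface a (by simp) b (by simp) d (by simp)]

/-- One positive coordinate `(a, i)` determines the label of every other vertex in the support, so
the point is recovered from its projection. -/
theorem sheet_eq {a : V} {i : ZMod 2} (z : K.doubleCover c)
    (ha : 0 < (z : V × ZMod 2 → ℝ) (a, i)) :
    sheet c a i (K.doubleCoverProj c z : V → ℝ) = z := by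
  funext ⟨b, j⟩
  have h0 := z.2.2.2
  have hz : ∀ k, k ≠ i + c a b → (z : V × ZMod 2 → ℝ) (b, k) = 0 := fun k hk =>
    (mul_eq_zero.1 (h0 a i b k hk)).resolve_left ha.ne'
  unfold sheet
  simp only [doubleCoverProj]
  split_ifs with h
  · have h1 := hz (j + 1) (by rw [← h]; simp)
    have h2 : ∀ j : ZMod 2, (z : V × ZMod 2 → ℝ) (b, 0) + (z : V × ZMod 2 → ℝ) (b, 1) =
        (z : V × ZMod 2 → ℝ) (b, j) + (z : V × ZMod 2 → ℝ) (b, j + 1) := by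
      intro j
      fin_cases j
      · rfl
      · exact add_comm _ _
    rw [h2 j, h1, add_zero]
  · exact (hz j h).symm

/-- Where a fixed coordinate `(a, i)` is positive, the projection is a homeomorphism onto the open
star of `a` with inverse `sheet`. A local homeomorphism from a compact space to a Hausdorff space is
a covering map. -/
theorem isCoveringMap_doubleCoverProj (hfin : K.faces.Finite)
    (hc : ∀ s ∈ K.faces, ∀ a ∈ s, ∀ b ∈ s, ∀ d ∈ s, c a b + c b d = c a d) :
    IsCoveringMap (K.doubleCoverProj c) := by
  have hcomp : CompactSpace (K.doubleCover c) :=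
    isCompact_iff_compactSpace.1 (isCompact_doubleCover hfin)
  rw [← isLocalHomeomorph_iff_isCoveringMap, isLocalHomeomorph_iff_isOpenEmbedding_restrict]
  intro z
  obtain ⟨a, ha⟩ := exists_pos_of_mem_realization z.2.2.1
  obtain ⟨i, hi⟩ : ∃ i, 0 < (z : V × ZMod 2 → ℝ) (a, i) := by
    by_contra hn
    push Not at hn
    linarith [hn 0, hn 1]
  let U : Set (K.doubleCover c) := {z | 0 < (z : V × ZMod 2 → ℝ) (a, i)}
  have hU : IsOpen U := isOpen_lt continuous_const ((continuous_apply _).comp continuous_subtype_val)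
  have hpos : ∀ z : K.doubleCover c, z ∈ U → 0 < (K.doubleCoverProj c z : V → ℝ) a := by
    intro z hz
    have h0 := z.2.1
    change 0 < (z : V × ZMod 2 → ℝ) (a, i) at hz
    change 0 < (z : V × ZMod 2 → ℝ) (a, 0) + (z : V × ZMod 2 → ℝ) (a, 1)
    rcases zmod_two_eq_or 0 i with rfl | rfl
    · linarith [h0 (a, 1)]
    · rw [zero_add] at hz
      linarith [h0 (a, 0)]
  let φ : U ≃ₜ {x : K.realization | 0 < (x : V → ℝ) a} :=
    { toFun := fun z => ⟨K.doubleCoverProj c z, hpos z z.2⟩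
      invFun := fun x => ⟨⟨sheet c a i x, sheet_mem hc x.1.2 x.2⟩, by
        have haK : {a} ∈ K.faces :=
          mem_vertexSet_of_pos (mem_coneSet_of_mem_realization x.1.2) x.2
        have h0 : c a a = 0 := by simpa using hc _ haK a (by simp) a (by simp) a (by simp)
        have hxa : 0 < ((x : K.realization) : V → ℝ) a := x.2
        change 0 < sheet c a i x (a, i)
        simpa only [sheet, h0, add_zero, if_true] using hxa⟩
      left_inv := fun z => Subtype.ext (Subtype.ext (sheet_eq z.1 z.2))
      right_inv := fun x => Subtype.ext (Subtype.ext (funext fun b => sheet_add a i _ b))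
      continuous_toFun := Continuous.subtype_mk
        (continuous_doubleCoverProj.comp continuous_subtype_val) _
      continuous_invFun := by
        refine Continuous.subtype_mk (Continuous.subtype_mk (continuous_pi fun q => ?_) _) _
        unfold sheet
        split_ifs
        · exact (continuous_apply _).comp (continuous_subtype_val.comp continuous_subtype_val)
        · exact continuous_const }
  exact ⟨U, hU.mem_nhds hi, isOpen_star.isOpenEmbedding_subtypeVal.comp φ.isOpenEmbedding⟩

/-- A cocycle modulo 2 on a complex is a coboundary if the complement of a point that does not lie
on the 1-skeleton is a Euclidean space. -/
theorem exists_potential (hfin : K.faces.Finite) {B : Type*} [NormedAddCommGroup B]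
    [NormedSpace ℝ B] {j : B → K.realization} (hj : IsOpenEmbedding j) {x₀ : K.realization}
    (hjr : range j = {x₀}ᶜ) {p q r : V} (hpq : p ≠ q) (hpr : p ≠ r) (hqr : q ≠ r)
    (hp : (x₀ : V → ℝ) p ≠ 0) (hq : (x₀ : V → ℝ) q ≠ 0) (hr : (x₀ : V → ℝ) r ≠ 0)
    (hc : ∀ s ∈ K.faces, ∀ a ∈ s, ∀ b ∈ s, ∀ d ∈ s, c a b + c b d = c a d) :
    ∃ f : V → ZMod 2, ∀ s ∈ K.faces, ∀ a ∈ s, ∀ b ∈ s, f b = f a + c a b := by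
  classical
  have hcov := isCoveringMap_doubleCoverProj hfin hc
  obtain ⟨e₀, he₀⟩ : ∃ e₀ : K.doubleCover c, K.doubleCoverProj c e₀ = j 0 := by
    obtain ⟨a, ha⟩ := exists_pos_of_mem_realization (j 0).2
    exact ⟨⟨sheet c a 0 (j 0), sheet_mem hc (j 0).2 ha⟩,
      Subtype.ext (funext fun b => sheet_add a 0 _ b)⟩
  -- The normed space is simply connected, so `j` lifts: the cover has a section over the complement
  -- of `x₀`.
  obtain ⟨S, ⟨-, hS⟩, -⟩ := hcov.existsUnique_continuousMap_lifts ⟨j, hj.continuous⟩ 0 e₀ he₀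
  have hS' : ∀ w a, (S w : V × ZMod 2 → ℝ) (a, 0) + (S w : V × ZMod 2 → ℝ) (a, 1) =
      (j w : V → ℝ) a := fun w a =>
    congrFun (congrArg Subtype.val (congrFun hS w)) a
  have hS2 : ∀ w a i, (S w : V × ZMod 2 → ℝ) (a, i) = 0 ∨
      (S w : V × ZMod 2 → ℝ) (a, i) = (j w : V → ℝ) a := by
    intro w a i
    rcases eq_or_ne ((j w : V → ℝ) a) 0 with h | h
    · left
      have h0 := (S w).2.1
      have h1 := hS' w a
      rw [h] at h1
      have h2 : ∀ i, (S w : V × ZMod 2 → ℝ) (a, i) = 0 := by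
        intro i
        rcases zmod_two_eq_or 0 i with rfl | rfl
        · linarith [h0 (a, 0), h0 (a, 1)]
        · rw [zero_add]; linarith [h0 (a, 0), h0 (a, 1)]
      exact h2 i
    · have haK : {a} ∈ K.faces := mem_vertexSet_of_pos (mem_coneSet_of_mem_realization (j w).2)
        (((j w).2.1 a).lt_of_ne' h)
      have h0 : c a a = 0 := by simpa using hc _ haK a (by simp) a (by simp) a (by simp)
      have h1 := (S w).2.2.2 a 0 a 1 (by rw [h0]; decide)
      have h2 := hS' w a
      rcases mul_eq_zero.1 h1 with h3 | h3 <;> rw [h3] at h2 <;>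
        rcases zmod_two_eq_or 0 i with rfl | rfl
      · exact Or.inl h3
      · exact Or.inr (by rw [zero_add, ← h2, zero_add])
      · exact Or.inr (by rw [← h2, add_zero])
      · exact Or.inl (by rwa [zero_add])
  -- The potential at `a` is the label of the sheet through which the section passes over the vertex
  -- `a`; labels whose vertex is not reached get the default 0.
  have hf : ∀ a, ∃ i : ZMod 2, ∀ w, (j w : V → ℝ) = vtx a → (S w : V × ZMod 2 → ℝ) (a, i) = 1 := by
    intro a
    by_cases ha : ∃ w, (j w : V → ℝ) = vtx a
    · obtain ⟨w, hw⟩ := ha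
      have huniq : ∀ w', (j w' : V → ℝ) = vtx a → w' = w := fun w' hw' =>
        hj.injective (Subtype.ext (hw'.trans hw.symm))
      have h1 := hS' w a
      rw [hw, vtx_self] at h1
      have h2 := hS2 w a 0
      rw [hw, vtx_self] at h2
      rcases h2 with h2 | h2
      · exact ⟨1, fun w' hw' => by rw [huniq w' hw']; linarith⟩
      · exact ⟨0, fun w' hw' => by rw [huniq w' hw']; exact h2⟩
    · exact ⟨0, fun w hw => absurd ⟨w, hw⟩ ha⟩
  choose f hf using hf
  refine ⟨f, fun s hs a has b hbs => ?_⟩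
  have haK := mem_vertexSet_of_mem hs has
  have hbK := mem_vertexSet_of_mem hs hbs
  have hcaa : c a a = 0 := by simpa using hc _ haK a (by simp) a (by simp) a (by simp)
  rcases eq_or_ne a b with rfl | hab
  · rw [hcaa, add_zero]
  have hface : {a, b} ∈ K.faces := mem_faces_of_subset hs (by
    intro w hw
    rw [Finset.mem_insert, Finset.mem_singleton] at hw
    rcases hw with rfl | rfl <;> assumption) (by simp)
  let γ : ℝ → V → ℝ := fun t => (1 - t) • vtx a + t • vtx b
  have hγa : ∀ t, γ t a = 1 - t := fun t => by simp [γ, vtx_of_ne hab]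
  have hγb : ∀ t, γ t b = t := fun t => by simp [γ, vtx_of_ne hab.symm]
  have hγ0 : ∀ t w, w ≠ a → w ≠ b → γ t w = 0 := fun t w h1 h2 => by
    simp [γ, vtx_of_ne h1, vtx_of_ne h2]
  have hγK : ∀ t ∈ Icc (0 : ℝ) 1, γ t ∈ K.realization := by
    intro t ht
    refine ⟨fun w => add_nonneg (mul_nonneg (by linarith [ht.2]) (vtx_nonneg _ _))
      (mul_nonneg ht.1 (vtx_nonneg _ _)), {a, b}, hface, fun w hw => ?_, ?_⟩
    · simp only [Finset.mem_insert, Finset.mem_singleton, not_or] at hw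
      exact hγ0 t w hw.1 hw.2
    · rw [Finset.sum_pair hab, hγa, hγb]
      ring
  -- Points of an edge have at most two nonzero coordinates, whereas `x₀` has three.
  have hγx : ∀ t (ht : t ∈ Icc (0 : ℝ) 1), (⟨γ t, hγK t ht⟩ : K.realization) ∈ range j := by
    intro t ht
    rw [hjr]
    rintro rfl
    have h1 : ∀ w, γ t w ≠ 0 → w = a ∨ w = b := fun w hw => by
      by_contra hn
      rw [not_or] at hn
      exact hw (hγ0 t w hn.1 hn.2)
    rcases h1 p hp with rfl | rfl <;> rcases h1 q hq with rfl | rfl <;>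
      rcases h1 r hr with rfl | rfl <;> simp_all
  let jh := hj.toIsEmbedding.toHomeomorph
  let W : Icc (0 : ℝ) 1 → B := fun t => jh.symm ⟨⟨γ t, hγK t t.2⟩, hγx t t.2⟩
  have hjW : ∀ t, (j (W t) : V → ℝ) = γ t := fun t =>
    congrArg Subtype.val (congrArg Subtype.val (jh.apply_symm_apply _))
  have hWc : Continuous W := jh.symm.continuous.comp
    (Continuous.subtype_mk (Continuous.subtype_mk (by fun_prop) _) _)
  let Z : V × ZMod 2 → ℝ → ℝ := fun q t => (S (W (projIcc 0 1 zero_le_one t)) : V × ZMod 2 → ℝ) q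
  have hZc : ∀ q, Continuous (Z q) := fun q => (continuous_apply q).comp
    (continuous_subtype_val.comp (S.continuous.comp (hWc.comp continuous_projIcc)))
  have hZ2 : ∀ t ∈ Icc (0 : ℝ) 1, ∀ d i, Z (d, i) t = 0 ∨ Z (d, i) t = γ t d := by
    intro t ht d i
    have := hS2 (W (projIcc 0 1 zero_le_one t)) d i
    rw [hjW, projIcc_of_mem _ ht] at this
    simp only [Z]
    rwa [projIcc_of_mem _ ht]
  have hZ0 : Z (a, f a) 0 = 1 := hf a _ (by
    rw [hjW, projIcc_left]
    simp [γ])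
  have hZ1 : Z (b, f b) 1 = 1 := hf b _ (by
    rw [hjW, projIcc_right]
    simp [γ])
  -- On the first half of the edge this coordinate is either 0 or 1 - t ≥ 1/2. It starts at 1, and
  -- by continuity it cannot jump over the value 1/4. At the midpoint both labels are thus present,
  -- and the definition of the cover relates them by `c a b`.
  have hhalf_a : Z (a, f a) (1 / 2) ≠ 0 := by
    intro h
    obtain ⟨t, ht, hzt⟩ := intermediate_value_Icc' (show (0 : ℝ) ≤ 1 / 2 by norm_num)
      (hZc (a, f a)).continuousOn (show (1 / 4 : ℝ) ∈ _ by rw [h, hZ0]; constructor <;> norm_num)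
    have := hZ2 t ⟨ht.1, ht.2.trans (by norm_num)⟩ a (f a)
    rw [hzt, hγa] at this
    rcases this with h | h <;> linarith [ht.2]
  have hhalf_b : Z (b, f b) (1 / 2) ≠ 0 := by
    intro h
    obtain ⟨t, ht, hzt⟩ := intermediate_value_Icc (show (1 / 2 : ℝ) ≤ 1 by norm_num)
      (hZc (b, f b)).continuousOn (show (1 / 4 : ℝ) ∈ _ by rw [h, hZ1]; constructor <;> norm_num)
    have := hZ2 t ⟨(by norm_num : (0 : ℝ) ≤ 1 / 2).trans ht.1, ht.2⟩ b (f b)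
    rw [hzt, hγb] at this
    rcases this with h | h <;> linarith [ht.1]
  by_contra hne
  rcases mul_eq_zero.1 ((S _).2.2.2 a (f a) b (f b) hne) with h | h
  · exact hhalf_a h
  · exact hhalf_b h

end DoubleCover

end PreAbstractSimplicialComplex

/-! ### Face numbers and double counting. Faces are indexed by the number of vertices, one more than
the dimension. -/

namespace PreAbstractSimplicialComplex

variable {V : Type*} {K : PreAbstractSimplicialComplex V} {F : Finset V}

/-- The faces of `K` with `i` vertices. -/
abbrev FaceOfCard (K : PreAbstractSimplicialComplex V) (i : ℕ) : Type _ :=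
  {s : Finset V // s ∈ K.faces ∧ s.card = i}

/-- The number of faces of `K` with `i` vertices. -/
noncomputable def faceNum (K : PreAbstractSimplicialComplex V) (i : ℕ) : ℕ :=
  Nat.card (K.FaceOfCard i)

theorem finite_faceOfCard (hfin : K.faces.Finite) (i : ℕ) : Finite (K.FaceOfCard i) :=
  (hfin.subset fun _ hs => hs.1 : {s | s ∈ K.faces ∧ s.card = i}.Finite)

theorem faceNum_eq_card_filter (hfin : K.faces.Finite) (i : ℕ) :
    K.faceNum i = (hfin.toFinset.filter fun s => s.card = i).card := by
  classical
  rw [faceNum, Nat.subtype_card]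
  intro s
  simp

theorem eulerChar_eq_sum (hfin : K.faces.Finite) {d : ℕ} (hd : ∀ s ∈ K.faces, s.card ≤ d) :
    K.eulerChar = ∑ i ∈ Finset.range d, (-1 : ℤ) ^ i * K.faceNum (i + 1) := by
  classical
  rw [eulerChar, finsum_mem_eq_finite_toFinset_sum _ hfin,
    ← Finset.sum_fiberwise_of_maps_to (s := hfin.toFinset) (t := Finset.range d)
      (g := fun s => s.card - 1)]
  · refine Finset.sum_congr rfl fun i _ => ?_
    rw [faceNum_eq_card_filter hfin]
    have h1 : (hfin.toFinset.filter fun s => s.card - 1 = i) =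
        hfin.toFinset.filter fun s => s.card = i + 1 := by
      refine Finset.filter_congr fun s hs => ?_
      have := (nonempty_of_mem_faces (hfin.mem_toFinset.1 hs)).card_pos
      omega
    rw [h1, Finset.sum_congr rfl (g := fun _ => (-1 : ℤ) ^ i), Finset.sum_const, nsmul_eq_mul,
      mul_comm]
    intro s hs
    rw [(Finset.mem_filter.1 hs).2, pow_add, pow_add]
    norm_num
  · intro s hs
    have h1 := (nonempty_of_mem_faces (hfin.mem_toFinset.1 hs)).card_pos
    have h2 := hd s (hfin.mem_toFinset.1 hs)
    rw [Finset.mem_range]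
    omega

/-- Pairs of a vertex and a face with i + 1 vertices containing it are counted in two ways. The
bound on `i` is needed because links do not contain the empty face. -/
theorem sum_faceNum_link (hfin : K.faces.Finite) {A : Finset V} (hA : ∀ v, v ∈ A ↔ v ∈ K.vertexSet)
    {i : ℕ} (hi : 1 ≤ i) :
    ∑ v ∈ A, (K.link {v}).faceNum i = (i + 1) * K.faceNum (i + 1) := by
  classical
  set S := hfin.toFinset.filter fun s => s.card = i + 1 with hS
  have h := Finset.sum_card_bipartiteAbove_eq_sum_card_bipartiteBelow (s := A) (t := S)
    (fun (v : V) (s : Finset V) => v ∈ s)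
  have h1 : ∀ v ∈ A, (S.bipartiteAbove (fun (v : V) (s : Finset V) => v ∈ s) v).card =
      (K.link {v}).faceNum i := by
    intro v _
    rw [faceNum_eq_card_filter (finite_link hfin _)]
    refine Finset.card_bij' (fun s _ => s.erase v) (fun t _ => insert v t) ?_ ?_ ?_ ?_
    · intro s hs
      simp only [Finset.bipartiteAbove, hS, Finset.mem_filter, Set.Finite.mem_toFinset] at hs ⊢
      have hc : (s.erase v).card = i := by rw [Finset.card_erase_of_mem hs.2, hs.1.2]; rfl
      refine ⟨mem_link_singleton_faces.2 ⟨?_, Finset.notMem_erase _ _, ?_⟩, hc⟩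
      · rw [← Finset.card_pos]; omega
      · rw [Finset.insert_erase hs.2]; exact hs.1.1
    · intro t ht
      simp only [Finset.bipartiteAbove, hS, Finset.mem_filter, Set.Finite.mem_toFinset,
        mem_link_singleton_faces] at ht ⊢
      exact ⟨⟨ht.1.2.2, by rw [Finset.card_insert_of_notMem ht.1.2.1, ht.2]⟩,
        Finset.mem_insert_self _ _⟩
    · intro s hs
      simp only [Finset.bipartiteAbove, Finset.mem_filter] at hs
      exact Finset.insert_erase hs.2
    · intro t ht
      simp only [Finset.mem_filter, Set.Finite.mem_toFinset, mem_link_singleton_faces] at ht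
      exact Finset.erase_insert ht.1.2.1
  have h2 : ∀ s ∈ S, (A.bipartiteBelow (fun (v : V) (s : Finset V) => v ∈ s) s).card = i + 1 := by
    intro s hs
    rw [hS, Finset.mem_filter, Set.Finite.mem_toFinset] at hs
    rw [← hs.2]
    congr 1
    ext v
    simp only [Finset.bipartiteBelow, Finset.mem_filter, hA, and_iff_right_iff_imp]
    exact fun hv => mem_vertexSet_of_mem hs.1 hv
  rw [Finset.sum_congr rfl h1, Finset.sum_congr rfl h2, Finset.sum_const, smul_eq_mul,
    ← faceNum_eq_card_filter hfin] at h
  rw [h, mul_comm]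

theorem IsSphereComplex.card_le {m : ℕ} (hK : K.IsSphereComplex m) {s : Finset V}
    (hs : s ∈ K.faces) : s.card ≤ m := by
  obtain ⟨k, hk, -⟩ := hK.link s hs
  omega

theorem card_sphere_fin_one :
    Nat.card (Metric.sphere (0 : EuclideanSpace ℝ (Fin 1)) 1) = 2 := by
  have hn : ∀ z : EuclideanSpace ℝ (Fin 1), ‖z‖ = |z 0| := fun z => by
    rw [EuclideanSpace.norm_eq]
    simp [Real.sqrt_sq_eq_abs]
  rw [Nat.card_eq_two_iff]
  refine ⟨⟨WithLp.toLp 2 fun _ => 1, by simp [hn]⟩, ⟨WithLp.toLp 2 fun _ => -1, by simp [hn]⟩,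
    ?_, ?_⟩
  · intro h
    have := congrFun (congrArg (fun z => (z.1 : Fin 1 → ℝ)) h) 0
    norm_num at this
  · refine eq_univ_of_forall fun z => ?_
    have hz : |(z : EuclideanSpace ℝ (Fin 1)) 0| = 1 := by
      rw [← hn]; exact norm_eq_of_mem_sphere z
    rcases eq_or_eq_neg_of_abs_eq hz with h | h
    · left
      ext i
      rw [Subsingleton.elim i 0, h]
    · right
      ext i
      rw [Subsingleton.elim i 0, h]

/-- All faces are single vertices, so the realization is in bijection with the vertices, and a
0-sphere has two points. -/
theorem IsSphereComplex.faceNum_one_of_one (hK : K.IsSphereComplex 1) : K.faceNum 1 = 2 := by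
  obtain ⟨g⟩ := hK.sphere
  rw [← card_sphere_fin_one, ← Nat.card_congr g.toEquiv, faceNum]
  have hmem : ∀ s : K.FaceOfCard 1, (Set.indicator (s.1 : Set V) 1 : V → ℝ) ∈ K.realization := by
    rintro ⟨s, hs, hcard⟩
    obtain ⟨a, rfl⟩ := Finset.card_eq_one.1 hcard
    rw [Finset.coe_singleton]
    exact vtx_mem_realization hs
  refine Nat.card_congr (Equiv.ofBijective (fun s => ⟨_, hmem s⟩) ⟨?_, ?_⟩)
  · rintro ⟨s, hs⟩ ⟨t, ht⟩ h
    have := congrArg Subtype.val h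
    simp only at this
    exact Subtype.ext (Finset.coe_injective (Set.indicator_one_inj ℝ this))
  · rintro ⟨x, h0, s, hs, hxs, hsum⟩
    have h1 : s.card = 1 := le_antisymm (hK.card_le hs) (nonempty_of_mem_faces hs).card_pos
    refine ⟨⟨s, hs, h1⟩, Subtype.ext ?_⟩
    obtain ⟨a, rfl⟩ := Finset.card_eq_one.1 h1
    rw [Finset.sum_singleton] at hsum
    funext w
    by_cases hw : w = a
    · simp [hw, hsum]
    · simp [hw, hxs w (by simpa using hw)]

theorem exists_vertex_finset (hfin : K.faces.Finite) :
    ∃ A : Finset V, ∀ v, v ∈ A ↔ v ∈ K.vertexSet := by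
  classical
  obtain ⟨F, hF⟩ := exists_supportedOn hfin
  exact ⟨F.filter fun v => v ∈ K.vertexSet, fun v => by
    rw [Finset.mem_filter]
    exact ⟨And.right, fun h => ⟨hF.mem h, h⟩⟩⟩

theorem card_eq_faceNum_one (hfin : K.faces.Finite) {A : Finset V}
    (hA : ∀ v, v ∈ A ↔ v ∈ K.vertexSet) : A.card = K.faceNum 1 := by
  classical
  rw [faceNum_eq_card_filter hfin]
  refine Finset.card_bij (fun v _ => {v}) ?_ ?_ ?_
  · intro v hv
    rw [Finset.mem_filter, Set.Finite.mem_toFinset]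
    exact ⟨(hA v).1 hv, Finset.card_singleton v⟩
  · intro v _ w _ h
    exact Finset.singleton_injective h
  · intro s hs
    rw [Finset.mem_filter, Set.Finite.mem_toFinset] at hs
    obtain ⟨a, rfl⟩ := Finset.card_eq_one.1 hs.2
    exact ⟨a, (hA a).2 hs.1, rfl⟩

theorem IsSphereComplex.faceNum_two_of_two (hK : K.IsSphereComplex 2) :
    K.faceNum 2 = K.faceNum 1 := by
  obtain ⟨A, hA⟩ := exists_vertex_finset hK.finite
  have h := sum_faceNum_link hK.finite hA le_rfl
  rw [Finset.sum_congr rfl fun v hv => (hK.link_singleton ((hA v).1 hv)).faceNum_one_of_one,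
    Finset.sum_const, smul_eq_mul, card_eq_faceNum_one hK.finite hA] at h
  norm_num at h
  omega

/-- Each vertex link is a circle and has as many edges as vertices; summing this over all vertices
gives the usual count of two triangles at each edge. -/
theorem IsSphereComplex.faceNum_three_of_three (hK : K.IsSphereComplex 3) :
    3 * K.faceNum 3 = 2 * K.faceNum 2 := by
  obtain ⟨A, hA⟩ := exists_vertex_finset hK.finite
  have h1 := sum_faceNum_link hK.finite hA (i := 1) le_rfl
  have h2 := sum_faceNum_link hK.finite hA (i := 2) (by norm_num)
  rw [Finset.sum_congr rfl fun v hv => (hK.link_singleton ((hA v).1 hv)).faceNum_two_of_two, h1] at h2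
  norm_num at h2
  omega

theorem IsSphereComplex.isPreconnected {m : ℕ} (hK : K.IsSphereComplex (m + 2)) :
    IsPreconnected K.realization := by
  obtain ⟨g⟩ := hK.sphere
  have h1 : IsPreconnected (Metric.sphere (0 : EuclideanSpace ℝ (Fin (m + 2))) 1) := by
    refine isPreconnected_sphere ?_ 0 1
    rw [← Module.finrank_eq_rank, finrank_euclideanSpace_fin]
    exact_mod_cast (by omega : 1 < m + 2)
  have := isPreconnected_iff_preconnectedSpace.1 h1
  exact isPreconnected_iff_preconnectedSpace.2
    (g.symm.surjective.denseRange.preconnectedSpace g.symm.continuous)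

section Cochains

/-- The incidence matrix modulo 2 of the faces with `i` and with `j` vertices. -/
noncomputable def incidence (K : PreAbstractSimplicialComplex V) (i j : ℕ) :
    Matrix (K.FaceOfCard i) (K.FaceOfCard j) (ZMod 2) :=
  open scoped Classical in
  Matrix.of fun s t => if s.1 ⊆ t.1 then 1 else 0

/-- Identifies the transposed incidence matrix with the simplicial coboundary modulo 2. The
extension `g'` allows the sum to run over the deleted vertex without carrying face proofs. -/
theorem incidence_transpose_mulVec [DecidableEq V] {i : ℕ} (hi : 1 ≤ i) [Fintype (K.FaceOfCard i)]
    (g : K.FaceOfCard i → ZMod 2) {g' : Finset V → ZMod 2} (hg : ∀ s, g' s.1 = g s)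
    (t : K.FaceOfCard (i + 1)) :
    (K.incidence i (i + 1)).transpose.mulVec g t = ∑ x ∈ t.1, g' (t.1.erase x) := by
  have hcard : ∀ x ∈ t.1, (t.1.erase x).card = i := fun x hx => by
    rw [Finset.card_erase_of_mem hx, t.2.2]; rfl
  have hface : ∀ x ∈ t.1, t.1.erase x ∈ K.faces ∧ (t.1.erase x).card = i := fun x hx =>
    ⟨mem_faces_of_subset t.2.1 (Finset.erase_subset _ _) (by
      rw [← Finset.card_pos, hcard x hx]; omega), hcard x hx⟩
  simp only [Matrix.mulVec, dotProduct, Matrix.transpose_apply, incidence, Matrix.of_apply,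
    ite_mul, one_mul, zero_mul]
  rw [← Finset.sum_filter]
  symm
  refine Finset.sum_bij (fun x hx => ⟨t.1.erase x, hface x hx⟩) ?_ ?_ ?_ ?_
  · intro x hx
    rw [Finset.mem_filter]
    exact ⟨Finset.mem_univ _, Finset.erase_subset _ _⟩
  · intro x hx y hy h
    exact Finset.erase_injOn t.1 hx hy (congrArg Subtype.val h)
  · rintro ⟨s, hs, hsc⟩ h
    rw [Finset.mem_filter] at h
    have h1 : (t.1 \ s).card = 1 := by
      rw [Finset.card_sdiff_of_subset h.2, t.2.2, hsc]; omega
    obtain ⟨x, hx⟩ := Finset.card_eq_one.1 h1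
    have hx' : x ∈ t.1 \ s := by rw [hx]; exact Finset.mem_singleton_self x
    refine ⟨x, (Finset.mem_sdiff.1 hx').1, Subtype.ext ?_⟩
    change t.1.erase x = s
    rw [Finset.erase_eq, ← hx, Finset.sdiff_sdiff_eq_self h.2]
  · intro x hx
    exact hg ⟨_, hface x hx⟩

end Cochains

end PreAbstractSimplicialComplex

/-! ### Cohomology modulo 2 of 2-spheres and the Euler relation. -/

namespace PreAbstractSimplicialComplex

variable {V : Type*} {K : PreAbstractSimplicialComplex V} {F : Finset V}

theorem pair_mem_faces [DecidableEq V] {s : Finset V} (hs : s ∈ K.faces) {a b : V} (ha : a ∈ s)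
    (hb : b ∈ s) : {a, b} ∈ K.faces :=
  mem_faces_of_subset hs (Finset.insert_subset ha (Finset.singleton_subset_iff.2 hb))
    (Finset.insert_nonempty _ _)

theorem triple_mem_faces [DecidableEq V] {s : Finset V} (hs : s ∈ K.faces) {a b d : V}
    (ha : a ∈ s) (hb : b ∈ s) (hd : d ∈ s) : {a, b, d} ∈ K.faces :=
  mem_faces_of_subset hs (Finset.insert_subset ha (Finset.insert_subset hb
    (Finset.singleton_subset_iff.2 hd))) (Finset.insert_nonempty _ _)

theorem finrank_eq_one_of_const {ι k : Type*} [Field k] [Nonempty ι] {S : Submodule k (ι → k)}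
    (h1 : (fun _ => 1) ∈ S) (hS : ∀ f ∈ S, ∀ i j, f i = f j) : Module.finrank k S = 1 := by
  have h : S = Submodule.span k {fun _ => 1} := by
    refine le_antisymm (fun f hf => ?_) ((Submodule.span_singleton_le_iff_mem _ _).2 h1)
    obtain ⟨i⟩ := ‹Nonempty ι›
    refine Submodule.mem_span_singleton.2 ⟨f i, funext fun j => ?_⟩
    rw [Pi.smul_apply, smul_eq_mul, mul_one, hS f hf i j]
  rw [h]
  refine finrank_span_singleton fun h0 => ?_
  obtain ⟨i⟩ := ‹Nonempty ι›
  exact one_ne_zero (congrFun h0 i)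

/-- Extension by zero of a function on the faces with `i` vertices. -/
noncomputable def extendZero {i : ℕ} (g : K.FaceOfCard i → ZMod 2) (s : Finset V) : ZMod 2 :=
  open scoped Classical in if h : s ∈ K.faces ∧ s.card = i then g ⟨s, h⟩ else 0

theorem extendZero_coe {i : ℕ} (g : K.FaceOfCard i → ZMod 2) (s : K.FaceOfCard i) :
    extendZero g s.1 = g s := by
  rw [extendZero, dif_pos s.2]

theorem coboundary_vertex [DecidableEq V] [Fintype (K.FaceOfCard 1)] (g : K.FaceOfCard 1 → ZMod 2)
    {a b : V} (hab : a ≠ b) (h : {a, b} ∈ K.faces ∧ ({a, b} : Finset V).card = 2) :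
    (K.incidence 1 2).transpose.mulVec g ⟨{a, b}, h⟩ = extendZero g {b} + extendZero g {a} := by
  have h1 := incidence_transpose_mulVec le_rfl g (extendZero_coe g) ⟨{a, b}, h⟩
  refine h1.trans ?_
  rw [Finset.sum_pair hab]
  congr 2
  · ext x; simp only [Finset.mem_erase, Finset.mem_insert, Finset.mem_singleton]; grind
  · ext x; simp only [Finset.mem_erase, Finset.mem_insert, Finset.mem_singleton]; grind

theorem coboundary_edge [DecidableEq V] [Fintype (K.FaceOfCard 2)] (g : K.FaceOfCard 2 → ZMod 2)
    {a b d : V} (hab : a ≠ b) (had : a ≠ d) (hbd : b ≠ d)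
    (h : {a, b, d} ∈ K.faces ∧ ({a, b, d} : Finset V).card = 3) :
    (K.incidence 2 3).transpose.mulVec g ⟨{a, b, d}, h⟩ =
      extendZero g {b, d} + (extendZero g {a, d} + extendZero g {a, b}) := by
  have h1 := incidence_transpose_mulVec (by norm_num) g (extendZero_coe g) ⟨{a, b, d}, h⟩
  refine h1.trans ?_
  rw [Finset.sum_insert (by simp [hab, had]), Finset.sum_pair hbd]
  congr 2
  · ext x; simp only [Finset.mem_erase, Finset.mem_insert, Finset.mem_singleton]; grind
  · congr 1; ext x; simp only [Finset.mem_erase, Finset.mem_insert, Finset.mem_singleton]; grind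
  · congr 1; ext x; simp only [Finset.mem_erase, Finset.mem_insert, Finset.mem_singleton]; grind

namespace IsSphereComplex

/-- By induction: a face of maximal size in the link of a vertex, joined with that vertex. -/
theorem nonempty_faceOfCard {m : ℕ} (hm : 1 ≤ m) : ∀ {K : PreAbstractSimplicialComplex V},
    K.IsSphereComplex m → ∃ s ∈ K.faces, s.card = m := by
  classical
  induction m, hm using Nat.le_induction with
  | base =>
    intro K hK
    have h := hK.faceNum_one_of_one
    have : Nonempty (K.FaceOfCard 1) := by
      by_contra hne
      rw [not_nonempty_iff] at hne
      rw [faceNum, Nat.card_of_isEmpty] at h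
      omega
    obtain ⟨s⟩ := this
    exact ⟨s.1, s.2⟩
  | succ m hm ih =>
    intro K hK
    obtain ⟨g⟩ := hK.sphere
    have hne : (Metric.sphere (0 : EuclideanSpace ℝ (Fin (m + 1))) 1).Nonempty :=
      NormedSpace.sphere_nonempty.2 zero_le_one
    obtain ⟨z, hz⟩ := hne
    obtain ⟨p, hp⟩ := exists_pos_of_mem_realization (g.symm ⟨z, hz⟩).2
    have hpK := mem_vertexSet_of_pos (mem_coneSet_of_mem_realization (g.symm ⟨z, hz⟩).2) hp
    obtain ⟨s, hs, hsm⟩ := ih (hK.link_singleton hpK)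
    rw [mem_link_singleton_faces] at hs
    exact ⟨insert p s, hs.2.2, by rw [Finset.card_insert_of_notMem hs.2.1, hsm]⟩

/-- Cocycles of degree 0 are constant along edges, hence constant by connectedness. -/
theorem finrank_ker_coboundary (hK : K.IsSphereComplex 3) [Fintype (K.FaceOfCard 1)] :
    Module.finrank (ZMod 2) (K.incidence 1 2).transpose.mulVecLin.ker = 1 := by
  classical
  have hne : Nonempty (K.FaceOfCard 1) := by
    obtain ⟨s, hs, hcard⟩ := nonempty_faceOfCard (by norm_num) hK
    obtain ⟨a, ha⟩ := nonempty_of_mem_faces hs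
    exact ⟨⟨{a}, mem_vertexSet_of_mem hs ha, Finset.card_singleton a⟩⟩
  refine finrank_eq_one_of_const ?_ ?_
  · rw [LinearMap.mem_ker, Matrix.mulVecLin_apply]
    ext ⟨t, ht, hcard⟩
    obtain ⟨a, b, hab, rfl⟩ := Finset.card_eq_two.1 hcard
    rw [coboundary_vertex _ hab, extendZero, extendZero,
      dif_pos ⟨mem_vertexSet_of_mem ht (by simp), Finset.card_singleton b⟩,
      dif_pos ⟨mem_vertexSet_of_mem ht (by simp), Finset.card_singleton a⟩]
    exact CharTwo.add_self_eq_zero 1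
  · intro g hg
    rw [LinearMap.mem_ker, Matrix.mulVecLin_apply] at hg
    have key : ∀ s ∈ K.faces, ∀ a ∈ s, ∀ b ∈ s, extendZero g {a} = extendZero g {b} := by
      intro s hs a ha b hb
      by_cases hab : a = b
      · rw [hab]
      have h := congrFun hg ⟨{a, b}, pair_mem_faces hs ha hb, Finset.card_pair hab⟩
      rw [coboundary_vertex _ hab, Pi.zero_apply, CharTwo.add_eq_zero] at h
      exact h.symm
    rintro ⟨s, hs⟩ ⟨t, ht⟩
    obtain ⟨a, rfl⟩ := Finset.card_eq_one.1 hs.2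
    obtain ⟨b, rfl⟩ := Finset.card_eq_one.1 ht.2
    rw [← extendZero_coe g, ← extendZero_coe g]
    exact eq_of_forall_edge_eq hK.isPreconnected (fun a => extendZero g {a}) key hs.1 ht.1

/-- In a triangulated 2-sphere every edge lies in exactly two triangles. -/
theorem exists_two_triangles [DecidableEq V] (hK : K.IsSphereComplex 3) {a b : V} (hab : a ≠ b)
    (h : {a, b} ∈ K.faces) :
    ∃ x y, x ≠ y ∧ ∀ z, ({a, b, z} ∈ K.faces ∧ z ≠ a ∧ z ≠ b) ↔ z = x ∨ z = y := by
  have ha : a ∈ K.vertexSet := mem_vertexSet_of_mem h (by simp)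
  have hb : b ∈ (K.link {a}).vertexSet := mem_link_vertexSet.2 ⟨hab.symm, h⟩
  have hL := (hK.link_singleton ha).link_singleton hb
  obtain ⟨A, hA⟩ := exists_vertex_finset hL.finite
  have hcard := (card_eq_faceNum_one hL.finite hA).trans hL.faceNum_one_of_one
  obtain ⟨x, y, hxy, rfl⟩ := Finset.card_eq_two.1 hcard
  refine ⟨x, y, hxy, fun z => ?_⟩
  have := hA z
  rw [Finset.mem_insert, Finset.mem_singleton] at this
  rw [this, mem_link_vertexSet, mem_link_singleton_faces]
  simp only [Finset.mem_insert, Finset.mem_singleton, Finset.insert_nonempty, true_and]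
  grind

theorem boundary_triangle [DecidableEq V] [Fintype (K.FaceOfCard 3)]
    (g : K.FaceOfCard 3 → ZMod 2) {a b : V} (hab : a ≠ b)
    (h : {a, b} ∈ K.faces ∧ ({a, b} : Finset V).card = 2) {x y : V} (hxy : x ≠ y)
    (hz : ∀ z, ({a, b, z} ∈ K.faces ∧ z ≠ a ∧ z ≠ b) ↔ z = x ∨ z = y) :
    (K.incidence 2 3).mulVec g ⟨{a, b}, h⟩ = extendZero g {a, b, x} + extendZero g {a, b, y} := by
  simp only [Matrix.mulVec, dotProduct, incidence, Matrix.of_apply, ite_mul, one_mul, zero_mul]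
  rw [← Finset.sum_filter, ← Finset.sum_pair (f := fun z => extendZero g {a, b, z}) hxy]
  have hF : ∀ z ∈ ({x, y} : Finset V), {a, b, z} ∈ K.faces ∧ ({a, b, z} : Finset V).card = 3 := by
    intro z hzxy
    rw [Finset.mem_insert, Finset.mem_singleton, ← hz] at hzxy
    exact ⟨hzxy.1, Finset.card_eq_three.2 ⟨a, b, z, hab, hzxy.2.1.symm, hzxy.2.2.symm, rfl⟩⟩
  symm
  refine Finset.sum_bij (fun z hz => ⟨{a, b, z}, hF z hz⟩) ?_ ?_ ?_ ?_
  · intro z hz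
    rw [Finset.mem_filter]
    refine ⟨Finset.mem_univ _, ?_⟩
    intro w
    simp only [Finset.mem_insert, Finset.mem_singleton]
    tauto
  · intro z hzxy w hw heq
    have h1 : z ∈ ({a, b, w} : Finset V) := by
      have h2 : ({a, b, z} : Finset V) = {a, b, w} := congrArg Subtype.val heq
      rw [← h2]; simp
    rw [Finset.mem_insert, Finset.mem_singleton, ← hz] at hzxy
    simp only [Finset.mem_insert, Finset.mem_singleton] at h1
    tauto
  · rintro ⟨t, ht, hcard⟩ hmem
    have hsub : {a, b} ⊆ t := (Finset.mem_filter.1 hmem).2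
    have h1 : (t \ {a, b}).card = 1 := by
      rw [Finset.card_sdiff_of_subset hsub, hcard, h.2]
    obtain ⟨z, hz1⟩ := Finset.card_eq_one.1 h1
    have hz2 : z ∈ t \ {a, b} := by rw [hz1]; exact Finset.mem_singleton_self z
    have ht' : {a, b, z} = t := by
      rw [← Finset.sdiff_union_of_subset hsub, hz1]
      ext w; simp only [Finset.mem_insert, Finset.mem_singleton, Finset.mem_union]; tauto
    rw [Finset.mem_sdiff, Finset.mem_insert, Finset.mem_singleton] at hz2
    refine ⟨z, ?_, Subtype.ext ht'⟩
    rw [Finset.mem_insert, Finset.mem_singleton, ← hz, ht']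
    exact ⟨ht, by tauto⟩
  · intro z hz
    exact extendZero_coe g ⟨_, hF z hz⟩

/-- A 2-cycle takes the same value on the two triangles at an edge. Connectedness of the vertex
links spreads this value to all triangles at a vertex, and connectedness of the whole complex to all
triangles. Conversely the constant 1 is a cycle, since each edge lies in two triangles. -/
theorem finrank_ker_boundary (hK : K.IsSphereComplex 3) [Fintype (K.FaceOfCard 3)] :
    Module.finrank (ZMod 2) (K.incidence 2 3).mulVecLin.ker = 1 := by
  classical
  have hne : Nonempty (K.FaceOfCard 3) := by
    obtain ⟨s, hs, hcard⟩ := nonempty_faceOfCard (by norm_num) hK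
    exact ⟨⟨s, hs, hcard⟩⟩
  refine finrank_eq_one_of_const ?_ ?_
  · rw [LinearMap.mem_ker, Matrix.mulVecLin_apply]
    ext ⟨t, ht, hcard⟩
    obtain ⟨a, b, hab, rfl⟩ := Finset.card_eq_two.1 hcard
    obtain ⟨x, y, hxy, hz⟩ := hK.exists_two_triangles hab ht
    rw [boundary_triangle _ hab _ hxy hz]
    have hF : ∀ z, z = x ∨ z = y → {a, b, z} ∈ K.faces ∧ ({a, b, z} : Finset V).card = 3 := by
      intro z hzxy
      rw [← hz] at hzxy
      exact ⟨hzxy.1, Finset.card_eq_three.2 ⟨a, b, z, hab, hzxy.2.1.symm, hzxy.2.2.symm, rfl⟩⟩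
    rw [extendZero, extendZero, dif_pos (hF x (Or.inl rfl)), dif_pos (hF y (Or.inr rfl))]
    exact CharTwo.add_self_eq_zero 1
  · intro g hg
    rw [LinearMap.mem_ker, Matrix.mulVecLin_apply] at hg
    have hthird : ∀ t ∈ K.faces, t.card = 3 → ∀ a ∈ t, ∀ b ∈ t, a ≠ b →
        ∃ z, t = {a, b, z} ∧ z ≠ a ∧ z ≠ b := by
      intro t _ hcard a ha b hb hab
      have hsub : {a, b} ⊆ t := Finset.insert_subset ha (Finset.singleton_subset_iff.2 hb)
      have h1 : (t \ {a, b}).card = 1 := by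
        rw [Finset.card_sdiff_of_subset hsub, hcard, Finset.card_pair hab]
      obtain ⟨z, hz1⟩ := Finset.card_eq_one.1 h1
      have hz2 : z ∈ t \ {a, b} := by rw [hz1]; exact Finset.mem_singleton_self z
      rw [Finset.mem_sdiff, Finset.mem_insert, Finset.mem_singleton] at hz2
      refine ⟨z, ?_, by tauto, by tauto⟩
      rw [← Finset.sdiff_union_of_subset hsub, hz1]
      ext w; simp only [Finset.mem_insert, Finset.mem_singleton, Finset.mem_union]; tauto
    have hedge : ∀ t ∈ K.faces, t.card = 3 → ∀ t' ∈ K.faces, t'.card = 3 → ∀ a b, a ≠ b →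
        a ∈ t → b ∈ t → a ∈ t' → b ∈ t' → extendZero g t = extendZero g t' := by
      intro t ht htc t' ht' htc' a b hab ha hb ha' hb'
      obtain ⟨z, rfl, hza, hzb⟩ := hthird t ht htc a ha b hb hab
      obtain ⟨z', rfl, hza', hzb'⟩ := hthird t' ht' htc' a ha' b hb' hab
      obtain ⟨x, y, hxy, hz⟩ := hK.exists_two_triangles hab (pair_mem_faces ht ha hb)
      have h := congrFun hg ⟨{a, b}, pair_mem_faces ht ha hb, Finset.card_pair hab⟩
      rw [boundary_triangle _ hab _ hxy hz, Pi.zero_apply, CharTwo.add_eq_zero] at h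
      rcases (hz z).1 ⟨ht, hza, hzb⟩ with rfl | rfl <;>
        rcases (hz z').1 ⟨ht', hza', hzb'⟩ with rfl | rfl <;> first | rfl | exact h | exact h.symm
    have hvert : ∀ a, ∀ t ∈ K.faces, t.card = 3 → ∀ t' ∈ K.faces, t'.card = 3 → a ∈ t → a ∈ t' →
        extendZero g t = extendZero g t' := by
      intro a t ht htc t' ht' htc' ha ha'
      have haK := mem_vertexSet_of_mem ht ha
      -- The set of all values on triangles through `a` and `b` is well defined before these values
      -- are known to agree, so the principle for functions constant along edges can be applied to
      -- it in the link of `a`.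
      let f : V → Set (ZMod 2) := fun b =>
        {z | ∃ t ∈ K.faces, t.card = 3 ∧ a ∈ t ∧ b ∈ t ∧ extendZero g t = z}
      have hf : ∀ s ∈ (K.link {a}).faces, ∀ b ∈ s, ∀ d ∈ s, f b ⊆ f d := by
        rintro s hs b hb d hd z ⟨t, ht, htc, hat, hbt, hz⟩
        have hs' := mem_link_singleton_faces.1 hs
        have hab : a ≠ b := fun h => hs'.2.1 (h ▸ hb)
        have had : a ≠ d := fun h => hs'.2.1 (h ▸ hd)
        by_cases hbd : b = d
        · subst hbd; exact ⟨t, ht, htc, hat, hbt, hz⟩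
        have h3 : {a, b, d} ∈ K.faces := triple_mem_faces hs'.2.2 (Finset.mem_insert_self _ _)
          (Finset.mem_insert_of_mem hb) (Finset.mem_insert_of_mem hd)
        have h3c : ({a, b, d} : Finset V).card = 3 :=
          Finset.card_eq_three.2 ⟨a, b, d, hab, had, hbd, rfl⟩
        refine ⟨_, h3, h3c, by simp, by simp, ?_⟩
        rw [← hz]
        exact hedge _ h3 h3c _ ht htc a b hab (by simp) (by simp) hat hbt
      have hex : ∀ t ∈ K.faces, t.card = 3 → a ∈ t → ∃ b ∈ t, b ≠ a := by
        intro t _ htc _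
        exact Finset.exists_mem_ne (by omega) a
      obtain ⟨b, hb, hba⟩ := hex t ht htc ha
      obtain ⟨b', hb', hba'⟩ := hex t' ht' htc' ha'
      have heq : f b = f b' := eq_of_forall_edge_eq (hK.link_singleton haK).isPreconnected f
        (fun s hs b hb d hd => (hf s hs b hb d hd).antisymm (hf s hs d hd b hb))
        (mem_link_vertexSet.2 ⟨hba, pair_mem_faces ht ha hb⟩)
        (mem_link_vertexSet.2 ⟨hba', pair_mem_faces ht' ha' hb'⟩)
      have h1 : extendZero g t ∈ f b := ⟨t, ht, htc, ha, hb, rfl⟩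
      rw [heq] at h1
      obtain ⟨t₁, ht₁, htc₁, hat₁, hbt₁, hz₁⟩ := h1
      rw [← hz₁]
      exact hedge _ ht₁ htc₁ _ ht' htc' a b' hba'.symm hat₁ hbt₁ ha' hb'
    rintro ⟨t, ht, htc⟩ ⟨t', ht', htc'⟩
    rw [← extendZero_coe g, ← extendZero_coe g]
    let G : V → Set (ZMod 2) := fun b => {z | ∃ t ∈ K.faces, t.card = 3 ∧ b ∈ t ∧ extendZero g t = z}
    have hG : ∀ s ∈ K.faces, ∀ b ∈ s, ∀ d ∈ s, G b ⊆ G d := by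
      rintro s hs b hb d hd z ⟨t, ht, htc, hbt, hz⟩
      by_cases hbd : b = d
      · subst hbd; exact ⟨t, ht, htc, hbt, hz⟩
      obtain ⟨x, y, hxy, hz'⟩ := hK.exists_two_triangles hbd (pair_mem_faces hs hb hd)
      obtain ⟨hx, hxb, hxd⟩ := (hz' x).2 (Or.inl rfl)
      have hxc : ({b, d, x} : Finset V).card = 3 :=
        Finset.card_eq_three.2 ⟨b, d, x, hbd, hxb.symm, hxd.symm, rfl⟩
      refine ⟨_, hx, hxc, by simp, ?_⟩
      rw [← hz]
      exact hvert b _ hx hxc _ ht htc (by simp) hbt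
    obtain ⟨a, ha⟩ := nonempty_of_mem_faces ht
    obtain ⟨a', ha'⟩ := nonempty_of_mem_faces ht'
    have heq : G a = G a' := eq_of_forall_edge_eq hK.isPreconnected G
      (fun s hs b hb d hd => (hG s hs b hb d hd).antisymm (hG s hs d hd b hb))
      (mem_vertexSet_of_mem ht ha) (mem_vertexSet_of_mem ht' ha')
    have h1 : extendZero g t ∈ G a := ⟨t, ht, htc, ha, rfl⟩
    rw [heq] at h1
    obtain ⟨t₁, ht₁, htc₁, hat₁, hz₁⟩ := h1
    change extendZero g t = extendZero g t'
    rw [← hz₁]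
    exact hvert a' _ ht₁ htc₁ _ ht' htc' hat₁ ha'

theorem exists_puncture_chart {m : ℕ} (hK : K.IsSphereComplex (m + 1)) (x₀ : K.realization) :
    ∃ j : EuclideanSpace ℝ (Fin m) → K.realization, IsOpenEmbedding j ∧ range j = {x₀}ᶜ := by
  obtain ⟨g⟩ := hK.sphere
  have hfr : Fact (Module.finrank ℝ (EuclideanSpace ℝ (Fin (m + 1))) = m + 1) := ⟨by simp⟩
  set st := stereographic' m (g x₀) with hst
  have hθ : IsOpenEmbedding st.symm :=
    st.symm.isOpenEmbedding (by simp [hst])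
  have hθr : range st.symm = {g x₀}ᶜ := by
    have h1 := st.symm.image_source_eq_target
    rw [st.symm_source, st.symm_target] at h1
    rw [← image_univ, ← stereographic'_target (n := m) (g x₀), ← hst, h1, hst,
      stereographic'_source]
  refine ⟨g.symm ∘ st.symm, g.symm.isOpenEmbedding.comp hθ, ?_⟩
  rw [range_comp, hθr, image_compl_eq g.symm.bijective, image_singleton, g.symm_apply_apply]

/-- The first cohomology vanishes. A 1-cocycle defines a double cover of the sphere; removing the
barycentre of one triangle leaves a Euclidean space that still contains the whole 1-skeleton, so the
cocycle has a potential. The other inclusion is that a coboundary is a cocycle. -/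
theorem ker_coboundary_eq_range (hK : K.IsSphereComplex 3) [Fintype (K.FaceOfCard 1)]
    [Fintype (K.FaceOfCard 2)] :
    (K.incidence 2 3).transpose.mulVecLin.ker = (K.incidence 1 2).transpose.mulVecLin.range := by
  classical
  apply le_antisymm
  · intro g hg
    rw [LinearMap.mem_ker, Matrix.mulVecLin_apply] at hg
    let c : V → V → ZMod 2 := fun a b => if a = b then 0 else extendZero g {a, b}
    have hsymm : ∀ a b, extendZero g {a, b} = extendZero g {b, a} := fun a b => by
      rw [Finset.pair_comm]
    have hc : ∀ s ∈ K.faces, ∀ a ∈ s, ∀ b ∈ s, ∀ d ∈ s, c a b + c b d = c a d := by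
      intro s hs a ha b hb d hd
      by_cases hab : a = b
      · subst hab; simp [c]
      by_cases hbd : b = d
      · subst hbd; simp [c]
      by_cases had : a = d
      · subst had
        simp only [c, if_neg hab, if_neg hbd, if_true]
        rw [hsymm b a]
        exact CharTwo.add_self_eq_zero _
      have h := congrFun hg ⟨{a, b, d}, triple_mem_faces hs ha hb hd,
        Finset.card_eq_three.2 ⟨a, b, d, hab, had, hbd, rfl⟩⟩
      rw [coboundary_edge _ hab had hbd, Pi.zero_apply, CharTwo.add_eq_zero] at h
      simp only [c, if_neg hab, if_neg hbd, if_neg had]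
      rw [h, add_comm, add_assoc, CharTwo.add_self_eq_zero, add_zero]
    obtain ⟨t, ht, htc⟩ := nonempty_faceOfCard (by norm_num) hK
    obtain ⟨p, q, r, hpq, hpr, hqr, rfl⟩ := Finset.card_eq_three.1 htc
    let x₀ : V → ℝ := fun w => if w ∈ ({p, q, r} : Finset V) then 1 / 3 else 0
    have hx₀ : x₀ ∈ K.realization := by
      refine ⟨fun w => ?_, _, ht, fun w hw => if_neg hw, ?_⟩
      · dsimp only [x₀]; split_ifs <;> norm_num
      · rw [Finset.sum_congr rfl fun w hw => if_pos hw, Finset.sum_const, htc]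
        norm_num
    obtain ⟨j, hj, hjr⟩ := hK.exists_puncture_chart ⟨x₀, hx₀⟩
    obtain ⟨f, hf⟩ := exists_potential hK.finite hj hjr hpq hpr hqr
      (by simp [x₀]) (by simp [x₀]) (by simp [x₀]) hc
    refine ⟨fun s => f (Finset.card_eq_one.1 s.2.2).choose, ?_⟩
    have hval : ∀ a, {a} ∈ K.faces →
        extendZero (K := K) (fun s : K.FaceOfCard 1 => f (Finset.card_eq_one.1 s.2.2).choose) {a} =
          f a := by
      intro a ha
      rw [extendZero, dif_pos ⟨ha, Finset.card_singleton a⟩]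
      congr 1
      have := (Finset.card_eq_one.1 (Finset.card_singleton a)).choose_spec
      exact (Finset.singleton_injective this).symm
    rw [Matrix.mulVecLin_apply]
    ext ⟨t, ht, hcard⟩
    obtain ⟨a, b, hab, rfl⟩ := Finset.card_eq_two.1 hcard
    rw [coboundary_vertex _ hab, hval a (mem_vertexSet_of_mem ht (by simp)),
      hval b (mem_vertexSet_of_mem ht (by simp)), hf _ ht a (by simp) b (by simp),
      ← extendZero_coe g]
    simp only [c, if_neg hab]
    rw [add_right_comm, CharTwo.add_self_eq_zero, zero_add]
  · rintro _ ⟨f, rfl⟩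
    rw [LinearMap.mem_ker, Matrix.mulVecLin_apply, Matrix.mulVecLin_apply]
    ext ⟨t, ht, hcard⟩
    obtain ⟨a, b, d, hab, had, hbd, rfl⟩ := Finset.card_eq_three.1 hcard
    have hval : ∀ x ∈ ({a, b, d} : Finset V), ∀ y ∈ ({a, b, d} : Finset V), x ≠ y →
        extendZero ((K.incidence 1 2).transpose.mulVec f) {x, y} =
          extendZero f {y} + extendZero f {x} := by
      intro x hx y hy hxy
      have h : {x, y} ∈ K.faces ∧ ({x, y} : Finset V).card = 2 :=
        ⟨pair_mem_faces ht hx hy, Finset.card_pair hxy⟩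
      rw [← coboundary_vertex f hxy h]
      exact extendZero_coe (K := K) _ ⟨_, h⟩
    rw [coboundary_edge _ hab had hbd, hval a (by simp) b (by simp) hab,
      hval a (by simp) d (by simp) had, hval b (by simp) d (by simp) hbd, Pi.zero_apply]
    generalize extendZero f {a} = A
    generalize extendZero f {b} = B
    generalize extendZero f {d} = D
    linear_combination CharTwo.add_self_eq_zero D + CharTwo.add_self_eq_zero B +
      CharTwo.add_self_eq_zero A

/-- With f_i faces of dimension i, the first coboundary has rank f_0 - 1. The second has rank f_2 -
1, computed from its transpose, the boundary of triangles. Exactness at the edges makes these ranks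
add up to f_1. -/
theorem faceNum_add_faceNum_of_three (hK : K.IsSphereComplex 3) :
    K.faceNum 1 + K.faceNum 3 = K.faceNum 2 + 2 := by
  classical
  have := finite_faceOfCard hK.finite
  have := fun i => Fintype.ofFinite (K.FaceOfCard i)
  have h1 := (K.incidence 1 2).transpose.mulVecLin.finrank_range_add_finrank_ker
  have h2 := (K.incidence 2 3).transpose.mulVecLin.finrank_range_add_finrank_ker
  have h3 := (K.incidence 2 3).mulVecLin.finrank_range_add_finrank_ker
  have h4 : (K.incidence 2 3).transpose.rank = (K.incidence 2 3).rank := Matrix.rank_transpose _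
  rw [Matrix.rank, Matrix.rank] at h4
  rw [hK.finrank_ker_coboundary, Module.finrank_pi] at h1
  rw [hK.ker_coboundary_eq_range, Module.finrank_pi, h4] at h2
  rw [hK.finrank_ker_boundary, Module.finrank_pi] at h3
  simp only [faceNum, Nat.card_eq_fintype_card]
  omega

/-- The Euler characteristic of a triangulated 3-sphere vanishes. -/
theorem eulerChar_eq_zero_of_four (hK : K.IsSphereComplex 4) : K.eulerChar = 0 := by
  obtain ⟨A, hA⟩ := exists_vertex_finset hK.finite
  have h1 := sum_faceNum_link hK.finite hA (i := 1) le_rfl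
  have h2 := sum_faceNum_link hK.finite hA (i := 2) (by norm_num)
  have h3 := sum_faceNum_link hK.finite hA (i := 3) (by norm_num)
  have h4 : ∑ v ∈ A, 3 * (K.link {v}).faceNum 3 = ∑ v ∈ A, 2 * (K.link {v}).faceNum 2 :=
    Finset.sum_congr rfl fun v hv => (hK.link_singleton ((hA v).1 hv)).faceNum_three_of_three
  have h5 : ∑ v ∈ A, ((K.link {v}).faceNum 1 + (K.link {v}).faceNum 3) =
      ∑ v ∈ A, ((K.link {v}).faceNum 2 + 2) :=
    Finset.sum_congr rfl fun v hv => (hK.link_singleton ((hA v).1 hv)).faceNum_add_faceNum_of_three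
  have h6 := card_eq_faceNum_one hK.finite hA
  -- With f_i faces of dimension i, the sums over vertex links become 12 f_3 = 6 f_2 and 2 f_1 + 4
  -- f_3 = 3 f_2 + 2 f_0, which together give f_0 - f_1 + f_2 - f_3 = 0.
  rw [← Finset.mul_sum, ← Finset.mul_sum] at h4
  rw [Finset.sum_add_distrib, Finset.sum_add_distrib, Finset.sum_const, smul_eq_mul] at h5
  rw [eulerChar_eq_sum hK.finite fun s hs => hK.card_le hs]
  simp only [Finset.sum_range_succ, Finset.sum_range_zero]
  norm_num at h1 h2 h3 ⊢
  omega

end IsSphereComplex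

end PreAbstractSimplicialComplex

/-! ### Star gluings: flagness and absence of squares. -/

namespace PreAbstractSimplicialComplex

section Near

variable {V : Type*} {K : PreAbstractSimplicialComplex V}

/-- `a` and `b` are equal or adjacent in the 1-skeleton. -/
def Near (K : PreAbstractSimplicialComplex V) (a b : V) : Prop :=
  a = b ∨ K.skeletonGraph.Adj a b

theorem Near.refl (a : V) : K.Near a a := Or.inl rfl

theorem Near.symm {a b : V} (h : K.Near a b) : K.Near b a :=
  h.imp Eq.symm SimpleGraph.Adj.symm

theorem near_of_mem {s : Finset V} (hs : s ∈ K.faces) {a b : V} (ha : a ∈ s) (hb : b ∈ s) :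
    K.Near a b := by
  by_cases h : a = b
  · exact Or.inl h
  · exact Or.inr ⟨h, s, hs, ha, hb⟩

theorem mem_vertexSet_of_adj {a b : V} (h : K.skeletonGraph.Adj a b) : a ∈ K.vertexSet := by
  obtain ⟨-, s, hs, ha, -⟩ := h
  exact mem_vertexSet_of_mem hs ha

theorem adj_iff_mem_link {a b : V} : K.skeletonGraph.Adj a b ↔ b ∈ (K.link {a}).vertexSet := by
  classical
  rw [mem_link_vertexSet]
  constructor
  · rintro ⟨hne, s, hs, ha, hb⟩
    exact ⟨hne.symm, pair_mem_faces hs ha hb⟩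
  · rintro ⟨hne, h⟩
    exact ⟨hne.symm, _, h, by simp, by simp⟩

theorem isFlag_iff : K.IsFlag ↔ ∀ s : Finset V, s.Nonempty → (∀ a ∈ s, a ∈ K.vertexSet) →
    (∀ a ∈ s, ∀ b ∈ s, K.Near a b) → s ∈ K.faces := by
  constructor
  · intro h s hs hv hc
    exact (h s).2 ⟨hs, hv, fun a ha b hb hab => (hc a ha b hb).resolve_left hab⟩
  · intro h s
    constructor
    · intro hs
      exact ⟨nonempty_of_mem_faces hs, fun a ha => mem_vertexSet_of_mem hs ha,
        fun a ha b hb hab => (near_of_mem hs ha hb).resolve_left hab⟩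
    · rintro ⟨hne, hv, hc⟩
      refine h s hne hv fun a ha b hb => ?_
      by_cases hab : a = b
      · exact Or.inl hab
      · exact Or.inr (hc ha hb hab)

theorem isEmpty_cycle_four_iff {G : SimpleGraph V} :
    IsEmpty (SimpleGraph.cycleGraph 4 ↪g G) ↔ ∀ a b c d, G.Adj a b → G.Adj b c → G.Adj c d →
      G.Adj d a → a ≠ c → b ≠ d → G.Adj a c ∨ G.Adj b d := by
  constructor
  · intro hE a b c d hab hbc hcd hda hac hbd
    by_contra hn
    push Not at hn
    refine hE.false ⟨⟨![a, b, c, d], ?_⟩, ?_⟩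
    · intro i j
      fin_cases i <;> fin_cases j <;>
        simp [hab.ne, hbc.ne, hcd.ne, hda.ne, hab.ne', hbc.ne', hcd.ne', hda.ne', hac, hbd,
          hac.symm, hbd.symm]
    · intro i j
      have h1 : ¬ G.Adj c a := fun h => hn.1 h.symm
      have h2 : ¬ G.Adj d b := fun h => hn.2 h.symm
      rw [SimpleGraph.cycleGraph_adj]
      change G.Adj (![a, b, c, d] i) (![a, b, c, d] j) ↔ _
      fin_cases i <;> fin_cases j <;> first
        | exact iff_of_true hab (by decide)
        | exact iff_of_true hbc (by decide)
        | exact iff_of_true hcd (by decide)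
        | exact iff_of_true hda (by decide)
        | exact iff_of_true hab.symm (by decide)
        | exact iff_of_true hbc.symm (by decide)
        | exact iff_of_true hcd.symm (by decide)
        | exact iff_of_true hda.symm (by decide)
        | exact iff_of_false hn.1 (by decide)
        | exact iff_of_false hn.2 (by decide)
        | exact iff_of_false h1 (by decide)
        | exact iff_of_false h2 (by decide)
        | exact iff_of_false (G.irrefl) (by decide)
  · intro h
    refine ⟨fun e => ?_⟩
    have hadj : ∀ i j : Fin 4, G.Adj (e i) (e j) ↔ (SimpleGraph.cycleGraph 4).Adj i j :=
      fun i j => e.map_adj_iff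
    simp only [SimpleGraph.cycleGraph_adj] at hadj
    have h1 := h (e 0) (e 1) (e 2) (e 3) ((hadj _ _).2 (by decide)) ((hadj _ _).2 (by decide))
      ((hadj _ _).2 (by decide)) ((hadj _ _).2 (by decide)) (e.injective.ne (by decide))
      (e.injective.ne (by decide))
    rw [hadj, hadj] at h1
    revert h1
    decide

end Near

open scoped Classical in
/-- The image of `s` under `σ` is a face of `K` that avoids `v` and `u`. -/
def Side {V X : Type*} (K : PreAbstractSimplicialComplex V) (v u : V) (σ : X → V)
    (s : Finset X) : Prop :=
  s.image σ ∈ K.faces ∧ ∀ x ∈ s, σ x ≠ v ∧ σ x ≠ u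

theorem Side.swap {V X : Type*} {K : PreAbstractSimplicialComplex V} {v u : V} {σ : X → V}
    {s : Finset X} (h : K.Side v u σ s) : K.Side u v σ s :=
  ⟨h.1, fun x hx => (h.2 x hx).symm⟩

open scoped Classical in
/-- `Q` is obtained from the flag complex `N` by removing the open stars of the far apart vertices
`v` and `u` and identifying their links. The sections `σ` and `τ` of the quotient map pick
representatives outside of the link of `u`, respectively of `v`. -/
structure IsStarGluing {V X : Type*} (N : PreAbstractSimplicialComplex V)
    (Q : PreAbstractSimplicialComplex X) (v u : V) (σ τ : X → V) : Prop where
  flag : N.IsFlag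
  mem_left : v ∈ N.vertexSet
  mem_right : u ∈ N.vertexSet
  far : ∀ a b c d e, N.Near v a → N.Near a b → N.Near b c → N.Near c d → N.Near d e → ¬ N.Near e u
  left_injective : Function.Injective σ
  right_injective : Function.Injective τ
  eq_of_not_adj : ∀ x, ¬ N.skeletonGraph.Adj v (σ x) → σ x = τ x
  adj_iff : ∀ x, N.skeletonGraph.Adj v (σ x) ↔ N.skeletonGraph.Adj u (τ x)
  not_adj_left : ∀ x, ¬ N.skeletonGraph.Adj u (σ x)
  not_adj_right : ∀ x, ¬ N.skeletonGraph.Adj v (τ x)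
  cover_left : ∀ w, ¬ N.skeletonGraph.Adj u w → ∃ x, σ x = w
  cover_right : ∀ w, ¬ N.skeletonGraph.Adj v w → ∃ x, τ x = w
  link_iff : ∀ s : Finset X, (∀ x ∈ s, N.skeletonGraph.Adj v (σ x)) →
    (s.image σ ∈ (N.link {v}).faces ↔ s.image τ ∈ (N.link {u}).faces)
  mem_faces_iff : ∀ s : Finset X, s ∈ Q.faces ↔ N.Side v u σ s ∨ N.Side v u τ s

namespace IsStarGluing

variable {V X : Type*} {N : PreAbstractSimplicialComplex V} {Q : PreAbstractSimplicialComplex X}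
  {v u : V} {σ τ : X → V}

theorem symm (h : IsStarGluing N Q v u σ τ) : IsStarGluing N Q u v τ σ where
  flag := h.flag
  mem_left := h.mem_right
  mem_right := h.mem_left
  far a b c d e h1 h2 h3 h4 h5 h6 :=
    h.far e d c b a h6.symm h5.symm h4.symm h3.symm h2.symm h1.symm
  left_injective := h.right_injective
  right_injective := h.left_injective
  eq_of_not_adj x hx := (h.eq_of_not_adj x (mt (h.adj_iff x).1 hx)).symm
  adj_iff x := (h.adj_iff x).symm
  not_adj_left := h.not_adj_right
  not_adj_right := h.not_adj_left
  cover_left := h.cover_right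
  cover_right := h.cover_left
  link_iff s hs := (h.link_iff s fun x hx => (h.adj_iff x).2 (hs x hx)).symm
  mem_faces_iff s := by
    rw [h.mem_faces_iff, or_comm]
    exact or_congr ⟨Side.swap, Side.swap⟩ ⟨Side.swap, Side.swap⟩

/-- The relation `Near` is reflexive, so excluding walks of six steps also excludes shorter ones.
Four steps suffice for most uses. -/
theorem far_four (h : IsStarGluing N Q v u σ τ) {a b c : V} (h1 : N.Near v a) (h2 : N.Near a b)
    (h3 : N.Near b c) : ¬ N.Near c u := fun h4 =>
  h.far a b c u u h1 h2 h3 h4 (Near.refl _) (Near.refl _)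

theorem not_near (h : IsStarGluing N Q v u σ τ) : ¬ N.Near v u :=
  h.far_four (Near.refl _) (Near.refl _) (Near.refl _)

/-- `x` represents a vertex of `N` other than `v` and `u`. -/
def Good (N : PreAbstractSimplicialComplex V) (v u : V) (σ : X → V) (x : X) : Prop :=
  σ x ∈ N.vertexSet ∧ σ x ≠ v ∧ σ x ≠ u

theorem good_of_adj (h : IsStarGluing N Q v u σ τ) {x : X} (hx : N.skeletonGraph.Adj v (σ x)) :
    Good N v u σ x :=
  ⟨mem_vertexSet_of_adj hx.symm, hx.ne', fun hu => h.not_near (hu ▸ Or.inr hx)⟩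

theorem good_iff (h : IsStarGluing N Q v u σ τ) (x : X) : Good N v u σ x ↔ Good N v u τ x := by
  by_cases hx : N.skeletonGraph.Adj v (σ x)
  · refine iff_of_true (h.good_of_adj hx) ?_
    have := h.symm.good_of_adj ((h.adj_iff x).1 hx)
    exact ⟨this.1, this.2.2, this.2.1⟩
  · rw [Good, Good, h.eq_of_not_adj x hx]

/-- Because N is flag, living on one side is a condition on pairs of vertices. -/
theorem side_iff (h : IsStarGluing N Q v u σ τ) {s : Finset X} :
    N.Side v u σ s ↔ s.Nonempty ∧ (∀ x ∈ s, Good N v u σ x) ∧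
      ∀ x ∈ s, ∀ y ∈ s, N.Near (σ x) (σ y) := by
  classical
  constructor
  · rintro ⟨hs, hav⟩
    exact ⟨Finset.image_nonempty.1 (nonempty_of_mem_faces (by convert hs)), fun x hx =>
      ⟨mem_vertexSet_of_mem hs (by simpa using ⟨x, hx, rfl⟩), hav x hx⟩, fun x hx y hy =>
      near_of_mem hs (by simpa using ⟨x, hx, rfl⟩) (by simpa using ⟨y, hy, rfl⟩)⟩
  · rintro ⟨hne, hg, hc⟩
    refine ⟨isFlag_iff.1 h.flag _ (by simpa using hne) ?_ ?_, fun x hx => (hg x hx).2⟩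
    · intro a ha
      obtain ⟨x, hx, rfl⟩ := Finset.mem_image.1 ha
      exact (hg x hx).1
    · intro a ha b hb
      obtain ⟨x, hx, rfl⟩ := Finset.mem_image.1 ha
      obtain ⟨y, hy, rfl⟩ := Finset.mem_image.1 hb
      exact hc x hx y hy

theorem side_right_iff (h : IsStarGluing N Q v u σ τ) {s : Finset X} :
    N.Side v u τ s ↔ s.Nonempty ∧ (∀ x ∈ s, Good N v u σ x) ∧
      ∀ x ∈ s, ∀ y ∈ s, N.Near (τ x) (τ y) := by
  have h1 : N.Side v u τ s ↔ N.Side u v τ s := ⟨Side.swap, Side.swap⟩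
  rw [h1, h.symm.side_iff]
  refine and_congr_right fun _ => and_congr_left fun _ => forall₂_congr fun x _ => ?_
  rw [h.good_iff, Good, Good, and_comm (a := τ x ≠ u)]

theorem mem_link_left_iff (h : IsStarGluing N Q v u σ τ) [DecidableEq V] {s : Finset X}
    (hs : ∀ x ∈ s, N.skeletonGraph.Adj v (σ x)) :
    s.image σ ∈ (N.link {v}).faces ↔ s.Nonempty ∧ ∀ x ∈ s, ∀ y ∈ s, N.Near (σ x) (σ y) := by
  rw [mem_link_singleton_faces]
  constructor
  · rintro ⟨hne, -, hf⟩
    exact ⟨Finset.image_nonempty.1 hne, fun x hx y hy =>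
      near_of_mem hf (Finset.mem_insert_of_mem (Finset.mem_image_of_mem σ hx))
        (Finset.mem_insert_of_mem (Finset.mem_image_of_mem σ hy))⟩
  · rintro ⟨hne, hc⟩
    refine ⟨hne.image σ, ?_, isFlag_iff.1 h.flag _ (Finset.insert_nonempty _ _) ?_ ?_⟩
    · intro hv
      obtain ⟨x, hx, hxv⟩ := Finset.mem_image.1 hv
      exact (hs x hx).ne hxv.symm
    · intro a ha
      rcases Finset.mem_insert.1 ha with rfl | ha
      · exact h.mem_left
      · obtain ⟨x, hx, rfl⟩ := Finset.mem_image.1 ha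
        exact mem_vertexSet_of_adj (hs x hx).symm
    · have hv : ∀ b ∈ s.image σ, N.Near v b := by
        intro b hb
        obtain ⟨x, hx, rfl⟩ := Finset.mem_image.1 hb
        exact Or.inr (hs x hx)
      intro a ha b hb
      rcases Finset.mem_insert.1 ha with ha' | ha' <;> rcases Finset.mem_insert.1 hb with hb' | hb'
      · exact Or.inl (ha'.trans hb'.symm)
      · exact ha' ▸ hv b hb'
      · exact hb' ▸ (hv a ha').symm
      · obtain ⟨x, hx, rfl⟩ := Finset.mem_image.1 ha'
        obtain ⟨y, hy, rfl⟩ := Finset.mem_image.1 hb'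
        exact hc x hx y hy

/-- An edge of N between two neighbours of `v` is an edge of the link of `v` by flagness, and the
identification of the links preserves faces. -/
theorem near_iff_of_adj (h : IsStarGluing N Q v u σ τ) {x y : X}
    (hx : N.skeletonGraph.Adj v (σ x)) (hy : N.skeletonGraph.Adj v (σ y)) :
    N.Near (σ x) (σ y) ↔ N.Near (τ x) (τ y) := by
  classical
  have hs : ∀ z ∈ ({x, y} : Finset X), N.skeletonGraph.Adj v (σ z) := by
    intro z hz
    rw [Finset.mem_insert, Finset.mem_singleton] at hz
    rcases hz with rfl | rfl <;> assumption
  have h1 := h.mem_link_left_iff hs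
  have h2 := h.symm.mem_link_left_iff fun z hz => (h.adj_iff z).1 (hs z hz)
  have h3 := h.link_iff _ hs
  have key : ∀ f : X → V, (({x, y} : Finset X).Nonempty ∧ ∀ a ∈ ({x, y} : Finset X),
      ∀ b ∈ ({x, y} : Finset X), N.Near (f a) (f b)) ↔ N.Near (f x) (f y) := by
    intro f
    constructor
    · rintro ⟨-, hf⟩
      exact hf x (by simp) y (by simp)
    · intro hf
      refine ⟨Finset.insert_nonempty _ _, fun a ha b hb => ?_⟩
      simp only [Finset.mem_insert, Finset.mem_singleton] at ha hb
      rcases ha with rfl | rfl <;> rcases hb with rfl | rfl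
      · exact Near.refl _
      · exact hf
      · exact hf.symm
      · exact Near.refl _
  rw [key] at h1 h2
  rw [← h1, ← h2]
  convert h3

theorem near_iff_of_not_adj (h : IsStarGluing N Q v u σ τ) {x y : X}
    (hx : ¬ N.skeletonGraph.Adj v (σ x)) (hy : ¬ N.skeletonGraph.Adj v (σ y)) :
    N.Near (σ x) (σ y) ↔ N.Near (τ x) (τ y) := by
  rw [h.eq_of_not_adj x hx, h.eq_of_not_adj y hy]

theorem mem_vertexSet_iff (h : IsStarGluing N Q v u σ τ) {x : X} :
    x ∈ Q.vertexSet ↔ Good N v u σ x := by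
  change {x} ∈ Q.faces ↔ _
  rw [h.mem_faces_iff, h.side_iff, h.side_right_iff]
  simp [Near.refl]

theorem near_iff (h : IsStarGluing N Q v u σ τ) {x y : X} (hx : Good N v u σ x)
    (hy : Good N v u σ y) : Q.Near x y ↔ N.Near (σ x) (σ y) ∨ N.Near (τ x) (τ y) := by
  classical
  constructor
  · rintro (rfl | ⟨-, s, hs, hxs, hys⟩)
    · exact Or.inl (Near.refl _)
    · rw [h.mem_faces_iff, h.side_iff, h.side_right_iff] at hs
      exact hs.imp (fun h => h.2.2 x hxs y hys) (fun h => h.2.2 x hxs y hys)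
  · intro hn
    have hxy : {x, y} ∈ Q.faces := by
      rw [h.mem_faces_iff, h.side_iff, h.side_right_iff]
      refine hn.imp (fun hn => ⟨Finset.insert_nonempty _ _, ?_, ?_⟩)
        (fun hn => ⟨Finset.insert_nonempty _ _, ?_, ?_⟩)
      all_goals simp only [Finset.mem_insert, Finset.mem_singleton, forall_eq_or_imp, forall_eq]
      · exact ⟨hx, hy⟩
      · exact ⟨⟨Near.refl _, hn⟩, hn.symm, Near.refl _⟩
      · exact ⟨hx, hy⟩
      · exact ⟨⟨Near.refl _, hn⟩, hn.symm, Near.refl _⟩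
    exact near_of_mem hxy (by simp) (by simp)

/-- An edge that exists only on the side of `u` leads from the common link to the outside. -/
theorem exists_mixed (h : IsStarGluing N Q v u σ τ) {x y : X} (h1 : ¬ N.Near (σ x) (σ y))
    (h2 : N.Near (τ x) (τ y)) : ∃ a b, ((a = x ∧ b = y) ∨ (a = y ∧ b = x)) ∧
      N.skeletonGraph.Adj u (τ a) ∧ ¬ N.skeletonGraph.Adj u (τ b) ∧ N.Near (τ a) (τ b) := by
  by_cases hx : N.skeletonGraph.Adj v (σ x) <;> by_cases hy : N.skeletonGraph.Adj v (σ y)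
  · exact absurd ((h.near_iff_of_adj hx hy).2 h2) h1
  · exact ⟨x, y, Or.inl ⟨rfl, rfl⟩, (h.adj_iff x).1 hx, mt (h.adj_iff y).2 hy, h2⟩
  · exact ⟨y, x, Or.inr ⟨rfl, rfl⟩, (h.adj_iff y).1 hy, mt (h.adj_iff x).2 hx, h2.symm⟩
  · exact absurd ((h.near_iff_of_not_adj hx hy).2 h2) h1

theorem eq_right (h : IsStarGluing N Q v u σ τ) {x : X} (hx : ¬ N.skeletonGraph.Adj u (τ x)) :
    σ x = τ x :=
  h.eq_of_not_adj x (mt (h.adj_iff x).1 hx)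

/-- If a clique is on neither side, it has an edge only on the u-side and an edge only on the
v-side. Their ends outside the common link are equal or adjacent, and joining everything gives a
walk of five steps from `v` to `u`. -/
theorem isFlag (h : IsStarGluing N Q v u σ τ) : Q.IsFlag := by
  classical
  rw [isFlag_iff]
  intro s hne hv hc
  have hg : ∀ x ∈ s, Good N v u σ x := fun x hx => h.mem_vertexSet_iff.1 (hv x hx)
  have hst : ∀ x ∈ s, ∀ y ∈ s, N.Near (σ x) (σ y) ∨ N.Near (τ x) (τ y) := fun x hx y hy =>
    (h.near_iff (hg x hx) (hg y hy)).1 (hc x hx y hy)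
  rw [h.mem_faces_iff, h.side_iff, h.side_right_iff]
  by_contra hn
  rw [not_or] at hn
  have h1 : ∃ x ∈ s, ∃ y ∈ s, ¬ N.Near (σ x) (σ y) := by
    by_contra hcon
    push Not at hcon
    exact hn.1 ⟨hne, hg, hcon⟩
  have h2 : ∃ x ∈ s, ∃ y ∈ s, ¬ N.Near (τ x) (τ y) := by
    by_contra hcon
    push Not at hcon
    exact hn.2 ⟨hne, hg, hcon⟩
  obtain ⟨x, hx, y, hy, hxy⟩ := h1
  obtain ⟨z, hz, w, hw, hzw⟩ := h2
  obtain ⟨a, b, hab, ha, hb, hn1⟩ := h.exists_mixed hxy ((hst x hx y hy).resolve_left hxy)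
  obtain ⟨c, d, hcd, hc', hd, hn2⟩ := h.symm.exists_mixed hzw ((hst z hz w hw).resolve_right hzw)
  have hbs : b ∈ s := by rcases hab with ⟨-, rfl⟩ | ⟨-, rfl⟩ <;> assumption
  have hds : d ∈ s := by rcases hcd with ⟨-, rfl⟩ | ⟨-, rfl⟩ <;> assumption
  have hbd : N.Near (σ d) (σ b) := by
    have hb' : ¬ N.skeletonGraph.Adj v (σ b) := mt (h.adj_iff b).1 hb
    exact (hst d hds b hbs).elim id (h.near_iff_of_not_adj hd hb').2
  rw [h.eq_right hb] at hbd
  exact h.far (σ c) (σ d) (τ b) (τ a) u (Or.inr hc') hn2 hbd hn1.symm (Or.inr ha.symm)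
    (Near.refl _)

theorem adj_iff_near {K : PreAbstractSimplicialComplex V} {a b : V} :
    K.skeletonGraph.Adj a b ↔ K.Near a b ∧ a ≠ b :=
  ⟨fun h => ⟨Or.inr h, h.ne⟩, fun h => h.1.resolve_left h.2⟩

/-- The case of an induced square with one corner near `u` and the opposite corner near `v`. -/
theorem false_of_square_opposite (h : IsStarGluing N Q v u σ τ)
    (hsq : ∀ a b c d, N.skeletonGraph.Adj a b → N.skeletonGraph.Adj b c → N.skeletonGraph.Adj c d →
      N.skeletonGraph.Adj d a → a ≠ c → b ≠ d → N.skeletonGraph.Adj a c ∨ N.skeletonGraph.Adj b d)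
    {y e w f x z : X} (hgy : Good N v u σ y) (hge : Good N v u σ e) (hgw : Good N v u σ w)
    (hgf : Good N v u σ f) (hye : Q.Near y e) (hew : Q.Near e w) (hwf : Q.Near w f)
    (hfy : Q.Near f y) (hef : ¬ Q.Near e f)
    (hx : N.skeletonGraph.Adj u (τ x)) (hy : ¬ N.skeletonGraph.Adj u (τ y))
    (hxy : N.Near (τ x) (τ y)) (hz : N.skeletonGraph.Adj v (σ z))
    (hw : ¬ N.skeletonGraph.Adj v (σ w)) (hzw : N.Near (σ z) (σ w)) : False := by
  have hy' : ¬ N.skeletonGraph.Adj v (σ y) := mt (h.adj_iff y).1 hy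
  have hyeq := h.eq_right hy
  -- If a middle corner were outside the common link, then v, z, w, g, y, x, u would be a walk of
  -- six steps. This is the place where all six steps excluded by `far` are used.
  have hadj : ∀ g, Good N v u σ g → Q.Near y g → Q.Near g w → N.skeletonGraph.Adj v (σ g) := by
    intro g hg hyg hgw'
    by_contra hng
    have h1 : N.Near (σ y) (σ g) :=
      ((h.near_iff hgy hg).1 hyg).elim id (h.near_iff_of_not_adj hy' hng).2
    have h2 : N.Near (σ g) (σ w) :=
      ((h.near_iff hg hgw).1 hgw').elim id (h.near_iff_of_not_adj hng hw).2
    rw [hyeq] at h1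
    exact h.far _ _ _ _ _ (Or.inr hz) hzw h2.symm h1.symm hxy.symm (Or.inr hx.symm)
  have hside : ∀ g, Good N v u σ g → N.skeletonGraph.Adj v (σ g) → Q.Near g w →
      N.Near (σ g) (σ w) := by
    intro g hg hvg hgw'
    refine ((h.near_iff hg hgw).1 hgw').elim id fun h1 => ?_
    rw [← h.eq_of_not_adj w hw] at h1
    exact absurd (Or.inr ((h.adj_iff g).1 hvg).symm) (h.far_four (Or.inr hz) hzw h1.symm)
  have hve := hadj e hge hye hew
  have hvf := hadj f hgf hfy.symm hwf.symm
  have hne : ∀ g, N.skeletonGraph.Adj v (σ g) → σ g ≠ σ w := by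
    intro g hg heq
    rw [heq] at hg
    exact hw hg
  have h1 := adj_iff_near.2 ⟨hside e hge hve hew, hne e hve⟩
  have h2 := adj_iff_near.2 ⟨hside f hgf hvf hwf.symm, hne f hvf⟩
  have hef' : ¬ N.Near (σ e) (σ f) := fun hn => hef ((h.near_iff hge hgf).2 (Or.inl hn))
  -- Both middle corners are neighbours of `v`, so replacing the corner near `u` by `v` gives a
  -- square in N itself, and either diagonal is excluded.
  rcases hsq v (σ e) (σ w) (σ f) hve h1 h2.symm hvf.symm hgw.2.1.symm
    (fun heq => hef' (Or.inl heq)) with h3 | h3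
  · exact hw h3
  · exact hef' (Or.inr h3)

/-- A square on one side would have a diagonal there. Otherwise it has edges of both exclusive
kinds, whose outer ends can be neither equal nor adjacent and so are opposite corners. -/
theorem isFns (h : IsStarGluing N Q v u σ τ)
    (hE : IsEmpty (SimpleGraph.cycleGraph 4 ↪g N.skeletonGraph)) : Q.IsFns := by
  refine ⟨h.isFlag, ?_⟩
  rw [isEmpty_cycle_four_iff] at hE ⊢
  intro a b c d hab hbc hcd hda hac hbd
  by_contra hn
  rw [not_or] at hn
  have hn1 : ¬ Q.Near a c := fun h => h.elim hac hn.1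
  have hn2 : ¬ Q.Near b d := fun h => h.elim hbd hn.2
  have hga := h.mem_vertexSet_iff.1 (mem_vertexSet_of_adj hab)
  have hgb := h.mem_vertexSet_iff.1 (mem_vertexSet_of_adj hbc)
  have hgc := h.mem_vertexSet_iff.1 (mem_vertexSet_of_adj hcd)
  have hgd := h.mem_vertexSet_iff.1 (mem_vertexSet_of_adj hda)
  -- not all edges are on one side
  have hall : ∀ f : X → V, Function.Injective f →
      (∀ x y, Good N v u σ x → Good N v u σ y → N.Near (f x) (f y) → Q.Near x y) →
      ∃ x y, ((x = a ∧ y = b) ∨ (x = b ∧ y = c) ∨ (x = c ∧ y = d) ∨ (x = d ∧ y = a)) ∧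
        ¬ N.Near (f x) (f y) := by
    intro f hf hfQ
    by_contra hcon
    push Not at hcon
    have h1 := hcon a b (by tauto)
    have h2 := hcon b c (by tauto)
    have h3 := hcon c d (by tauto)
    have h4 := hcon d a (by tauto)
    rcases hE (f a) (f b) (f c) (f d) (adj_iff_near.2 ⟨h1, hf.ne hab.ne⟩)
      (adj_iff_near.2 ⟨h2, hf.ne hbc.ne⟩) (adj_iff_near.2 ⟨h3, hf.ne hcd.ne⟩)
      (adj_iff_near.2 ⟨h4, hf.ne hda.ne⟩) (hf.ne hac) (hf.ne hbd) with h5 | h5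
    · exact hn1 (hfQ a c hga hgc (Or.inr h5))
    · exact hn2 (hfQ b d hgb hgd (Or.inr h5))
  obtain ⟨x, y, hxy, hxy'⟩ := hall σ h.left_injective
    fun x y hx hy hn => (h.near_iff hx hy).2 (Or.inl hn)
  obtain ⟨z, w, hzw, hzw'⟩ := hall τ h.right_injective
    fun x y hx hy hn => (h.near_iff hx hy).2 (Or.inr hn)
  have hQ : ∀ x y, ((x = a ∧ y = b) ∨ (x = b ∧ y = c) ∨ (x = c ∧ y = d) ∨ (x = d ∧ y = a)) →
      N.Near (σ x) (σ y) ∨ N.Near (τ x) (τ y) := by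
    rintro x y (⟨rfl, rfl⟩ | ⟨rfl, rfl⟩ | ⟨rfl, rfl⟩ | ⟨rfl, rfl⟩)
    · exact (h.near_iff hga hgb).1 (Or.inr hab)
    · exact (h.near_iff hgb hgc).1 (Or.inr hbc)
    · exact (h.near_iff hgc hgd).1 (Or.inr hcd)
    · exact (h.near_iff hgd hga).1 (Or.inr hda)
  obtain ⟨p, q, hpq, hp, hq, hpq'⟩ := h.exists_mixed hxy' ((hQ x y hxy).resolve_left hxy')
  obtain ⟨r, t, hrt, hr, ht, hrt'⟩ := h.symm.exists_mixed hzw' ((hQ z w hzw).resolve_right hzw')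
  have hq' : ¬ N.skeletonGraph.Adj v (σ q) := mt (h.adj_iff q).1 hq
  -- Nearness of the two outer ends would close a walk of five steps from `v` to `u`.
  have hnear : N.Near (σ t) (σ q) → False := fun hn => by
    rw [h.eq_right hq] at hn
    exact h.far _ _ _ _ _ (Or.inr hr) hrt' hn hpq'.symm (Or.inr hp.symm) (Near.refl _)
  have hnear' : Good N v u σ t → Good N v u σ q → Q.Near t q → False := fun h1 h2 hn =>
    ((h.near_iff h1 h2).1 hn).elim hnear fun h3 => hnear ((h.near_iff_of_not_adj ht hq').2 h3)
  have hmem : ∀ x y p q, ((x = a ∧ y = b) ∨ (x = b ∧ y = c) ∨ (x = c ∧ y = d) ∨ (x = d ∧ y = a)) →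
      ((p = x ∧ q = y) ∨ (p = y ∧ q = x)) → q = a ∨ q = b ∨ q = c ∨ q = d := by
    rintro x y p q (⟨rfl, rfl⟩ | ⟨rfl, rfl⟩ | ⟨rfl, rfl⟩ | ⟨rfl, rfl⟩)
      (⟨rfl, rfl⟩ | ⟨rfl, rfl⟩) <;> simp only [true_or, or_true]
  have hqm := hmem x y p q hxy hpq
  have htm := hmem z w r t hzw hrt
  rcases hqm with rfl | rfl | rfl | rfl <;> rcases htm with rfl | rfl | rfl | rfl
  · exact hnear (Near.refl _)
  · exact hnear' hgb hga (Or.inr hab.symm)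
  · exact h.false_of_square_opposite hE hga hgb hgc hgd (Or.inr hab) (Or.inr hbc) (Or.inr hcd)
      (Or.inr hda) hn2 hp hq hpq' hr ht hrt'
  · exact hnear' hgd hga (Or.inr hda)
  · exact hnear' hga hgb (Or.inr hab)
  · exact hnear (Near.refl _)
  · exact hnear' hgc hgb (Or.inr hbc.symm)
  · exact h.false_of_square_opposite hE hgb hgc hgd hga (Or.inr hbc) (Or.inr hcd) (Or.inr hda)
      (Or.inr hab) (fun hn => hn1 hn.symm) hp hq hpq' hr ht hrt'
  · exact h.false_of_square_opposite hE hgc hgd hga hgb (Or.inr hcd) (Or.inr hda) (Or.inr hab)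
      (Or.inr hbc) (fun hn => hn2 hn.symm) hp hq hpq' hr ht hrt'
  · exact hnear' hgb hgc (Or.inr hbc)
  · exact hnear (Near.refl _)
  · exact hnear' hgd hgc (Or.inr hcd.symm)
  · exact hnear' hga hgd (Or.inr hda.symm)
  · exact h.false_of_square_opposite hE hgd hga hgb hgc (Or.inr hda) (Or.inr hab) (Or.inr hbc)
      (Or.inr hcd) hn1 hp hq hpq' hr ht hrt'
  · exact hnear' hgc hgd (Or.inr hcd)
  · exact hnear (Near.refl _)

end IsStarGluing

end PreAbstractSimplicialComplex

/-! ### The star handled complex is a star gluing. -/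

namespace PreAbstractSimplicialComplex

variable {V : Type*} {N : PreAbstractSimplicialComplex V} {v u : V}

theorem Near.exists_walk {a b : V} (h : N.Near a b) :
    ∃ p : N.skeletonGraph.Walk a b, p.length ≤ 1 := by
  rcases h with rfl | h
  · exact ⟨.nil, zero_le⟩
  · exact ⟨.cons h .nil, le_rfl⟩

/-- Seven vertices in a chain of `Near` give a walk with at most six edges. -/
theorem not_near_of_dist (hdist : 7 ≤ N.skeletonGraph.dist v u) (a b c d e : V) (h1 : N.Near v a)
    (h2 : N.Near a b) (h3 : N.Near b c) (h4 : N.Near c d) (h5 : N.Near d e) : ¬ N.Near e u := by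
  intro h6
  obtain ⟨p1, l1⟩ := h1.exists_walk
  obtain ⟨p2, l2⟩ := h2.exists_walk
  obtain ⟨p3, l3⟩ := h3.exists_walk
  obtain ⟨p4, l4⟩ := h4.exists_walk
  obtain ⟨p5, l5⟩ := h5.exists_walk
  obtain ⟨p6, l6⟩ := h6.exists_walk
  have := SimpleGraph.dist_le (p1.append (p2.append (p3.append (p4.append (p5.append p6)))))
  simp only [SimpleGraph.Walk.length_append] at this
  omega

/-- The star handled complex is a star gluing. -/
theorem exists_isStarGluing (hflag : N.IsFlag) (hv : v ∈ N.vertexSet) (hu : u ∈ N.vertexSet)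
    (hdist : 7 ≤ N.skeletonGraph.dist v u) (φ : (N.link {v}).Iso (N.link {u})) :
    ∃ σ τ : Quot (HandleRel φ) → V, IsStarGluing N (N.starHandle φ) v u σ τ ∧
      ∀ x (hx : σ x ∈ (N.link {v}).vertexSet), τ x = φ.toEquiv ⟨σ x, hx⟩ := by
  classical
  have hfar := not_near_of_dist hdist
  have hdisj : ∀ w, w ∈ (N.link {v}).vertexSet → w ∉ (N.link {u}).vertexSet := by
    intro w h1 h2
    rw [← adj_iff_mem_link] at h1 h2
    exact hfar w u u u u (Or.inr h1) (Or.inr h2.symm) (Near.refl _) (Near.refl _) (Near.refl _)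
      (Near.refl _)
  -- `f` moves the link of `v` to the link of `u`, and `g` moves it back. As the links are disjoint,
  -- both are constant on the classes and descend to `τ` and `σ`.
  let f : V → V := fun w => if h : w ∈ (N.link {v}).vertexSet then φ.toEquiv ⟨w, h⟩ else w
  let g : V → V := fun w => if h : w ∈ (N.link {u}).vertexSet then φ.toEquiv.symm ⟨w, h⟩ else w
  have hf1 : ∀ w (h : w ∈ (N.link {v}).vertexSet), f w = φ.toEquiv ⟨w, h⟩ := fun w h => dif_pos h
  have hf2 : ∀ w, w ∉ (N.link {v}).vertexSet → f w = w := fun w h => dif_neg h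
  have hg1 : ∀ w (h : w ∈ (N.link {u}).vertexSet), g w = φ.toEquiv.symm ⟨w, h⟩ :=
    fun w h => dif_pos h
  have hg2 : ∀ w, w ∉ (N.link {u}).vertexSet → g w = w := fun w h => dif_neg h
  have hfm : ∀ w, w ∈ (N.link {v}).vertexSet → f w ∈ (N.link {u}).vertexSet := fun w h => by
    rw [hf1 w h]; exact (φ.toEquiv ⟨w, h⟩).2
  have hgm : ∀ w, w ∈ (N.link {u}).vertexSet → g w ∈ (N.link {v}).vertexSet := fun w h => by
    rw [hg1 w h]; exact (φ.toEquiv.symm ⟨w, h⟩).2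
  have hgf : ∀ w, w ∈ (N.link {v}).vertexSet → g (f w) = w := fun w h => by
    rw [hg1 _ (hfm w h)]
    have : (⟨f w, hfm w h⟩ : (N.link {u}).vertexSet) = φ.toEquiv ⟨w, h⟩ := Subtype.ext (hf1 w h)
    rw [this, Equiv.symm_apply_apply]
  have hfg : ∀ w, w ∈ (N.link {u}).vertexSet → f (g w) = w := fun w h => by
    rw [hf1 _ (hgm w h)]
    have : (⟨g w, hgm w h⟩ : (N.link {v}).vertexSet) = φ.toEquiv.symm ⟨w, h⟩ :=
      Subtype.ext (hg1 w h)
    rw [this, Equiv.apply_symm_apply]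
  have hfr : ∀ a b, HandleRel φ a b → f a = f b := by
    rintro a b ⟨ha, rfl⟩
    rw [← hf1 a ha, hf2 (f a) fun h => hdisj _ h (hfm a ha)]
  have hgr : ∀ a b, HandleRel φ a b → g a = g b := by
    rintro a b ⟨ha, rfl⟩
    rw [← hf1 a ha, hgf a ha, hg2 a (hdisj a ha)]
  let τ : Quot (HandleRel φ) → V := Quot.lift f hfr
  let σ : Quot (HandleRel φ) → V := Quot.lift g hgr
  have hτ : ∀ w, τ (Quot.mk _ w) = f w := fun _ => rfl
  have hσ : ∀ w, σ (Quot.mk _ w) = g w := fun _ => rfl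
  have hmkf : ∀ w, Quot.mk (HandleRel φ) (f w) = Quot.mk _ w := by
    intro w
    by_cases h : w ∈ (N.link {v}).vertexSet
    · exact (Quot.sound ⟨h, hf1 w h⟩).symm
    · rw [hf2 w h]
  have hmkg : ∀ w, Quot.mk (HandleRel φ) (g w) = Quot.mk _ w := by
    intro w
    by_cases h : w ∈ (N.link {u}).vertexSet
    · refine Quot.sound ⟨hgm w h, ?_⟩
      rw [← hf1, hfg w h]
    · rw [hg2 w h]
  have hmkτ : ∀ x, Quot.mk (HandleRel φ) (τ x) = x := Quot.ind fun w => hmkf w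
  have hmkσ : ∀ x, Quot.mk (HandleRel φ) (σ x) = x := Quot.ind fun w => hmkg w
  have hτf : ∀ x, τ x = f (σ x) := fun x => by rw [← hτ, hmkσ]
  have hσg : ∀ x, σ x = g (τ x) := fun x => by rw [← hσ, hmkτ]
  have hσu : ∀ x, σ x ∉ (N.link {u}).vertexSet := by
    intro x hx
    have h1 := hgm _ hx
    rw [← hσ, hmkσ] at h1
    exact hdisj _ h1 hx
  have hτv : ∀ x, τ x ∉ (N.link {v}).vertexSet := by
    intro x hx
    have h1 := hfm _ hx
    rw [← hτ, hmkτ] at h1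
    exact hdisj _ hx h1
  have hτ1 : ∀ x (hx : σ x ∈ (N.link {v}).vertexSet), τ x = φ.toEquiv ⟨σ x, hx⟩ :=
    fun x hx => by rw [hτf, hf1]
  refine ⟨σ, τ, ?_, hτ1⟩
  refine ⟨hflag, hv, hu, hfar, ?_, ?_, ?_, ?_, ?_, ?_, ?_, ?_, ?_, ?_⟩
  · exact fun x y h => by rw [← hmkσ x, ← hmkσ y, h]
  · exact fun x y h => by rw [← hmkτ x, ← hmkτ y, h]
  · intro x hx
    rw [adj_iff_mem_link] at hx
    rw [hτf, hf2 _ hx]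
  · intro x
    rw [adj_iff_mem_link, adj_iff_mem_link]
    refine ⟨fun h => ?_, fun h => ?_⟩
    · rw [hτf]; exact hfm _ h
    · rw [hσg]; exact hgm _ h
  · intro x
    rw [adj_iff_mem_link]
    exact hσu x
  · intro x
    rw [adj_iff_mem_link]
    exact hτv x
  · intro w hw
    rw [adj_iff_mem_link] at hw
    exact ⟨Quot.mk _ w, hg2 w hw⟩
  · intro w hw
    rw [adj_iff_mem_link] at hw
    exact ⟨Quot.mk _ w, hf2 w hw⟩
  · intro s hs
    have hs' : ∀ x ∈ s, σ x ∈ (N.link {v}).vertexSet := fun x hx => adj_iff_mem_link.1 (hs x hx)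
    let s' : Finset (N.link {v}).vertexSet := s.attach.image fun x => ⟨σ x.1, hs' x.1 x.2⟩
    have h1 : s'.map (Function.Embedding.subtype _) = s.image σ := by
      ext w
      simp only [s', Finset.mem_map, Finset.mem_image, Finset.mem_attach, true_and,
        Function.Embedding.subtype_apply]
      constructor
      · rintro ⟨_, ⟨x, rfl⟩, rfl⟩
        exact ⟨x, x.2, rfl⟩
      · rintro ⟨x, hx, rfl⟩
        exact ⟨_, ⟨⟨x, hx⟩, rfl⟩, rfl⟩
    have h2 : (s'.map φ.toEquiv.toEmbedding).map (Function.Embedding.subtype _) = s.image τ := by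
      ext w
      simp only [s', Finset.mem_map, Finset.mem_image, Finset.mem_attach, true_and,
        Function.Embedding.subtype_apply, Equiv.coe_toEmbedding]
      constructor
      · rintro ⟨_, ⟨_, ⟨x, rfl⟩, rfl⟩, rfl⟩
        exact ⟨x, x.2, hτ1 x _⟩
      · rintro ⟨x, hx, rfl⟩
        exact ⟨_, ⟨_, ⟨⟨x, hx⟩, rfl⟩, rfl⟩, (hτ1 x _).symm⟩
    have := φ.mem_faces_iff s'
    rwa [h1, h2] at this
  · intro s
    constructor
    · rintro ⟨t, ⟨⟨ht, hvt⟩, hut⟩, rfl⟩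
      -- A face that meets both links would join `v` to `u` in three steps. So one of the two
      -- sections returns all of its vertices unchanged.
      have hdich : (∀ w ∈ t, w ∉ (N.link {u}).vertexSet) ∨ ∀ w ∈ t, w ∉ (N.link {v}).vertexSet := by
        by_contra hn
        push Not at hn
        obtain ⟨⟨a, ha, hau⟩, b, hb, hbv⟩ := hn
        rw [← adj_iff_mem_link] at hau hbv
        exact hfar b a u u u (Or.inr hbv) (near_of_mem ht hb ha) (Or.inr hau.symm) (Near.refl _)
          (Near.refl _) (Near.refl _)
      have key : ∀ ρ : Quot (HandleRel φ) → V, (∀ w ∈ t, ρ (Quot.mk _ w) = w) →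
          N.Side v u ρ (t.image (Quot.mk (HandleRel φ))) := by
        intro ρ hρ
        have himg : (t.image (Quot.mk (HandleRel φ))).image ρ = t := by
          rw [Finset.image_image]
          exact (Finset.image_congr (fun w hw => hρ w hw)).trans Finset.image_id
        refine ⟨himg.symm ▸ ht, fun x hx => ?_⟩
        obtain ⟨w, hw, rfl⟩ := Finset.mem_image.1 hx
        rw [hρ w hw]
        exact ⟨fun h => hvt (h ▸ hw), fun h => hut (h ▸ hw)⟩
      rcases hdich with h | h
      · exact Or.inl (key σ fun w hw => hg2 w (h w hw))
      · exact Or.inr (key τ fun w hw => hf2 w (h w hw))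
    · have key : ∀ ρ : Quot (HandleRel φ) → V, (∀ x, Quot.mk _ (ρ x) = x) → N.Side v u ρ s →
          s ∈ (N.starHandle φ).faces := by
        intro ρ hρ hside
        refine ⟨s.image ρ, ⟨⟨hside.1, ?_⟩, ?_⟩, ?_⟩
        · intro h
          obtain ⟨x, hx, hxv⟩ := Finset.mem_image.1 h
          exact (hside.2 x hx).1 hxv
        · intro h
          obtain ⟨x, hx, hxv⟩ := Finset.mem_image.1 h
          exact (hside.2 x hx).2 hxv
        · change (s.image ρ).image (Quot.mk _) = s
          rw [Finset.image_image]
          exact (Finset.image_congr (fun w _ => hρ w)).trans Finset.image_id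
      rintro (h | h)
      · exact key σ hmkσ h
      · exact key τ hmkτ h

end PreAbstractSimplicialComplex

/-! ### Relabelling of realizations, and the links of the glued complex. -/

namespace PreAbstractSimplicialComplex

section Pullback

variable {V X : Type*} {K : PreAbstractSimplicialComplex X} {L : PreAbstractSimplicialComplex V}
  {σ : X → V}

theorem continuous_extend_zero : Continuous fun x : X → ℝ => (Function.extend σ x 0 : V → ℝ) := by
  classical
  refine continuous_pi fun w => ?_
  by_cases h : ∃ a, σ a = w
  · simp only [Function.extend_def, dif_pos h]
    fun_prop
  · simp only [Function.extend_def, dif_neg h]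
    fun_prop

theorem continuous_comp_right : Continuous fun y : V → ℝ => y ∘ σ :=
  continuous_pi fun z => continuous_apply (σ z)

theorem extend_mem_realization [DecidableEq V] (hσ : Function.Injective σ) {x : X → ℝ}
    (h0 : ∀ z, 0 ≤ x z) {t : Finset X} (ht : t.image σ ∈ L.faces) (hxt : ∀ z, z ∉ t → x z = 0)
    (hsum : ∑ z ∈ t, x z = 1) : Function.extend σ x 0 ∈ L.realization := by
  refine ⟨fun w => ?_, _, ht, fun w hw => ?_, ?_⟩
  · by_cases h : ∃ a, σ a = w
    · obtain ⟨a, rfl⟩ := h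
      rw [hσ.extend_apply]
      exact h0 a
    · rw [Function.extend_apply' _ _ _ h]
      rfl
  · by_cases h : ∃ a, σ a = w
    · obtain ⟨a, rfl⟩ := h
      rw [hσ.extend_apply]
      exact hxt a fun ha => hw (Finset.mem_image_of_mem σ ha)
    · rw [Function.extend_apply' _ _ _ h]
      rfl
  · rw [Finset.sum_image fun a _ b _ h => hσ h, ← hsum]
    exact Finset.sum_congr rfl fun z _ => hσ.extend_apply _ _ _

theorem exists_support_comp [DecidableEq V] (hσ : Function.Injective σ)
    (hcov : ∀ w ∈ L.vertexSet, ∃ x, σ x = w) {y : V → ℝ} (hy : y ∈ L.realization) :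
    ∃ t : Finset X, t.image σ ∈ L.faces ∧ (∀ z, z ∉ t → (y ∘ σ) z = 0) ∧
      ∑ z ∈ t, (y ∘ σ) z = 1 := by
  obtain ⟨-, s, hs, hys, hsum⟩ := hy
  have himg : (s.preimage σ hσ.injOn).image σ = s := by
    ext w
    rw [Finset.mem_image]
    constructor
    · rintro ⟨x, hx, rfl⟩
      exact Finset.mem_preimage.1 hx
    · intro hw
      obtain ⟨x, rfl⟩ := hcov w (mem_vertexSet_of_mem hs hw)
      exact ⟨x, Finset.mem_preimage.2 hw, rfl⟩
  refine ⟨s.preimage σ hσ.injOn, by rwa [himg], fun z hz => hys _ fun h =>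
    hz (Finset.mem_preimage.2 h), ?_⟩
  rw [← hsum]
  refine Eq.trans ?_ (congrArg (fun r : Finset V => ∑ w ∈ r, y w) himg)
  rw [Finset.sum_image fun a _ b _ h => hσ h]
  rfl

theorem extend_comp_eq (hσ : Function.Injective σ) (hcov : ∀ w ∈ L.vertexSet, ∃ x, σ x = w)
    {y : V → ℝ} (hy : y ∈ L.realization) : Function.extend σ (y ∘ σ) 0 = y := by
  funext w
  by_cases h : ∃ a, σ a = w
  · obtain ⟨a, rfl⟩ := h
    rw [hσ.extend_apply, Function.comp_apply]
  · rw [Function.extend_apply' _ _ _ h, Pi.zero_apply]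
    by_contra hn
    exact h (hcov w (mem_vertexSet_of_pos (mem_coneSet_of_mem_realization hy)
      ((hy.1 w).lt_of_ne hn)))

theorem comp_mem_realization [DecidableEq V] (hσ : Function.Injective σ)
    (hcov : ∀ w ∈ L.vertexSet, ∃ x, σ x = w)
    (hmem : ∀ t : Finset X, t.image σ ∈ L.faces → t ∈ K.faces) {y : V → ℝ}
    (hy : y ∈ L.realization) : y ∘ σ ∈ K.realization := by
  obtain ⟨t, ht, hyt, hsum⟩ := exists_support_comp hσ hcov hy
  exact ⟨fun z => hy.1 _, t, hmem t ht, hyt, hsum⟩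

theorem nonempty_realization_homeomorph [DecidableEq V] (hσ : Function.Injective σ)
    (hcov : ∀ w ∈ L.vertexSet, ∃ x, σ x = w)
    (hmem : ∀ t : Finset X, t.image σ ∈ L.faces ↔ t ∈ K.faces) :
    Nonempty (K.realization ≃ₜ L.realization) := by
  have hm : ∀ x : K.realization, Function.extend σ (x : X → ℝ) 0 ∈ L.realization := by
    rintro ⟨x, h0, t, ht, hxt, hsum⟩
    exact extend_mem_realization hσ h0 ((hmem t).2 ht) hxt hsum
  exact ⟨{
     toFun := fun x => ⟨Function.extend σ (x : X → ℝ) 0, hm x⟩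
     invFun := fun y => ⟨(y : V → ℝ) ∘ σ, comp_mem_realization hσ hcov (fun t => (hmem t).1) y.2⟩
     left_inv := fun x => Subtype.ext (Function.extend_comp hσ (x : X → ℝ) 0)
     right_inv := fun y => Subtype.ext (extend_comp_eq hσ hcov y.2)
     continuous_toFun := (continuous_extend_zero.comp continuous_subtype_val).subtype_mk hm
     continuous_invFun := (continuous_comp_right.comp continuous_subtype_val).subtype_mk _ }⟩

/-- Complexes that correspond to each other under relabelling have homeomorphic realizations. -/
theorem exists_transfer_homeomorph [DecidableEq V] {L' : PreAbstractSimplicialComplex V}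
    {τ : X → V} (hσ : Function.Injective σ) (hτ : Function.Injective τ)
    (hcovσ : ∀ w ∈ L.vertexSet, ∃ x, σ x = w) (hcovτ : ∀ w ∈ L'.vertexSet, ∃ x, τ x = w)
    (hiff : ∀ t : Finset X, t.image σ ∈ L.faces ↔ t.image τ ∈ L'.faces) :
    ∃ Λ : L'.realization ≃ₜ L.realization,
      ∀ y, (Λ y : V → ℝ) = Function.extend σ ((y : V → ℝ) ∘ τ) 0 := by
  have hm1 : ∀ y : L'.realization,
      Function.extend σ ((y : V → ℝ) ∘ τ) 0 ∈ L.realization := fun y => by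
    obtain ⟨t, ht, hyt, hsum⟩ := exists_support_comp hτ hcovτ y.2
    exact extend_mem_realization hσ (fun z => y.2.1 _) ((hiff t).2 ht) hyt hsum
  have hm2 : ∀ y : L.realization,
      Function.extend τ ((y : V → ℝ) ∘ σ) 0 ∈ L'.realization := fun y => by
    obtain ⟨t, ht, hyt, hsum⟩ := exists_support_comp hσ hcovσ y.2
    exact extend_mem_realization hτ (fun z => y.2.1 _) ((hiff t).1 ht) hyt hsum
  refine ⟨
    { toFun := fun y => ⟨Function.extend σ ((y : V → ℝ) ∘ τ) 0, hm1 y⟩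
      invFun := fun y => ⟨Function.extend τ ((y : V → ℝ) ∘ σ) 0, hm2 y⟩
      left_inv := fun y => Subtype.ext (by
        change Function.extend τ (Function.extend σ ((y : V → ℝ) ∘ τ) 0 ∘ σ) 0 = _
        rw [Function.extend_comp hσ, extend_comp_eq hτ hcovτ y.2])
      right_inv := fun y => Subtype.ext (by
        change Function.extend σ (Function.extend τ ((y : V → ℝ) ∘ σ) 0 ∘ τ) 0 = _
        rw [Function.extend_comp hτ, extend_comp_eq hσ hcovσ y.2])
      continuous_toFun := (continuous_extend_zero.comp (continuous_comp_right.comp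
        continuous_subtype_val)).subtype_mk hm1
      continuous_invFun := (continuous_extend_zero.comp (continuous_comp_right.comp
        continuous_subtype_val)).subtype_mk hm2 }, fun y => rfl⟩

end Pullback

section Cap

variable {V : Type*} {L : PreAbstractSimplicialComplex V} {v : V}

/-- The closed star of a vertex whose link is a sphere, as a ball. -/
theorem exists_star_cap (hfin : L.faces.Finite) (hv : v ∈ L.vertexSet) {m : ℕ}
    (ξ : sphere (0 : EuclideanSpace ℝ (Fin m)) 1 ≃ₜ (L.link {v}).realization) :
    ∃ ζ : closedBall (0 : EuclideanSpace ℝ (Fin m)) 1 → L.realization, Continuous ζ ∧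
      Function.Injective ζ ∧ (∀ w, (ζ w : V → ℝ) v = 1 - ‖(w : EuclideanSpace ℝ (Fin m))‖) ∧
      (∀ x : L.realization, 0 < (x : V → ℝ) v → ∃ w, ζ w = x) ∧
      ∀ (w : closedBall (0 : EuclideanSpace ℝ (Fin m)) 1)
        (hw : (w : EuclideanSpace ℝ (Fin m)) ∈ sphere (0 : EuclideanSpace ℝ (Fin m)) 1),
        (ζ w : V → ℝ) = ξ ⟨w, hw⟩ := by
  obtain ⟨F, hF⟩ := exists_supportedOn hfin
  have hFl := hF.link {v}
  have hcone := hFl.coneOver_realization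
  obtain ⟨Φ, hΦ1, hΦ2, hΦ3⟩ := exists_cone_homeomorph (T := sphere (0 : EuclideanSpace ℝ (Fin m)) 1)
    (T' := (L.link {v}).realization) (ℓ := fun w => ‖w‖) (ℓ' := fun x => ∑ w ∈ F, x w)
    continuous_norm (fun r x hr => by rw [norm_smul, Real.norm_of_nonneg hr])
    (fun t ht => by simpa using ht) (isCompact_sphere _ _) (by fun_prop)
    (fun r x _ => by simp only [Pi.smul_apply, smul_eq_mul, Finset.mul_sum])
    (fun t ht => (hFl.mem_realization_iff.1 ht).2) (isCompact_realization (finite_link hfin _)) ξ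
  have hall : ∀ w : EuclideanSpace ℝ (Fin m), w ∈ coneOver (sphere (0 : EuclideanSpace ℝ (Fin m)) 1) := by
    intro w
    by_cases hw : w = 0
    · exact Or.inl hw
    · have hw' := norm_pos_iff.2 hw
      refine Or.inr ⟨‖w‖, hw', ‖w‖⁻¹ • w, ?_, ?_⟩
      · rw [mem_sphere_zero_iff_norm, norm_smul, norm_inv, norm_norm, inv_mul_cancel₀ hw'.ne']
      · rw [smul_smul, mul_inv_cancel₀ hw'.ne', one_smul]
  let Ψ : EuclideanSpace ℝ (Fin m) → V → ℝ := fun w => Φ ⟨w, hall w⟩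
  have hΨc : Continuous Ψ := by fun_prop
  have hΨm : ∀ w, Ψ w ∈ (L.link {v}).coneSet := fun w => hcone ▸ (Φ ⟨w, hall w⟩).2
  have hΨs : ∀ w, ∑ p ∈ F, Ψ w p = ‖w‖ := fun w => hΦ1 ⟨w, hall w⟩
  have hΨv : ∀ w, Ψ w v = 0 := fun w => eq_zero_of_mem_coneSet_link (hΨm w)
  have hΨi : Function.Injective Ψ := fun w w' h => by
    have := Φ.injective (Subtype.ext h)
    exact congrArg Subtype.val this
  have hvF : v ∈ F := hF.mem hv
  have hmem : ∀ w : closedBall (0 : EuclideanSpace ℝ (Fin m)) 1,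
      (1 - ‖(w : EuclideanSpace ℝ (Fin m))‖) • vtx v + Ψ w ∈ L.realization := by
    rintro ⟨w, hw⟩
    rw [mem_closedBall_zero_iff] at hw
    refine hF.mem_realization_iff.2 ⟨?_, ?_⟩
    · rcases hw.eq_or_lt with h | h
      · simp only [h, sub_self, zero_smul, zero_add]
        exact coneSet_mono link_faces_subset (hΨm w)
      · exact (vtx_add_mem_coneSet_iff hv (hΨv w) (sub_pos.2 h)).2 (hΨm w)
    · simp only [Pi.add_apply, Pi.smul_apply, smul_eq_mul]
      rw [Finset.sum_add_distrib, ← Finset.mul_sum, sum_vtx hvF, hΨs]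
      ring
  have hval : ∀ w : closedBall (0 : EuclideanSpace ℝ (Fin m)) 1,
      ((1 - ‖(w : EuclideanSpace ℝ (Fin m))‖) • vtx v + Ψ w) v =
        1 - ‖(w : EuclideanSpace ℝ (Fin m))‖ := by
    intro w
    simp [hΨv]
  refine ⟨fun w => ⟨_, hmem w⟩, by fun_prop, ?_, hval, ?_, ?_⟩
  · intro w w' h
    have h1 : (1 - ‖(w : EuclideanSpace ℝ (Fin m))‖) • vtx v + Ψ w =
      (1 - ‖(w' : EuclideanSpace ℝ (Fin m))‖) • vtx v + Ψ w' := congrArg Subtype.val h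
    have h2 := congrFun h1 v
    rw [hval, hval] at h2
    rw [h2] at h1
    exact Subtype.ext (hΨi (add_left_cancel h1))
  · intro x hx
    have h1 := sub_vtx_mem_coneSet_link hv (mem_coneSet_of_mem_realization x.2) hx
    obtain ⟨w, hw⟩ := Φ.surjective ⟨_, hcone.symm ▸ h1⟩
    have hw' : Ψ w = (x : V → ℝ) - (x : V → ℝ) v • vtx v := congrArg Subtype.val hw
    have h2 : ‖(w : EuclideanSpace ℝ (Fin m))‖ = 1 - (x : V → ℝ) v := by
      rw [← hΨs, hw']
      simp only [Pi.sub_apply, Pi.smul_apply, smul_eq_mul]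
      rw [Finset.sum_sub_distrib, ← Finset.mul_sum, sum_vtx hvF, (hF.mem_realization_iff.1 x.2).2,
        mul_one]
    refine ⟨⟨w, ?_⟩, Subtype.ext ?_⟩
    · rw [mem_closedBall_zero_iff, h2]
      linarith
    · change (1 - ‖(w : EuclideanSpace ℝ (Fin m))‖) • vtx v + Ψ w = x
      rw [h2, hw']
      simp
  · intro w hw
    change (1 - ‖(w : EuclideanSpace ℝ (Fin m))‖) • vtx v + Ψ w = _
    have := hΦ3 ⟨w, hall w⟩ 1 ⟨w, hw⟩ one_pos (one_smul _ _).symm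
    rw [mem_sphere_zero_iff_norm.1 hw, sub_self, zero_smul, zero_add]
    exact this.trans (one_smul _ _)

end Cap

theorem IsSimplicialManifold.isSphereComplex_link {V : Type*} {N : PreAbstractSimplicialComplex V}
    {d : ℕ} (hN : N.IsSimplicialManifold d) {s : Finset V} (hs : s ∈ N.faces) :
    (N.link s).IsSphereComplex (d + 1 - s.card) := by
  classical
  refine ⟨finite_link hN.finite s, hN.link_sphere s hs, fun t ht => ?_⟩
  rw [mem_link_faces] at ht
  have h1 := hN.card_le _ ht.2.2
  have h2 := hN.link_sphere _ ht.2.2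
  have h3 := Finset.card_union_of_disjoint ht.2.1
  refine ⟨d + 1 - (s ∪ t).card, by omega, ?_⟩
  rwa [link_link ht.2.1]

namespace IsStarGluing

variable {V X : Type*} {N : PreAbstractSimplicialComplex V} {Q : PreAbstractSimplicialComplex X}
  {v u : V} {σ τ : X → V}

/-- The link of a face with a vertex outside of the common link, away from `lk u`. -/
theorem nonempty_link_homeomorph_of_not_adj [DecidableEq V] (h : IsStarGluing N Q v u σ τ)
    {s : Finset X} (hs : s ∈ Q.faces) {a : X} (ha : a ∈ s) (hva : ¬ N.skeletonGraph.Adj v (σ a))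
    (hnu : ∀ b, N.Near (σ a) b → ¬ N.skeletonGraph.Adj u b) :
    s.image σ ∈ N.faces ∧
      Nonempty ((Q.link s).realization ≃ₜ (N.link (s.image σ)).realization) := by
  classical
  have hga := h.mem_vertexSet_iff.1 (mem_vertexSet_of_mem hs ha)
  have hside : ∀ s' : Finset X, a ∈ s' → (s' ∈ Q.faces ↔ N.Side v u σ s') := by
    intro s' has'
    rw [h.mem_faces_iff, or_iff_left_iff_imp, h.side_iff, h.side_right_iff]
    rintro ⟨hne, hg, hc⟩
    have heq : ∀ x ∈ s', σ x = τ x := by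
      intro x hx
      refine h.eq_right (hnu _ ?_)
      rw [h.eq_of_not_adj a hva]
      exact hc a has' x hx
    refine ⟨hne, hg, fun x hx y hy => ?_⟩
    rw [heq x hx, heq y hy]
    exact hc x hx y hy
  have hface : ∀ s' : Finset X, a ∈ s' → (s' ∈ Q.faces ↔ s'.image σ ∈ N.faces) := by
    intro s' has'
    rw [hside s' has']
    constructor
    · intro h1; convert h1.1
    · intro h1
      refine ⟨by convert h1, fun x hx => ?_⟩
      have hn : N.Near (σ a) (σ x) :=
        near_of_mem h1 (Finset.mem_image_of_mem σ has') (Finset.mem_image_of_mem σ hx)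
      constructor
      · intro hxv
        rw [hxv] at hn
        exact hn.elim hga.2.1 fun h2 => hva h2.symm
      · intro hxu
        rw [hxu] at hn
        exact hn.elim hga.2.2 fun h2 => h.not_adj_left a h2.symm
  have hsN := (hface s ha).1 hs
  refine ⟨hsN, nonempty_realization_homeomorph h.left_injective ?_ ?_⟩
  · intro w hw
    have hw' := mem_link_faces.1 hw
    exact h.cover_left w (hnu w (near_of_mem hw'.2.2
      (Finset.mem_union_left _ (Finset.mem_image_of_mem σ ha))
      (Finset.mem_union_right _ (Finset.mem_singleton_self w))))
  · intro t
    rw [mem_link_faces, mem_link_faces, Finset.image_nonempty,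
      Finset.disjoint_image h.left_injective, ← Finset.image_union,
      hface _ (Finset.mem_union_left _ ha)]

/-- Describes the part of the link of `s` that is seen from `v`: deleting `v` is the only
correction, because the face lies in the link of `v` and `u` is too far away to appear. -/
theorem mem_link_iff_of_adj [DecidableEq V] [DecidableEq X] (h : IsStarGluing N Q v u σ τ)
    {s : Finset X} (hne : s.Nonempty) (hadj : ∀ x ∈ s, N.skeletonGraph.Adj v (σ x))
    {t : Finset X} : t.image σ ∈ ((N.link (s.image σ)).deletion v).faces ↔
      t.Nonempty ∧ Disjoint s t ∧ N.Side v u σ (s ∪ t) := by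
  change t.image σ ∈ (N.link (s.image σ)).faces ∧ _ ↔ _
  rw [mem_link_faces, Finset.image_nonempty, Finset.disjoint_image h.left_injective,
    ← Finset.image_union]
  constructor
  · rintro ⟨⟨h1, h2, h3⟩, h4⟩
    refine ⟨h1, h2, by convert h3, fun x hx => ?_⟩
    rcases Finset.mem_union.1 hx with hxs | hxt
    · exact (h.good_of_adj (hadj x hxs)).2
    · refine ⟨fun hxv => h4 (hxv ▸ Finset.mem_image_of_mem σ hxt), fun hxu => ?_⟩
      obtain ⟨a, ha⟩ := hne
      have hn : N.Near (σ a) (σ x) := near_of_mem h3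
        (Finset.mem_image_of_mem σ (Finset.mem_union_left _ ha)) (Finset.mem_image_of_mem σ hx)
      rw [hxu] at hn
      exact h.far_four (Or.inr (hadj a ha)) hn (Near.refl _) (Near.refl _)
  · rintro ⟨h1, h2, h3⟩
    refine ⟨⟨h1, h2, by convert h3.1⟩, fun hv => ?_⟩
    obtain ⟨x, hx, hxv⟩ := Finset.mem_image.1 hv
    exact (h3.2 x (Finset.mem_union_right _ hx)).1 hxv

theorem cover_link_of_adj [DecidableEq V] (h : IsStarGluing N Q v u σ τ)
    {s : Finset X} (hne : s.Nonempty) (hadj : ∀ x ∈ s, N.skeletonGraph.Adj v (σ x)) :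
    ∀ w ∈ (N.link (s.image σ)).vertexSet, ∃ x, σ x = w := by
  intro w hw
  have hw' := mem_link_faces.1 hw
  obtain ⟨a, ha⟩ := hne
  refine h.cover_left w fun hadjw => ?_
  have hn : N.Near (σ a) w := near_of_mem hw'.2.2
    (Finset.mem_union_left _ (Finset.mem_image_of_mem σ ha))
    (Finset.mem_union_right _ (Finset.mem_singleton_self w))
  exact h.far_four (Or.inr (hadj a ha)) hn (Or.inr hadjw.symm) (Near.refl _)

/-- The faces of the link of a face of the common link that exist on both sides. -/
theorem mem_link_link_of_both [DecidableEq V] [DecidableEq X] (h : IsStarGluing N Q v u σ τ)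
    {s : Finset X} (hne : s.Nonempty) (hadj : ∀ x ∈ s, N.skeletonGraph.Adj v (σ x))
    {t : Finset X} (h1 : N.Side v u σ (s ∪ t)) (h2 : N.Side v u τ (s ∪ t)) :
    ∀ x ∈ s ∪ t, N.skeletonGraph.Adj v (σ x) := by
  intro x hx
  by_contra hn
  obtain ⟨a, ha⟩ := hne
  have hh1 := (h.side_iff.1 h1).2.2 a (Finset.mem_union_left _ ha) x hx
  have hh2 := (h.side_right_iff.1 h2).2.2 a (Finset.mem_union_left _ ha) x hx
  rw [← h.eq_of_not_adj x hn] at hh2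
  exact h.far_four (Or.inr (hadj a ha)) hh1 hh2.symm
    (Or.inr ((h.adj_iff a).1 (hadj a ha)).symm)

theorem side_both_iff [DecidableEq V] [DecidableEq X] (h : IsStarGluing N Q v u σ τ)
    {s : Finset X} (hadj : ∀ x ∈ s, N.skeletonGraph.Adj v (σ x)) :
    N.Side v u σ s ↔ N.Side v u τ s := by
  rw [h.side_iff, h.side_right_iff]
  refine and_congr_right fun _ => and_congr_right fun _ => forall₂_congr fun x hx =>
    forall₂_congr fun y hy => h.near_iff_of_adj (hadj x hx) (hadj y hy)

theorem mem_link_link_iff [DecidableEq V] [DecidableEq X] (h : IsStarGluing N Q v u σ τ)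
    {s : Finset X} (hne : s.Nonempty) (hadj : ∀ x ∈ s, N.skeletonGraph.Adj v (σ x))
    {t : Finset X} : t.image σ ∈ ((N.link (s.image σ)).link {v}).faces ↔
      t.Nonempty ∧ Disjoint s t ∧ N.Side v u σ (s ∪ t) ∧
        ∀ x ∈ s ∪ t, N.skeletonGraph.Adj v (σ x) := by
  constructor
  · intro ht
    obtain ⟨h1, h2, h3⟩ := (h.mem_link_iff_of_adj hne hadj).1 (link_faces_subset_deletion ht)
    refine ⟨h1, h2, h3, fun x hx => ?_⟩
    rcases Finset.mem_union.1 hx with hxs | hxt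
    · exact hadj x hxs
    · rw [mem_link_singleton_faces] at ht
      have hf := link_faces_subset ht.2.2
      rw [adj_iff_near]
      exact ⟨near_of_mem hf (Finset.mem_insert_self _ _)
        (Finset.mem_insert_of_mem (Finset.mem_image_of_mem σ hxt)), (h3.2 x hx).1.symm⟩
  · rintro ⟨h1, h2, h3, h4⟩
    have hl := (h.mem_link_left_iff h4).2 ⟨h1.mono Finset.subset_union_right,
      (h.side_iff.1 h3).2.2⟩
    have hvs : Disjoint (s.image σ) {v} := by
      rw [Finset.disjoint_singleton_right]
      intro hv
      obtain ⟨x, hx, hxv⟩ := Finset.mem_image.1 hv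
      exact (hadj x hx).ne hxv.symm
    rw [link_link hvs, Finset.union_comm, ← link_link hvs.symm, mem_link_faces,
      Finset.image_nonempty, Finset.disjoint_image h.left_injective, ← Finset.image_union]
    exact ⟨h1, h2, hl⟩

/-- The link of a face of the common link is again a sphere. -/
theorem nonempty_link_homeomorph_of_adj [DecidableEq V] (h : IsStarGluing N Q v u σ τ) {d : ℕ}
    (hN : N.IsSimplicialManifold d) {s : Finset X} (hs : s ∈ Q.faces)
    (hadj : ∀ x ∈ s, N.skeletonGraph.Adj v (σ x)) :
    s.image σ ∈ N.faces ∧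
      Nonempty ((Q.link s).realization ≃ₜ (N.link (s.image σ)).realization) := by
  classical
  have hne := nonempty_of_mem_faces hs
  have hadj' : ∀ x ∈ s, N.skeletonGraph.Adj u (τ x) := fun x hx => (h.adj_iff x).1 (hadj x hx)
  have hsσ : N.Side v u σ s := by
    rcases (h.mem_faces_iff s).1 hs with h1 | h1
    · exact h1
    · exact (h.side_both_iff hadj).2 h1
  have hsτ : N.Side v u τ s := (h.side_both_iff hadj).1 hsσ
  have hσf : s.image σ ∈ N.faces := by convert hsσ.1
  have hτf : s.image τ ∈ N.faces := by convert hsτ.1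
  refine ⟨hσf, ?_⟩
  have hcσ : (s.image σ).card = s.card := Finset.card_image_of_injective _ h.left_injective
  have hcτ : (s.image τ).card = s.card := Finset.card_image_of_injective _ h.right_injective
  set L := N.link (s.image σ) with hL
  set L' := N.link (s.image τ) with hL'
  have hvL : v ∈ L.vertexSet := by
    have hl := (h.mem_link_left_iff hadj).2 ⟨hne, (h.side_iff.1 hsσ).2.2⟩
    rw [mem_link_singleton_faces] at hl
    refine mem_link_faces.2 ⟨Finset.singleton_nonempty v, ?_, ?_⟩
    · rw [Finset.disjoint_singleton_right]; exact hl.2.1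
    · rw [Finset.union_comm, ← Finset.insert_eq]; exact hl.2.2
  have huL : u ∈ L'.vertexSet := by
    have hl := (h.symm.mem_link_left_iff hadj').2 ⟨hne, (h.side_right_iff.1 hsτ).2.2⟩
    rw [mem_link_singleton_faces] at hl
    refine mem_link_faces.2 ⟨Finset.singleton_nonempty u, ?_, ?_⟩
    · rw [Finset.disjoint_singleton_right]; exact hl.2.1
    · rw [Finset.union_comm, ← Finset.insert_eq]; exact hl.2.2
  have hSL := hN.isSphereComplex_link hσf
  have hSL' := hN.isSphereComplex_link hτf
  rw [hcσ] at hSL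
  rw [hcτ] at hSL'
  obtain ⟨m, hm⟩ : ∃ m, d + 1 - s.card = m + 1 := by
    have := hSL.card_le hvL
    rw [Finset.card_singleton] at this
    exact ⟨d + 1 - s.card - 1, by omega⟩
  rw [hm] at hSL hSL'
  have hcovσ := h.cover_link_of_adj hne hadj
  have hcovτ := h.symm.cover_link_of_adj hne hadj'
  have hswap : ∀ t, N.Side u v τ t ↔ N.Side v u τ t := fun t => ⟨Side.swap, Side.swap⟩
  have hmσ : ∀ t : Finset X, t.image σ ∈ (L.deletion v).faces → t ∈ (Q.link s).faces := by
    intro t ht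
    obtain ⟨h1, h2, h3⟩ := (h.mem_link_iff_of_adj hne hadj).1 ht
    exact mem_link_faces.2 ⟨h1, h2, (h.mem_faces_iff _).2 (Or.inl h3)⟩
  have hmτ : ∀ t : Finset X, t.image τ ∈ (L'.deletion u).faces → t ∈ (Q.link s).faces := by
    intro t ht
    obtain ⟨h1, h2, h3⟩ := (h.symm.mem_link_iff_of_adj hne hadj').1 ht
    exact mem_link_faces.2 ⟨h1, h2, (h.mem_faces_iff _).2 (Or.inr h3.swap)⟩
  have hmiff : ∀ t : Finset X, t.image σ ∈ (L.link {v}).faces ↔ t.image τ ∈ (L'.link {u}).faces := by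
    intro t
    rw [h.mem_link_link_iff hne hadj, h.symm.mem_link_link_iff hne hadj', hswap]
    refine and_congr_right fun _ => and_congr_right fun _ => ⟨?_, ?_⟩
    · rintro ⟨h1, h2⟩
      exact ⟨(h.side_both_iff h2).1 h1, fun x hx => (h.adj_iff x).1 (h2 x hx)⟩
    · rintro ⟨h1, h2⟩
      have h3 := fun x hx => (h.adj_iff x).2 (h2 x hx)
      exact ⟨(h.side_both_iff h3).2 h1, h3⟩
  have hboth : ∀ t : Finset X, t.image σ ∈ (L.deletion v).faces →
      t.image τ ∈ (L'.deletion u).faces → t.image σ ∈ (L.link {v}).faces := by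
    intro t h1 h2
    rw [h.mem_link_iff_of_adj hne hadj] at h1
    rw [h.symm.mem_link_iff_of_adj hne hadj', hswap] at h2
    exact (h.mem_link_link_iff hne hadj).2 ⟨h1.1, h1.2.1, h1.2.2,
      h.mem_link_link_of_both hne hadj h1.2.2 h2.2.2⟩
  have hcovσd : ∀ w ∈ (L.deletion v).vertexSet, ∃ x, σ x = w := fun w hw => hcovσ w hw.1
  have hcovτd : ∀ w ∈ (L'.deletion u).vertexSet, ∃ x, τ x = w := fun w hw => hcovτ w hw.1
  have hcovσl : ∀ w ∈ (L.link {v}).vertexSet, ∃ x, σ x = w :=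
    fun w hw => hcovσ w (link_faces_subset hw)
  have hcovτl : ∀ w ∈ (L'.link {u}).vertexSet, ∃ x, τ x = w :=
    fun w hw => hcovτ w (link_faces_subset hw)
  -- the identification of the two boundary spheres
  obtain ⟨Λ, hΛe⟩ := exists_transfer_homeomorph h.left_injective h.right_injective hcovσl hcovτl hmiff
  have hΛ : ∀ y, (Λ y : V → ℝ) ∘ σ = (y : V → ℝ) ∘ τ := fun y => by
    rw [hΛe]
    exact Function.extend_comp h.left_injective _ _
  obtain ⟨β, hβ⟩ := hSL'.exists_ball huL
  have hlink' : ∀ y : (L'.link {u}).realization, (y : V → ℝ) ∈ (L'.deletion u).realization :=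
    fun y => realization_mono link_faces_subset_deletion y.2
  let β₁ : (L'.link {u}).realization ≃ₜ sphere (0 : EuclideanSpace ℝ (Fin m)) 1 :=
    { toFun := fun y => ⟨β ⟨y, hlink' y⟩, (hβ _).1 y.2⟩
      invFun := fun z => ⟨β.symm ⟨z, sphere_subset_closedBall z.2⟩, (hβ _).2 (by
        rw [Homeomorph.apply_symm_apply]; exact z.2)⟩
      left_inv := fun y => Subtype.ext (by simp)
      right_inv := fun z => Subtype.ext (by simp)
      continuous_toFun := by fun_prop
      continuous_invFun := by fun_prop }
  -- The closed star of `v` in `L` is a ball by coning. Its boundary is parametrised so that it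
  -- matches, under the identification of the links, the boundary of the ball `L'` minus `u`.
  obtain ⟨ζ, hζc, hζi, hζv, hζs, hζb⟩ := exists_star_cap hSL.finite hvL (β₁.symm.trans Λ)
  have hζΛ : ∀ y : (L'.link {u}).realization,
      (ζ (β ⟨y, hlink' y⟩) : V → ℝ) = (Λ y : V → ℝ) := by
    intro y
    rw [hζb _ (β₁ y).2]
    change (Λ (β₁.symm (β₁ y)) : V → ℝ) = _
    rw [Homeomorph.symm_apply_apply]
  have hc1 : CompactSpace (L.deletion v).realization :=
    isCompact_iff_compactSpace.1 (isCompact_realization (finite_deletion hSL.finite _))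
  have hc2 : CompactSpace (L'.deletion u).realization :=
    isCompact_iff_compactSpace.1 (isCompact_realization (finite_deletion hSL'.finite _))
  -- Two quotients of the same disjoint union: `f` glues the pieces to the link of `s` in the
  -- quotient, while `g` uses the second ball to refill the star of `v` in `L`. Both identify
  -- exactly corresponding boundary points, so the link of `s` is homeomorphic to the sphere `L`.
  let f : (L.deletion v).realization ⊕ (L'.deletion u).realization → (Q.link s).realization :=
    Sum.elim (fun y => ⟨(y : V → ℝ) ∘ σ, comp_mem_realization h.left_injective hcovσd hmσ y.2⟩)
      (fun y => ⟨(y : V → ℝ) ∘ τ, comp_mem_realization h.right_injective hcovτd hmτ y.2⟩)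
  let g : (L.deletion v).realization ⊕ (L'.deletion u).realization → L.realization :=
    Sum.elim (fun y => ⟨y, (mem_realization_deletion_iff.1 y.2).1⟩) (fun y => ζ (β y))
  have hf : Continuous f := Continuous.sumElim
    ((continuous_comp_right.comp continuous_subtype_val).subtype_mk _)
    ((continuous_comp_right.comp continuous_subtype_val).subtype_mk _)
  have hg : Continuous g := Continuous.sumElim (continuous_subtype_val.subtype_mk _)
    (hζc.comp β.continuous)
  have hfs : Function.Surjective f := by
    rintro ⟨x, h0, t, ht, hxt, hsum⟩
    rw [mem_link_faces, h.mem_faces_iff] at ht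
    rcases ht.2.2 with h1 | h1
    · refine ⟨Sum.inl ⟨Function.extend σ x 0, extend_mem_realization h.left_injective h0
        ((h.mem_link_iff_of_adj hne hadj).2 ⟨ht.1, ht.2.1, h1⟩) hxt hsum⟩, Subtype.ext ?_⟩
      exact Function.extend_comp h.left_injective _ _
    · refine ⟨Sum.inr ⟨Function.extend τ x 0, extend_mem_realization h.right_injective h0
        ((h.symm.mem_link_iff_of_adj hne hadj').2 ⟨ht.1, ht.2.1, h1.swap⟩) hxt hsum⟩,
        Subtype.ext ?_⟩
      exact Function.extend_comp h.right_injective _ _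
  have hgs : Function.Surjective g := by
    intro x
    rcases (x.2.1 v).eq_or_lt with hx | hx
    · exact ⟨Sum.inl ⟨x, mem_realization_deletion_iff.2 ⟨x.2, hx.symm⟩⟩, rfl⟩
    · obtain ⟨w, hw⟩ := hζs x hx
      exact ⟨Sum.inr (β.symm w), by
        change ζ (β (β.symm w)) = x
        rw [Homeomorph.apply_symm_apply, hw]⟩
  have hmix : ∀ (y : (L.deletion v).realization) (y' : (L'.deletion u).realization),
      f (Sum.inl y) = f (Sum.inr y') ↔ g (Sum.inl y) = g (Sum.inr y') := by
    intro y y'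
    constructor
    · intro heq
      have heq' : (y : V → ℝ) ∘ σ = (y' : V → ℝ) ∘ τ := congrArg Subtype.val heq
      obtain ⟨t, ht, hyt, hsum⟩ := exists_support_comp h.left_injective hcovσd y.2
      -- restrict to the positive coordinates
      let t₀ := t.filter fun z => 0 < ((y : V → ℝ) ∘ σ) z
      have hsum₀ : ∑ z ∈ t₀, ((y : V → ℝ) ∘ σ) z = 1 := by
        rw [← hsum]
        refine Finset.sum_subset (Finset.filter_subset _ _) fun z hz hz' => ?_
        by_contra hn
        exact hz' (Finset.mem_filter.2 ⟨hz, (y.2.1 _).lt_of_ne' hn⟩)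
      have hne₀ : t₀.Nonempty := by
        by_contra hn
        rw [Finset.not_nonempty_iff_eq_empty] at hn
        rw [hn] at hsum₀
        simp at hsum₀
      have hyt₀ : ∀ z, z ∉ t₀ → ((y' : V → ℝ) ∘ τ) z = 0 := by
        intro z hz
        rw [← heq']
        by_contra hn
        have hzt : z ∈ t := by
          by_contra hzt
          exact hn (hyt z hzt)
        exact hz (Finset.mem_filter.2 ⟨hzt, (y.2.1 _).lt_of_ne' hn⟩)
      have h1 : t₀.image σ ∈ (L.deletion v).faces :=
        mem_faces_of_subset ht (Finset.image_subset_image (Finset.filter_subset _ _))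
          (hne₀.image σ)
      have h2 : t₀.image τ ∈ (L'.deletion u).faces := by
        refine mem_faces_of_pos (mem_coneSet_of_mem_realization y'.2) (hne₀.image τ) fun w hw => ?_
        obtain ⟨z, hz, rfl⟩ := Finset.mem_image.1 hw
        have := congrFun heq' z
        rw [Function.comp_apply, Function.comp_apply] at this
        rw [← this]
        exact (Finset.mem_filter.1 hz).2
      have h3 := (hmiff t₀).1 (hboth t₀ h1 h2)
      have hy' : (y' : V → ℝ) ∈ (L'.link {u}).realization := by
        rw [← extend_comp_eq h.right_injective hcovτd y'.2]
        exact extend_mem_realization h.right_injective (fun z => y'.2.1 _) h3 hyt₀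
          (by rw [← heq']; exact hsum₀)
      refine Subtype.ext ?_
      change (y : V → ℝ) = ζ (β y')
      rw [hζΛ ⟨y', hy'⟩, ← extend_comp_eq h.left_injective hcovσd y.2, heq', hΛe]
    · intro heq
      have heq' : (y : V → ℝ) = ζ (β y') := congrArg Subtype.val heq
      have hyv := (mem_realization_deletion_iff.1 y.2).2
      rw [heq', hζv] at hyv
      have hy' : (y' : V → ℝ) ∈ (L'.link {u}).realization := by
        rw [hβ, mem_sphere_zero_iff_norm]
        linarith
      refine Subtype.ext ?_
      change (y : V → ℝ) ∘ σ = (y' : V → ℝ) ∘ τ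
      rw [heq', hζΛ ⟨y', hy'⟩, hΛ]
  have hfg : ∀ z z', f z = f z' ↔ g z = g z' := by
    rintro (y | y) (y' | y')
    · constructor
      · intro heq
        have heq' : (y : V → ℝ) ∘ σ = (y' : V → ℝ) ∘ σ := congrArg Subtype.val heq
        refine Subtype.ext ?_
        change (y : V → ℝ) = y'
        rw [← extend_comp_eq h.left_injective hcovσd y.2, heq',
          extend_comp_eq h.left_injective hcovσd y'.2]
      · intro heq
        have heq' : (g (Sum.inl y) : V → ℝ) = g (Sum.inl y') := congrArg Subtype.val heq
        rw [Subtype.ext (show (y : V → ℝ) = y' from heq')]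
    · exact hmix y y'
    · rw [eq_comm, hmix y' y, eq_comm]
    · constructor
      · intro heq
        have heq' : (y : V → ℝ) ∘ τ = (y' : V → ℝ) ∘ τ := congrArg Subtype.val heq
        have : y = y' := Subtype.ext (by
          rw [← extend_comp_eq h.right_injective hcovτd y.2, heq',
            extend_comp_eq h.right_injective hcovτd y'.2])
        rw [this]
      · intro heq
        rw [β.injective (hζi heq)]
  obtain ⟨e, -⟩ := exists_homeomorph_of_same_fibers hf hg hfs hgs hfg
  exact ⟨e⟩

/-- A face inside the common link is covered by the gluing of two balls. Any other face has a vertex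
off the common link whose neighbourhood cannot meet both links, so the link of the face is a link of
N seen through one section. -/
theorem link_sphere (h : IsStarGluing N Q v u σ τ) {d : ℕ} (hN : N.IsSimplicialManifold d)
    {s : Finset X} (hs : s ∈ Q.faces) : s.card ≤ d + 1 ∧ Nonempty ((Q.link s).realization ≃ₜ
      Metric.sphere (0 : EuclideanSpace ℝ (Fin (d + 1 - s.card))) 1) := by
  classical
  have key : ∀ ρ : X → V, Function.Injective ρ → s.image ρ ∈ N.faces ∧
      Nonempty ((Q.link s).realization ≃ₜ (N.link (s.image ρ)).realization) →
      s.card ≤ d + 1 ∧ Nonempty ((Q.link s).realization ≃ₜ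
        Metric.sphere (0 : EuclideanSpace ℝ (Fin (d + 1 - s.card))) 1) := by
    rintro ρ hρ ⟨h1, ⟨e⟩⟩
    obtain ⟨e'⟩ := hN.link_sphere _ h1
    have h2 := hN.card_le _ h1
    rw [Finset.card_image_of_injective _ hρ] at h2 e'
    exact ⟨h2, ⟨e.trans e'⟩⟩
  by_cases hadj : ∀ x ∈ s, N.skeletonGraph.Adj v (σ x)
  · exact key σ h.left_injective (h.nonempty_link_homeomorph_of_adj hN hs hadj)
  · push Not at hadj
    obtain ⟨a, ha, hva⟩ := hadj
    by_cases hnu : ∀ b, N.Near (σ a) b → ¬ N.skeletonGraph.Adj u b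
    · exact key σ h.left_injective (h.nonempty_link_homeomorph_of_not_adj hs ha hva hnu)
    · push Not at hnu
      obtain ⟨b, hb, hub⟩ := hnu
      refine key τ h.right_injective (h.symm.nonempty_link_homeomorph_of_not_adj hs ha
        (mt (h.adj_iff a).2 hva) fun c hc hvc => ?_)
      rw [← h.eq_of_not_adj a hva] at hc
      exact h.far_four (Or.inr hvc) hc.symm hb (Or.inr hub.symm)

theorem finite_faces (h : IsStarGluing N Q v u σ τ) (hfin : N.faces.Finite) : Q.faces.Finite := by
  classical
  have h1 : ∀ ρ : X → V, Function.Injective ρ → {s : Finset X | s.image ρ ∈ N.faces}.Finite :=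
    fun ρ hρ => hfin.preimage (Finset.image_injective hρ).injOn
  refine ((h1 σ h.left_injective).union (h1 τ h.right_injective)).subset fun s hs => ?_
  rcases (h.mem_faces_iff s).1 hs with h2 | h2
  · exact Or.inl (show s.image σ ∈ N.faces by convert h2.1)
  · exact Or.inr (show s.image τ ∈ N.faces by convert h2.1)

end IsStarGluing

/-- The open stars of the vertices cover the realization, and each is the open cone over a sphere,
that is, a Euclidean space. -/
theorem isClosedTopManifold_of_link {V : Type*} {K : PreAbstractSimplicialComplex V} {d : ℕ}
    (hfin : K.faces.Finite) (hlink : ∀ p ∈ K.vertexSet, Nonempty ((K.link {p}).realization ≃ₜ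
      Metric.sphere (0 : EuclideanSpace ℝ (Fin d)) 1)) : IsClosedTopManifold d K.realization := by
  obtain ⟨F, hF⟩ := exists_supportedOn hfin
  have hchart : ∀ x : K.realization, ∃ e : EuclideanSpace ℝ (Fin d) → K.realization,
      IsOpenEmbedding e ∧ x ∈ range e := by
    intro x
    obtain ⟨p, hp⟩ := exists_pos_of_mem_realization x.2
    have hpK := mem_vertexSet_of_pos (mem_coneSet_of_mem_realization x.2) hp
    obtain ⟨ψ⟩ := hlink p hpK
    obtain ⟨e, he, hr, -⟩ := exists_star_embedding hF hfin hpK ψ.symm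
    exact ⟨e, he, by rw [hr]; exact hp⟩
  choose e he hx using hchart
  refine ⟨inferInstance, isCompact_iff_compactSpace.1 (isCompact_realization hfin), ⟨?_⟩⟩
  exact
    { atlas := range fun x => ((he x).toOpenPartialHomeomorph (e x)).symm
      chartAt := fun x => ((he x).toOpenPartialHomeomorph (e x)).symm
      mem_chart_source := fun x => by simpa using hx x
      chart_mem_atlas := fun x => ⟨x, rfl⟩ }

theorem IsStarGluing.isSimplicialManifold {V X : Type*} {N : PreAbstractSimplicialComplex V}
    {Q : PreAbstractSimplicialComplex X} {v u : V} {σ τ : X → V} (h : IsStarGluing N Q v u σ τ)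
    {d : ℕ} (hN : N.IsSimplicialManifold d) : Q.IsSimplicialManifold d := by
  have hfin := h.finite_faces hN.finite
  refine ⟨hfin, isClosedTopManifold_of_link hfin fun p hp => ?_,
    fun s hs => (h.link_sphere hN hs).1, fun s hs => (h.link_sphere hN hs).2⟩
  have := (h.link_sphere hN hp).2
  rwa [Finset.card_singleton] at this

end PreAbstractSimplicialComplex

/-! ### Orientation of the glued complex. -/

namespace PreAbstractSimplicialComplex

namespace IsStarGluing

variable {V X : Type*} {N : PreAbstractSimplicialComplex V} {Q : PreAbstractSimplicialComplex X}
  {v u : V} {σ τ : X → V}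

theorem side_right_of_not_adj (h : IsStarGluing N Q v u σ τ) {s : Finset X}
    (hs : N.Side v u σ s) (hadj : ∀ x ∈ s, ¬ N.skeletonGraph.Adj v (σ x)) : N.Side v u τ s := by
  rw [h.side_iff] at hs
  rw [h.side_right_iff]
  exact ⟨hs.1, hs.2.1, fun x hx y hy =>
    (h.near_iff_of_not_adj (hadj x hx) (hadj y hy)).1 (hs.2.2 x hx y hy)⟩

/-- A further vertex outside the common link would be near the link of `v` on one side and near the
link of `u` on the other. -/
theorem adj_of_side_of_side (h : IsStarGluing N Q v u σ τ) {s : Finset X}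
    (h1 : N.Side v u σ s) (h2 : N.Side v u τ s) {a : X} (ha : a ∈ s)
    (hva : N.skeletonGraph.Adj v (σ a)) : ∀ x ∈ s, N.skeletonGraph.Adj v (σ x) := by
  classical
  have hs : {a} ∪ s = s := Finset.union_eq_right.2 (Finset.singleton_subset_iff.2 ha)
  have := h.mem_link_link_of_both (s := {a}) (t := s) (Finset.singleton_nonempty a)
    (by simpa using hva) (by rwa [hs]) (by rwa [hs])
  rwa [hs] at this

section Orientation

theorem isOrderedFace_comp [DecidableEq X] {ρ : X → V} (hρ : Function.Injective ρ) {n : ℕ}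
    {x : Fin n → X} (hx : Function.Injective x) (hs : N.Side v u ρ (Finset.univ.image x)) :
    N.IsOrderedFace (ρ ∘ x) := by
  classical
  refine ⟨hρ.comp hx, _, hs.1, ?_⟩
  ext w
  simp

theorem side_of_isOrderedFace [DecidableEq X] (h : IsStarGluing N Q v u σ τ) {n : ℕ}
    {x : Fin n → X} (hx : Q.IsOrderedFace x) :
    N.Side v u σ (Finset.univ.image x) ∨ N.Side v u τ (Finset.univ.image x) := by
  obtain ⟨-, s, hs, hsx⟩ := hx
  have : s = Finset.univ.image x := by
    rw [← Finset.coe_inj, hsx]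
    simp
  rw [← h.mem_faces_iff, ← this]
  exact hs

open scoped Classical in
/-- The sign of an ordered face of the glued complex, read off on one of the two sides. -/
noncomputable def glueSign {d : ℕ} (o : N.Orientation d) (v u : V) (σ τ : X → V)
    (x : Fin (d + 1) → X) : ℤˣ :=
  if N.Side v u σ (Finset.univ.image x) then o.sign (σ ∘ x) else o.sign (τ ∘ x)

variable {d : ℕ}

theorem glueSign_left [DecidableEq X] (o : N.Orientation d) {x : Fin (d + 1) → X}
    (hx : N.Side v u σ (Finset.univ.image x)) : glueSign o v u σ τ x = o.sign (σ ∘ x) := by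
  rw [glueSign, if_pos (by convert hx)]

/-- The sign does not depend on the side. A facet on both sides that touched the common link would
lie in it, and adding `v` would give a face of too many vertices; so both sections agree on the
facet. -/
theorem glueSign_right [DecidableEq X] (h : IsStarGluing N Q v u σ τ) (o : N.Orientation d)
    (hdim : ∀ s ∈ N.faces, s.card ≤ d + 1) {x : Fin (d + 1) → X} (hinj : Function.Injective x)
    (hx : N.Side v u τ (Finset.univ.image x)) : glueSign o v u σ τ x = o.sign (τ ∘ x) := by
  classical
  by_cases hx' : N.Side v u σ (Finset.univ.image x)
  · rw [glueSign_left o (by convert hx')]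
    congr 1
    funext i
    refine h.eq_of_not_adj _ fun hadj => ?_
    have hall := h.adj_of_side_of_side (by convert hx') (by convert hx)
      (Finset.mem_image_of_mem x (Finset.mem_univ i)) hadj
    have hl := (h.mem_link_left_iff hall).2 ⟨(Finset.univ_nonempty).image x,
      (h.side_iff.1 (by convert hx')).2.2⟩
    rw [mem_link_singleton_faces] at hl
    have hc := hdim _ hl.2.2
    rw [Finset.card_insert_of_notMem hl.2.1, Finset.card_image_of_injective _ h.left_injective,
      Finset.card_image_of_injective _ hinj, Finset.card_univ, Fintype.card_fin] at hc
    omega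
  · rw [glueSign, if_neg (by convert hx')]

theorem isOrderedFace_cons {y : Fin d → X}
    (hl : (N.link {v}).IsOrderedFace (σ ∘ y)) :
    N.IsOrderedFace (Fin.cons v (σ ∘ y) : Fin (d + 1) → V) := by
  classical
  obtain ⟨hinj, s, hs, hsx⟩ := hl
  rw [mem_link_singleton_faces] at hs
  have hmem : ∀ i, σ (y i) ∈ s := fun i => by
    rw [← Finset.mem_coe, hsx]
    exact ⟨i, rfl⟩
  refine ⟨?_, _, hs.2.2, ?_⟩
  · rw [Fin.cons_injective_iff]
    refine ⟨?_, hinj⟩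
    rintro ⟨i, hi⟩
    exact hs.2.1 (hi ▸ hmem i)
  · rw [Fin.range_cons, Finset.coe_insert, hsx]

/-- If one of the facets lives on both sides, coherence in N suffices. Otherwise the ridge lies in
the common link: in N the u-side facet is compared with the one through `u`, the v-side facet with
the one through `v`, and the reversal hypothesis links these two. Three sign changes leave one. -/
theorem glueSign_coherent [DecidableEq X] (h : IsStarGluing N Q v u σ τ) (hd : 0 < d)
    (o : N.Orientation d) (hdim : ∀ s ∈ N.faces, s.card ≤ d + 1)
    (hrev : ∀ y : Fin d → X, (N.link {v}).IsOrderedFace (σ ∘ y) →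
      o.sign (Fin.cons u (τ ∘ y)) = -o.sign (Fin.cons v (σ ∘ y)))
    {a b : X} {y : Fin d → X} (hab : a ≠ b)
    (hai : Function.Injective (Fin.cons a y : Fin (d + 1) → X))
    (hbi : Function.Injective (Fin.cons b y : Fin (d + 1) → X))
    (ha : N.Side v u σ (Finset.univ.image (Fin.cons a y : Fin (d + 1) → X)))
    (hb : N.Side v u τ (Finset.univ.image (Fin.cons b y : Fin (d + 1) → X))) :
    glueSign o v u σ τ (Fin.cons b y) = -glueSign o v u σ τ (Fin.cons a y) := by
  classical
  have hmem : ∀ (c : X) (i : Fin d),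
      y i ∈ Finset.univ.image (Fin.cons c y : Fin (d + 1) → X) := fun c i =>
    Finset.mem_image.2 ⟨i.succ, Finset.mem_univ _, by simp⟩
  have hmem0 : ∀ c : X, c ∈ Finset.univ.image (Fin.cons c y : Fin (d + 1) → X) := fun c =>
    Finset.mem_image.2 ⟨0, Finset.mem_univ _, by simp⟩
  have hsame : ∀ ρ : X → V, Function.Injective ρ →
      N.Side v u ρ (Finset.univ.image (Fin.cons a y : Fin (d + 1) → X)) →
      N.Side v u ρ (Finset.univ.image (Fin.cons b y : Fin (d + 1) → X)) →
      o.sign (ρ ∘ (Fin.cons b y : Fin (d + 1) → X)) =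
        -o.sign (ρ ∘ (Fin.cons a y : Fin (d + 1) → X)) := by
    intro ρ hρ h1 h2
    have h3 := isOrderedFace_comp hρ hai h1
    have h4 := isOrderedFace_comp hρ hbi h2
    rw [Fin.comp_cons] at h3 h4 ⊢
    rw [Fin.comp_cons]
    exact o.coherent _ _ _ (hρ.ne hab) h3 h4
  by_cases ha' : N.Side v u τ (Finset.univ.image (Fin.cons a y : Fin (d + 1) → X))
  · rw [h.glueSign_right o hdim hai ha', h.glueSign_right o hdim hbi hb]
    exact hsame τ h.right_injective ha' hb
  by_cases hb' : N.Side v u σ (Finset.univ.image (Fin.cons b y : Fin (d + 1) → X))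
  · rw [glueSign_left o ha, glueSign_left o hb']
    exact hsame σ h.left_injective ha hb'
  have hyadj : ∀ i, N.skeletonGraph.Adj v (σ (y i)) := by
    intro i
    by_contra hn
    have h1 : ∃ c ∈ Finset.univ.image (Fin.cons a y : Fin (d + 1) → X),
        N.skeletonGraph.Adj v (σ c) := by
      by_contra hcon
      push Not at hcon
      exact ha' (h.side_right_of_not_adj ha hcon)
    have h2 : ∃ c ∈ Finset.univ.image (Fin.cons b y : Fin (d + 1) → X),
        N.skeletonGraph.Adj u (τ c) := by
      by_contra hcon
      push Not at hcon
      exact hb' (h.symm.side_right_of_not_adj hb.swap hcon).swap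
    obtain ⟨c, hc, hvc⟩ := h1
    obtain ⟨c', hc', huc⟩ := h2
    have h3 := (h.side_iff.1 ha).2.2 c hc _ (hmem a i)
    have h4 := (h.side_right_iff.1 hb).2.2 c' hc' _ (hmem b i)
    rw [← h.eq_of_not_adj _ hn] at h4
    exact h.far_four (Or.inr hvc) h3 h4.symm (Or.inr huc.symm)
  have hyinj : Function.Injective y := (Fin.cons_injective_iff.1 hai).2
  have hne : (Finset.univ.image y).Nonempty := by
    have : Nonempty (Fin d) := ⟨⟨0, hd⟩⟩
    exact Finset.univ_nonempty.image y
  have hall : ∀ z ∈ Finset.univ.image y, N.skeletonGraph.Adj v (σ z) := by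
    intro z hz
    obtain ⟨i, -, rfl⟩ := Finset.mem_image.1 hz
    exact hyadj i
  have hl : (N.link {v}).IsOrderedFace (σ ∘ y) := by
    refine ⟨h.left_injective.comp hyinj, _, (h.mem_link_left_iff hall).2 ⟨hne, ?_⟩, by ext; simp⟩
    intro z hz w hw
    obtain ⟨i, -, rfl⟩ := Finset.mem_image.1 hz
    obtain ⟨j, -, rfl⟩ := Finset.mem_image.1 hw
    exact (h.side_iff.1 ha).2.2 _ (hmem a i) _ (hmem a j)
  have hl' : (N.link {u}).IsOrderedFace (τ ∘ y) := by
    refine ⟨h.right_injective.comp hyinj, _, (h.symm.mem_link_left_iff fun z hz =>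
      (h.adj_iff z).1 (hall z hz)).2 ⟨hne, ?_⟩, by ext; simp⟩
    intro z hz w hw
    obtain ⟨i, -, rfl⟩ := Finset.mem_image.1 hz
    obtain ⟨j, -, rfl⟩ := Finset.mem_image.1 hw
    exact (h.side_right_iff.1 hb).2.2 _ (hmem b i) _ (hmem b j)
  have h1 := isOrderedFace_comp h.left_injective hai ha
  have h2 := isOrderedFace_comp h.right_injective hbi hb
  rw [glueSign_left o ha, h.glueSign_right o hdim hbi hb, Fin.comp_cons, Fin.comp_cons]
  rw [Fin.comp_cons] at h1 h2
  rw [o.coherent u (τ b) _ (hb.2 b (hmem0 b)).2.symm (isOrderedFace_cons hl') h2,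
    hrev y hl, neg_neg, o.coherent (σ a) v _ (ha.2 a (hmem0 a)).1 h1 (isOrderedFace_cons hl)]

theorem isOrientable (h : IsStarGluing N Q v u σ τ) (hd : 0 < d)
    (o : N.Orientation d) (hdim : ∀ s ∈ N.faces, s.card ≤ d + 1)
    (hrev : ∀ y : Fin d → X, (N.link {v}).IsOrderedFace (σ ∘ y) →
      o.sign (Fin.cons u (τ ∘ y)) = -o.sign (Fin.cons v (σ ∘ y))) : Q.IsOrientable d := by
  classical
  refine ⟨⟨glueSign o v u σ τ, ?_, ?_⟩⟩
  · intro x hx π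
    have himg : Finset.univ.image (x ∘ π) = Finset.univ.image x := by
      rw [← Finset.image_image, Finset.image_univ_equiv]
    have hinj : Function.Injective (x ∘ π) := hx.1.comp π.injective
    rcases h.side_of_isOrderedFace hx with h1 | h1
    · rw [glueSign_left o h1, glueSign_left o (by rwa [himg]), ← Function.comp_assoc]
      exact o.sign_comp_perm _ (isOrderedFace_comp h.left_injective hx.1 h1) π
    · rw [h.glueSign_right o hdim hx.1 h1, h.glueSign_right o hdim hinj (by rwa [himg]),
        ← Function.comp_assoc]
      exact o.sign_comp_perm _ (isOrderedFace_comp h.right_injective hx.1 h1) π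
  · intro a b y hab ha hb
    have hsame : ∀ ρ : X → V, Function.Injective ρ →
        N.Side v u ρ (Finset.univ.image (Fin.cons a y : Fin (d + 1) → X)) →
        N.Side v u ρ (Finset.univ.image (Fin.cons b y : Fin (d + 1) → X)) →
        o.sign (ρ ∘ (Fin.cons b y : Fin (d + 1) → X)) =
          -o.sign (ρ ∘ (Fin.cons a y : Fin (d + 1) → X)) := by
      intro ρ hρ h1 h2
      have h3 := isOrderedFace_comp hρ ha.1 h1
      have h4 := isOrderedFace_comp hρ hb.1 h2
      rw [Fin.comp_cons] at h3 h4 ⊢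
      rw [Fin.comp_cons]
      exact o.coherent _ _ _ (hρ.ne hab) h3 h4
    rcases h.side_of_isOrderedFace ha with h1 | h1 <;>
      rcases h.side_of_isOrderedFace hb with h2 | h2
    · rw [glueSign_left o h1, glueSign_left o h2]
      exact hsame σ h.left_injective h1 h2
    · exact h.glueSign_coherent hd o hdim hrev hab ha.1 hb.1 h1 h2
    · rw [h.glueSign_coherent hd o hdim hrev hab.symm hb.1 ha.1 h2 h1, neg_neg]
    · rw [h.glueSign_right o hdim ha.1 h1, h.glueSign_right o hdim hb.1 h2]
      exact hsame τ h.right_injective h1 h2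

end Orientation

end IsStarGluing

/-! ### The Euler characteristic of the glued complex. -/

section Euler

/-- The faces through `v` are the vertex itself, contributing 1, and the faces of the link with `v`
added, each of which changes the sign. -/
theorem eulerChar_eq_deletion {V : Type*} {K : PreAbstractSimplicialComplex V} {v : V}
    (hfin : K.faces.Finite) (hv : v ∈ K.vertexSet) :
    K.eulerChar = (K.deletion v).eulerChar + 1 - (K.link {v}).eulerChar := by
  classical
  have hsplit : K.faces = (K.deletion v).faces ∪ ({{v}} ∪ insert v '' (K.link {v}).faces) := by
    ext s
    constructor
    · intro hs
      by_cases hvs : v ∈ s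
      · right
        by_cases hs1 : s = {v}
        · exact Or.inl hs1
        · refine Or.inr ⟨s.erase v, mem_link_singleton_faces.2 ⟨?_, Finset.notMem_erase _ _, ?_⟩,
            Finset.insert_erase hvs⟩
          · rw [Finset.nonempty_iff_ne_empty]
            intro he
            rw [Finset.erase_eq_empty_iff] at he
            rcases he with he | he
            · simp [he] at hvs
            · exact hs1 he
          · rwa [Finset.insert_erase hvs]
      · exact Or.inl ⟨hs, hvs⟩
    · rintro (hs | rfl | ⟨t, ht, rfl⟩)
      · exact hs.1
      · exact hv
      · exact (mem_link_singleton_faces.1 ht).2.2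
  have hd1 : Disjoint (K.deletion v).faces ({{v}} ∪ insert v '' (K.link {v}).faces) := by
    rw [Set.disjoint_left]
    rintro s hs (rfl | ⟨t, ht, rfl⟩)
    · exact hs.2 (Finset.mem_singleton_self v)
    · exact hs.2 (Finset.mem_insert_self v t)
  have hd2 : Disjoint ({{v}} : Set (Finset V)) (insert v '' (K.link {v}).faces) := by
    rw [Set.disjoint_left]
    rintro s rfl ⟨t, ht, hts⟩
    rw [mem_link_singleton_faces] at ht
    obtain ⟨a, ha⟩ := ht.1
    have hav : a ∈ ({v} : Finset V) := hts ▸ Finset.mem_insert_of_mem ha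
    rw [Finset.mem_singleton] at hav
    exact ht.2.1 (hav ▸ ha)
  have hfl := finite_link hfin {v}
  rw [eulerChar, hsplit, finsum_mem_union hd1 (finite_deletion hfin v)
    ((Set.finite_singleton _).union (hfl.image _)), finsum_mem_union hd2 (Set.finite_singleton _)
    (hfl.image _), finsum_mem_singleton, finsum_mem_image, eulerChar, eulerChar]
  · have : ∑ᶠ s ∈ (K.link {v}).faces, (-1 : ℤ) ^ ((insert v s).card + 1) =
        -∑ᶠ s ∈ (K.link {v}).faces, (-1 : ℤ) ^ (s.card + 1) := by
      rw [← finsum_mem_neg_distrib _ hfl]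
      refine finsum_mem_congr rfl fun s hs => ?_
      rw [Finset.card_insert_of_notMem (mem_link_singleton_faces.1 hs).2.1, pow_succ]
      ring
    rw [this, Finset.card_singleton]
    ring
  · intro s hs t ht hst
    rw [← Finset.erase_insert (mem_link_singleton_faces.1 hs).2.1,
      ← Finset.erase_insert (mem_link_singleton_faces.1 ht).2.1]
    exact congrArg (fun r => Finset.erase r v) hst

theorem deletion_eq_self {V : Type*} {K : PreAbstractSimplicialComplex V} {v : V}
    (hv : v ∉ K.vertexSet) : K.deletion v = K :=
  PreAbstractSimplicialComplex.ext (Set.ext fun _ =>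
    ⟨And.left, fun hs => ⟨hs, fun h => hv (mem_vertexSet_of_mem hs h)⟩⟩)

namespace IsStarGluing

variable {V X : Type*} {N : PreAbstractSimplicialComplex V} {Q : PreAbstractSimplicialComplex X}
  {v u : V} {σ τ : X → V}

theorem eulerChar_eq_deletion_deletion (h : IsStarGluing N Q v u σ τ) (hfin : N.faces.Finite) :
    N.eulerChar = ((N.deletion v).deletion u).eulerChar + 2 - (N.link {v}).eulerChar -
      (N.link {u}).eulerChar := by
  have hne : u ≠ v := fun huv => h.not_near (Or.inl huv.symm)
  have hu : u ∈ (N.deletion v).vertexSet := ⟨h.mem_right, by simpa using hne.symm⟩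
  have hd : (N.link {u}).deletion v = N.link {u} := deletion_eq_self (by
    rw [← adj_iff_mem_link]
    exact fun hadj => h.not_near (Or.inr hadj.symm))
  rw [eulerChar_eq_deletion hfin h.mem_left, eulerChar_eq_deletion (finite_deletion hfin v) hu,
    deletion_link_singleton hne, hd]
  ring

/-- Inclusion and exclusion over the two sides. In the quotient the overlap consists of the faces
off the common link and those inside it. In N without `v` and `u` only the former are shared, since
the two copies of the link are distinct there. The difference is one copy of the link. -/
theorem eulerChar_eq (h : IsStarGluing N Q v u σ τ) (hfin : N.faces.Finite) :
    Q.eulerChar = ((N.deletion v).deletion u).eulerChar - (N.link {v}).eulerChar := by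
  classical
  let A : Set (Finset X) := {s | N.Side v u σ s}
  let B : Set (Finset X) := {s | N.Side v u τ s}
  let C : Set (Finset X) := {s | N.Side v u σ s ∧ ∀ x ∈ s, ¬ N.skeletonGraph.Adj v (σ x)}
  let D : Set (Finset X) := {s | N.Side v u σ s ∧ ∀ x ∈ s, N.skeletonGraph.Adj v (σ x)}
  have hfinQ := h.finite_faces hfin
  have hQ : Q.faces = A ∪ B := Set.ext fun s => h.mem_faces_iff s
  have hA : A.Finite := hfinQ.subset (hQ ▸ subset_union_left)
  have hB : B.Finite := hfinQ.subset (hQ ▸ subset_union_right)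
  have hC : C.Finite := hA.subset fun s hs => hs.1
  have hD : D.Finite := hA.subset fun s hs => hs.1
  have hAB : A ∩ B = C ∪ D := by
    ext s
    constructor
    · rintro ⟨h1, h2⟩
      by_cases hs : ∀ x ∈ s, ¬ N.skeletonGraph.Adj v (σ x)
      · exact Or.inl ⟨h1, hs⟩
      · push Not at hs
        obtain ⟨a, ha, hva⟩ := hs
        exact Or.inr ⟨h1, h.adj_of_side_of_side h1 h2 ha hva⟩
    · rintro (⟨h1, h2⟩ | ⟨h1, h2⟩)
      · exact ⟨h1, h.side_right_of_not_adj h1 h2⟩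
      · exact ⟨h1, (h.side_both_iff h2).1 h1⟩
  have hCD : Disjoint C D := by
    rw [Set.disjoint_left]
    rintro s ⟨h1, h2⟩ ⟨-, h3⟩
    obtain ⟨a, ha⟩ := (h.side_iff.1 h1).1
    exact h2 a ha (h3 a ha)
  have himg : ∀ (ρ : X → V) (S : Set (Finset X)), Function.Injective ρ →
      ∑ᶠ s ∈ S, (-1 : ℤ) ^ (s.card + 1) =
        ∑ᶠ s ∈ Finset.image ρ '' S, (-1 : ℤ) ^ (s.card + 1) := by
    intro ρ S hρ
    rw [finsum_mem_image (Finset.image_injective hρ).injOn]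
    refine finsum_mem_congr rfl fun s _ => ?_
    rw [Finset.card_image_of_injective _ hρ]
  have hpre : ∀ (ρ : X → V) (f : Finset V), Function.Injective ρ → (∀ w ∈ f, ∃ x, ρ x = w) →
      ∃ s : Finset X, s.image ρ = f := by
    intro ρ f hρ hf
    refine ⟨f.preimage ρ hρ.injOn, ?_⟩
    ext w
    rw [Finset.mem_image]
    constructor
    · rintro ⟨x, hx, rfl⟩
      exact Finset.mem_preimage.1 hx
    · intro hw
      obtain ⟨x, rfl⟩ := hf w hw
      exact ⟨x, Finset.mem_preimage.2 hw, rfl⟩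
  have hM : ((N.deletion v).deletion u).faces = Finset.image σ '' A ∪ Finset.image τ '' B := by
    have hside : ∀ (ρ : X → V) (s : Finset X), s.image ρ ∈ ((N.deletion v).deletion u).faces ↔
        N.Side v u ρ s := by
      intro ρ s
      constructor
      · rintro ⟨⟨h1, h2⟩, h3⟩
        exact ⟨h1, fun x hx => ⟨fun hxv => h2 (hxv ▸ Finset.mem_image_of_mem ρ hx),
          fun hxu => h3 (hxu ▸ Finset.mem_image_of_mem ρ hx)⟩⟩
      · rintro ⟨h1, h2⟩
        refine ⟨⟨h1, fun hm => ?_⟩, fun hm => ?_⟩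
        · obtain ⟨x, hx, hxv⟩ := Finset.mem_image.1 hm
          exact (h2 x hx).1 hxv
        · obtain ⟨x, hx, hxv⟩ := Finset.mem_image.1 hm
          exact (h2 x hx).2 hxv
    ext f
    constructor
    · intro hf
      by_cases hfu : ∀ w ∈ f, ¬ N.skeletonGraph.Adj u w
      · obtain ⟨s, rfl⟩ := hpre σ f h.left_injective fun w hw => h.cover_left w (hfu w hw)
        exact Or.inl ⟨s, (hside σ s).1 hf, rfl⟩
      · push Not at hfu
        obtain ⟨b, hb, hub⟩ := hfu
        obtain ⟨s, rfl⟩ := hpre τ f h.right_injective fun w hw => h.cover_right w fun hvw =>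
          h.far_four (Or.inr hvw) (near_of_mem hf.1.1 hw hb) (Or.inr hub.symm) (Near.refl _)
        exact Or.inr ⟨s, (hside τ s).1 hf, rfl⟩
    · rintro (⟨s, hs, rfl⟩ | ⟨s, hs, rfl⟩)
      · exact (hside σ s).2 hs
      · exact (hside τ s).2 hs
  have hMi : Finset.image σ '' A ∩ Finset.image τ '' B = Finset.image σ '' C := by
    ext f
    constructor
    · rintro ⟨⟨s, hs, rfl⟩, t, ht, hts⟩
      refine ⟨s, ⟨hs, fun x hx hvx => ?_⟩, rfl⟩
      have hxt : σ x ∈ t.image τ := hts ▸ Finset.mem_image_of_mem σ hx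
      obtain ⟨z, -, hz⟩ := Finset.mem_image.1 hxt
      exact h.not_adj_right z (hz ▸ hvx)
    · rintro ⟨s, ⟨h1, h2⟩, rfl⟩
      refine ⟨⟨s, h1, rfl⟩, s, h.side_right_of_not_adj h1 h2, ?_⟩
      exact Finset.image_congr fun x hx => (h.eq_of_not_adj x (h2 x hx)).symm
  have hlink : (N.link {v}).faces = Finset.image σ '' D := by
    ext f
    constructor
    · intro hf
      have hadj : ∀ w ∈ f, N.skeletonGraph.Adj v w := fun w hw =>
        adj_iff_mem_link.2 (mem_vertexSet_of_mem hf hw)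
      obtain ⟨s, rfl⟩ := hpre σ f h.left_injective fun w hw => h.cover_left w fun huw =>
        h.far_four (Or.inr (hadj w hw)) (Or.inr huw.symm) (Near.refl _) (Near.refl _)
      have hs : ∀ x ∈ s, N.skeletonGraph.Adj v (σ x) := fun x hx =>
        hadj _ (Finset.mem_image_of_mem σ hx)
      have hl := (h.mem_link_left_iff hs).1 hf
      exact ⟨s, ⟨h.side_iff.2 ⟨hl.1, fun x hx => h.good_of_adj (hs x hx), hl.2⟩, hs⟩, rfl⟩
    · rintro ⟨s, ⟨h1, h2⟩, rfl⟩
      have h3 := h.side_iff.1 h1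
      exact (h.mem_link_left_iff h2).2 ⟨h3.1, h3.2.2⟩
  have e1 := finsum_mem_union_inter (f := fun s : Finset X => (-1 : ℤ) ^ (s.card + 1)) hA hB
  have e2 := finsum_mem_union_inter (f := fun s : Finset V => (-1 : ℤ) ^ (s.card + 1))
    (hA.image (Finset.image σ)) (hB.image (Finset.image τ))
  have e3 := finsum_mem_union (f := fun s : Finset X => (-1 : ℤ) ^ (s.card + 1)) hCD hC hD
  rw [hAB, e3] at e1
  rw [hMi, ← hM, ← himg τ B h.right_injective, ← himg σ A h.left_injective,
    ← himg σ C h.left_injective] at e2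
  rw [eulerChar, eulerChar, eulerChar, hQ, hlink, ← himg σ D h.left_injective]
  linarith

end IsStarGluing

end Euler

end PreAbstractSimplicialComplex

/-! ### The hollow handle. -/

namespace PreAbstractSimplicialComplex

/-- The links of the neighbours of `v` are spheres with `v` as a vertex, so deleting `v` from them
leaves the balls that the collar construction needs. -/
theorem IsSimplicialManifold.exists_collar {V : Type*} {N : PreAbstractSimplicialComplex V} {d : ℕ}
    (hN : N.IsSimplicialManifold d) {v : V} (hv : v ∈ N.vertexSet) :
    ∃ H : N.realization ≃ₜ N.realization,
      (∀ x : N.realization, (∀ p ∈ (N.link {v}).vertexSet, (x : V → ℝ) p = 0) → H x = x) ∧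
      (∀ x : N.realization, (x : V → ℝ) ∈ (N.link {v}).realization →
        (H x : V → ℝ) = push v 1 x) ∧
      ∀ x : N.realization, (x : V → ℝ) v = 0 ↔ (H x : V → ℝ) v ≤ 1 / 2 := by
  obtain ⟨F, hF⟩ := exists_supportedOn hN.finite
  refine PreAbstractSimplicialComplex.exists_collar hF hN.finite hv fun p hp => ?_
  have hS := hN.isSphereComplex_link (link_faces_subset hp)
  rw [Finset.card_singleton, Nat.add_sub_cancel] at hS
  have hvp := mem_link_vertexSet_comm.1 hp
  have hd := hS.card_le hvp
  rw [Finset.card_singleton] at hd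
  obtain ⟨m, rfl⟩ : ∃ m, d = m + 1 := ⟨d - 1, by omega⟩
  exact ⟨m, hS.exists_ball hvp⟩

/-- Pushing forward barycentric coordinates to a star gluing. -/
noncomputable def foldMap {V X : Type*} (N : PreAbstractSimplicialComplex V) (v : V) (σ τ : X → V)
    (x : V → ℝ) (q : X) : ℝ :=
  open scoped Classical in
  if N.skeletonGraph.Adj v (σ q) then x (σ q) + x (τ q) else x (σ q)

theorem continuous_foldMap {V X : Type*} (N : PreAbstractSimplicialComplex V) (v : V)
    (σ τ : X → V) : Continuous (foldMap N v σ τ) := by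
  refine continuous_pi fun q => ?_
  by_cases h : N.skeletonGraph.Adj v (σ q)
  · simp only [foldMap, if_pos h]
    fun_prop
  · simp only [foldMap, if_neg h]
    fun_prop

namespace IsStarGluing

variable {V X : Type*} {N : PreAbstractSimplicialComplex V} {Q : PreAbstractSimplicialComplex X}
  {v u : V} {σ τ : X → V}

section Fold

variable {x x' : V → ℝ}

theorem foldMap_left (h : IsStarGluing N Q v u σ τ)
    (hx : ∀ w, N.skeletonGraph.Adj u w → x w = 0) : foldMap N v σ τ x = x ∘ σ := by
  funext q
  by_cases hq : N.skeletonGraph.Adj v (σ q)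
  · rw [foldMap, if_pos hq, hx _ ((h.adj_iff q).1 hq), add_zero, Function.comp_apply]
  · rw [foldMap, if_neg hq, Function.comp_apply]

theorem foldMap_right (h : IsStarGluing N Q v u σ τ)
    (hx : ∀ w, N.skeletonGraph.Adj v w → x w = 0) : foldMap N v σ τ x = x ∘ τ := by
  funext q
  by_cases hq : N.skeletonGraph.Adj v (σ q)
  · rw [foldMap, if_pos hq, hx _ hq, zero_add, Function.comp_apply]
  · rw [foldMap, if_neg hq, Function.comp_apply, h.eq_of_not_adj q hq]

theorem near_of_ne_zero (hx : x ∈ N.realization) {a b : V} (ha : x a ≠ 0) (hb : x b ≠ 0) :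
    N.Near a b := by
  obtain ⟨-, s, hs, hxs, -⟩ := hx
  refine near_of_mem hs ?_ ?_
  · by_contra hn; exact ha (hxs a hn)
  · by_contra hn; exact hb (hxs b hn)

/-- The support of a point is a clique, and a clique that met both links would connect `v` to `u` in
three steps. -/
theorem left_or_right (h : IsStarGluing N Q v u σ τ) (hx : x ∈ N.realization) :
    (∀ w, N.skeletonGraph.Adj u w → x w = 0) ∨ ∀ w, N.skeletonGraph.Adj v w → x w = 0 := by
  by_contra hn
  push Not at hn
  obtain ⟨⟨a, hua, ha⟩, b, hvb, hb⟩ := hn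
  exact h.far_four (Or.inr hvb) (near_of_ne_zero hx hb ha) (Or.inr hua.symm) (Near.refl _)

theorem exists_support_left (h : IsStarGluing N Q v u σ τ) (hx : x ∈ N.realization)
    (hxu : ∀ w, N.skeletonGraph.Adj u w → x w = 0) (h1 : x v = 0) (h2 : x u = 0) :
    ∃ t : Finset X, N.Side v u σ t ∧ (∀ z, z ∈ t ↔ 0 < x (σ z)) ∧ ∑ z ∈ t, x (σ z) = 1 := by
  classical
  obtain ⟨h0, s, hs, hxs, hsum⟩ := hx
  let s₀ := s.filter fun w => 0 < x w
  have hs₀ : ∀ w, w ∈ s₀ ↔ 0 < x w := by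
    intro w
    rw [Finset.mem_filter]
    refine ⟨And.right, fun hw => ⟨?_, hw⟩⟩
    by_contra hn
    exact hw.ne' (hxs w hn)
  have hsum₀ : ∑ w ∈ s₀, x w = 1 := by
    rw [← hsum]
    refine Finset.sum_subset (Finset.filter_subset _ _) fun w hw hw' => ?_
    by_contra hn
    exact hw' ((hs₀ w).2 ((h0 w).lt_of_ne' hn))
  have hne : s₀.Nonempty := by
    by_contra hn
    rw [Finset.not_nonempty_iff_eq_empty] at hn
    rw [hn] at hsum₀
    simp at hsum₀
  let t := s₀.preimage σ h.left_injective.injOn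
  have ht : ∀ z, z ∈ t ↔ 0 < x (σ z) := fun z => by rw [Finset.mem_preimage, hs₀]
  have himg : t.image σ = s₀ := by
    ext w
    rw [Finset.mem_image]
    constructor
    · rintro ⟨z, hz, rfl⟩
      exact Finset.mem_preimage.1 hz
    · intro hw
      obtain ⟨z, rfl⟩ := h.cover_left w fun hadj => ((hs₀ w).1 hw).ne' (hxu w hadj)
      exact ⟨z, Finset.mem_preimage.2 hw, rfl⟩
  refine ⟨t, ⟨?_, fun z hz => ⟨fun hzv => ?_, fun hzu => ?_⟩⟩, ht, ?_⟩
  · rw [himg]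
    exact mem_faces_of_subset hs (Finset.filter_subset _ _) hne
  · exact ((ht z).1 hz).ne' (hzv ▸ h1)
  · exact ((ht z).1 hz).ne' (hzu ▸ h2)
  · rw [← hsum₀, ← himg, Finset.sum_image fun a _ b _ hab => h.left_injective hab]

theorem extend_left_eq (h : IsStarGluing N Q v u σ τ)
    (hxu : ∀ w, N.skeletonGraph.Adj u w → x w = 0) : Function.extend σ (x ∘ σ) 0 = x := by
  funext w
  by_cases hw : ∃ a, σ a = w
  · obtain ⟨a, rfl⟩ := hw
    rw [h.left_injective.extend_apply, Function.comp_apply]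
  · rw [Function.extend_apply' _ _ _ hw, Pi.zero_apply]
    by_contra hn
    exact hw (h.cover_left w fun hadj => hn (hxu w hadj).symm)

theorem foldMap_mem (h : IsStarGluing N Q v u σ τ) (hx : x ∈ N.realization) (h1 : x v = 0)
    (h2 : x u = 0) : foldMap N v σ τ x ∈ Q.realization := by
  rcases h.left_or_right hx with hxu | hxv
  · obtain ⟨t, ht, hpos, hsum⟩ := h.exists_support_left hx hxu h1 h2
    rw [h.foldMap_left hxu]
    refine ⟨fun z => hx.1 _, t, (h.mem_faces_iff t).2 (Or.inl ht), fun z hz => ?_, hsum⟩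
    exact le_antisymm (not_lt.1 (mt (hpos z).2 hz)) (hx.1 _)
  · obtain ⟨t, ht, hpos, hsum⟩ := h.symm.exists_support_left hx hxv h2 h1
    rw [h.foldMap_right hxv]
    refine ⟨fun z => hx.1 _, t, (h.mem_faces_iff t).2 (Or.inr ht.swap), fun z hz => ?_, hsum⟩
    exact le_antisymm (not_lt.1 (mt (hpos z).2 hz)) (hx.1 _)

theorem exists_foldMap_eq (h : IsStarGluing N Q v u σ τ) {y : X → ℝ} (hy : y ∈ Q.realization) :
    ∃ x ∈ N.realization, x v = 0 ∧ x u = 0 ∧ foldMap N v σ τ x = y := by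
  classical
  obtain ⟨h0, t, ht, hyt, hsum⟩ := hy
  have hzero : ∀ (ρ : X → V) (p : V), Function.Injective ρ → (∀ z ∈ t, ρ z ≠ p) →
      Function.extend ρ y 0 p = 0 := by
    intro ρ p hρ hp
    by_cases hw : ∃ a, ρ a = p
    · obtain ⟨a, rfl⟩ := hw
      rw [hρ.extend_apply]
      exact hyt a fun ha => hp a ha rfl
    · rw [Function.extend_apply' _ _ _ hw, Pi.zero_apply]
  have hnot : ∀ (ρ : X → V) (p : V), (∀ z, ¬ N.skeletonGraph.Adj p (ρ z)) →
      ∀ w, N.skeletonGraph.Adj p w → Function.extend ρ y 0 w = 0 := by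
    intro ρ p hρ w hw
    have hw' : ¬ ∃ a, ρ a = w := by
      rintro ⟨a, rfl⟩
      exact hρ a hw
    rw [Function.extend_apply' _ _ _ hw', Pi.zero_apply]
  rcases (h.mem_faces_iff t).1 ht with hs | hs
  · refine ⟨Function.extend σ y 0, extend_mem_realization h.left_injective h0 hs.1 hyt hsum,
      hzero σ v h.left_injective fun z hz => (hs.2 z hz).1,
      hzero σ u h.left_injective fun z hz => (hs.2 z hz).2, ?_⟩
    rw [h.foldMap_left (hnot σ u h.not_adj_left)]
    exact Function.extend_comp h.left_injective _ _
  · refine ⟨Function.extend τ y 0, extend_mem_realization h.right_injective h0 hs.1 hyt hsum,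
      hzero τ v h.right_injective fun z hz => (hs.2 z hz).1,
      hzero τ u h.right_injective fun z hz => (hs.2 z hz).2, ?_⟩
    rw [h.foldMap_right (hnot τ v h.not_adj_right)]
    exact Function.extend_comp h.right_injective _ _

theorem mem_link_of_support (h : IsStarGluing N Q v u σ τ) (hx : x ∈ N.realization)
    (hxu : ∀ w, N.skeletonGraph.Adj u w → x w = 0) {t : Finset X} (ht : N.Side v u σ t)
    (hpos : ∀ z, z ∈ t ↔ 0 < x (σ z)) (hsum : ∑ z ∈ t, x (σ z) = 1)
    (hadj : ∀ z ∈ t, N.skeletonGraph.Adj v (σ z)) : x ∈ (N.link {v}).realization := by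
  classical
  have h3 := h.side_iff.1 ht
  have hl := (h.mem_link_left_iff hadj).2 ⟨h3.1, h3.2.2⟩
  rw [← h.extend_left_eq hxu]
  exact extend_mem_realization h.left_injective (fun z => hx.1 _) hl
    (fun z hz => le_antisymm (not_lt.1 (mt (hpos z).2 hz)) (hx.1 _)) hsum

theorem eq_or_mem_link_of_comp_eq (h : IsStarGluing N Q v u σ τ) (hx : x ∈ N.realization)
    (hx' : x' ∈ N.realization) (h1 : x v = 0) (h2 : x u = 0) (h1' : x' v = 0) (h2' : x' u = 0)
    (hxu : ∀ w, N.skeletonGraph.Adj u w → x w = 0)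
    (hxv : ∀ w, N.skeletonGraph.Adj v w → x' w = 0) (heq : x ∘ σ = x' ∘ τ) :
    x = x' ∨ (x ∈ (N.link {v}).realization ∧ x' ∈ (N.link {u}).realization) := by
  classical
  obtain ⟨t, ht, hpos, hsum⟩ := h.exists_support_left hx hxu h1 h2
  obtain ⟨t', ht', hpos', hsum'⟩ := h.symm.exists_support_left hx' hxv h2' h1'
  have heq' : ∀ z, x (σ z) = x' (τ z) := fun z => congrFun heq z
  obtain rfl : t = t' := by
    ext z
    rw [hpos, hpos', heq']
  by_cases hadj : ∀ z ∈ t, ¬ N.skeletonGraph.Adj v (σ z)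
  · left
    funext w
    by_cases hw : x w = 0
    · rw [hw]
      by_contra hw'
      have hwpos : 0 < x' w := (hx'.1 w).lt_of_ne hw'
      obtain ⟨z, rfl⟩ := h.cover_right w fun hvw => hwpos.ne' (hxv w hvw)
      have hz := hadj z ((hpos' z).2 hwpos)
      rw [← heq', h.eq_of_not_adj z hz, hw] at hwpos
      exact lt_irrefl _ hwpos
    · have hwpos : 0 < x w := (hx.1 w).lt_of_ne' hw
      obtain ⟨z, rfl⟩ := h.cover_left w fun huw => hw (hxu w huw)
      have hz := hadj z ((hpos z).2 hwpos)
      rw [heq', h.eq_of_not_adj z hz]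
  · right
    push Not at hadj
    obtain ⟨a, ha, hva⟩ := hadj
    have hall := h.adj_of_side_of_side ht ht'.swap ha hva
    exact ⟨h.mem_link_of_support hx hxu ht hpos hsum hall,
      h.symm.mem_link_of_support hx' hxv ht' hpos' hsum' fun z hz => (h.adj_iff z).1 (hall z hz)⟩

/-- Computes the fibres of the folding map: away from the links it is injective, and its only
identification matches the link of `v` with the link of `u`. -/
theorem eq_or_mem_link_of_foldMap_eq (h : IsStarGluing N Q v u σ τ) (hx : x ∈ N.realization)
    (hx' : x' ∈ N.realization) (h1 : x v = 0) (h2 : x u = 0) (h1' : x' v = 0) (h2' : x' u = 0)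
    (heq : foldMap N v σ τ x = foldMap N v σ τ x') : x = x' ∨
      (x ∈ (N.link {v}).realization ∧ x' ∈ (N.link {u}).realization ∧ x ∘ σ = x' ∘ τ) ∨
      (x' ∈ (N.link {v}).realization ∧ x ∈ (N.link {u}).realization ∧ x' ∘ σ = x ∘ τ) := by
  rcases h.left_or_right hx with hxu | hxv <;> rcases h.left_or_right hx' with hxu' | hxv'
  · rw [h.foldMap_left hxu, h.foldMap_left hxu'] at heq
    left
    rw [← h.extend_left_eq hxu, heq, h.extend_left_eq hxu']
  · rw [h.foldMap_left hxu, h.foldMap_right hxv'] at heq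
    rcases h.eq_or_mem_link_of_comp_eq hx hx' h1 h2 h1' h2' hxu hxv' heq with h3 | h3
    · exact Or.inl h3
    · exact Or.inr (Or.inl ⟨h3.1, h3.2, heq⟩)
  · rw [h.foldMap_right hxv, h.foldMap_left hxu'] at heq
    rcases h.eq_or_mem_link_of_comp_eq hx' hx h1' h2' h1 h2 hxu' hxv heq.symm with h3 | h3
    · exact Or.inl h3.symm
    · exact Or.inr (Or.inr ⟨h3.1, h3.2, heq.symm⟩)
  · rw [h.foldMap_right hxv, h.foldMap_right hxv'] at heq
    left
    rw [← h.symm.extend_left_eq hxv, heq, h.symm.extend_left_eq hxv']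

theorem adj_of_mem_link (hx : x ∈ (N.link {v}).realization) {w : V} (hw : x w ≠ 0) :
    N.skeletonGraph.Adj v w :=
  adj_iff_mem_link.2 (mem_vertexSet_of_pos (mem_coneSet_of_mem_realization hx)
    ((hx.1 w).lt_of_ne' hw))

theorem eq_zero_of_mem_link (h : IsStarGluing N Q v u σ τ) (hx : x ∈ (N.link {v}).realization) :
    ∀ w, N.skeletonGraph.Adj u w → x w = 0 := by
  intro w huw
  by_contra hn
  exact h.far_four (Or.inr (adj_of_mem_link hx hn)) (Or.inr huw.symm) (Near.refl _) (Near.refl _)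

theorem foldMap_eq_of_mem_link (h : IsStarGluing N Q v u σ τ) (hx : x ∈ (N.link {v}).realization)
    (hx' : x' ∈ (N.link {u}).realization) (heq : x ∘ σ = x' ∘ τ) :
    foldMap N v σ τ x = foldMap N v σ τ x' := by
  rw [h.foldMap_left (h.eq_zero_of_mem_link hx), h.foldMap_right (h.symm.eq_zero_of_mem_link hx'),
    heq]

end Fold

/-- Collars of both links at once. -/
theorem exists_collars (h : IsStarGluing N Q v u σ τ) {d : ℕ} (hN : N.IsSimplicialManifold d) :
    ∃ H : N.realization ≃ₜ N.realization,
      (∀ x : N.realization, (x : V → ℝ) v = 0 ↔ (H x : V → ℝ) v ≤ 1 / 2) ∧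
      (∀ x : N.realization, (x : V → ℝ) u = 0 ↔ (H x : V → ℝ) u ≤ 1 / 2) ∧
      (∀ x : N.realization, (x : V → ℝ) ∈ (N.link {v}).realization →
        (H x : V → ℝ) = push v 1 x) ∧
      ∀ x : N.realization, (x : V → ℝ) ∈ (N.link {u}).realization →
        (H x : V → ℝ) = push u 1 x := by
  -- The collar at `v` moves only points with a neighbour of `v` in their support. For such points,
  -- and for their images, the `u`-coordinate vanishes, so it is unchanged.
  have key : ∀ {v u : V} {σ τ : X → V} (_ : IsStarGluing N Q v u σ τ)
      {H : N.realization ≃ₜ N.realization}, (∀ x : N.realization,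
        (∀ p ∈ (N.link {v}).vertexSet, (x : V → ℝ) p = 0) → H x = x) →
      ∀ x : N.realization, (H x : V → ℝ) u = (x : V → ℝ) u := by
    intro v u σ τ h H hH x
    have hzero : ∀ y : N.realization,
        (∃ p ∈ (N.link {v}).vertexSet, (y : V → ℝ) p ≠ 0) → (y : V → ℝ) u = 0 := by
      rintro y ⟨p, hp, hyp⟩
      by_contra hn
      exact h.far_four (Or.inr (adj_iff_mem_link.2 hp)) (near_of_ne_zero y.2 hyp hn) (Near.refl _)
        (Near.refl _)
    by_cases hx : ∃ p ∈ (N.link {v}).vertexSet, (x : V → ℝ) p ≠ 0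
    · by_cases hHx : ∃ p ∈ (N.link {v}).vertexSet, (H x : V → ℝ) p ≠ 0
      · rw [hzero x hx, hzero _ hHx]
      · push Not at hHx
        rw [H.injective (hH _ hHx)]
    · push Not at hx
      rw [hH x hx]
  obtain ⟨A, hA1, hA2, hA3⟩ := hN.exists_collar h.mem_left
  obtain ⟨B, hB1, hB2, hB3⟩ := hN.exists_collar h.mem_right
  have hAu := key h hA1
  have hBv := key h.symm hB1
  refine ⟨B.trans A, fun x => ?_, fun x => ?_, fun x hx => ?_, fun x hx => ?_⟩
  · rw [Homeomorph.trans_apply, ← hA3, hBv]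
  · rw [Homeomorph.trans_apply, hAu, ← hB3]
  · rw [Homeomorph.trans_apply, hB1 x fun p hp =>
      h.eq_zero_of_mem_link hx p (adj_iff_mem_link.2 hp), hA2 x hx]
  · rw [Homeomorph.trans_apply, hA1, hB2 x hx]
    intro p hp
    have hadj := adj_iff_mem_link.2 hp
    rw [hB2 x hx, push_of_ne, h.symm.eq_zero_of_mem_link hx p hadj, mul_zero]
    rintro rfl
    exact h.not_near (Or.inr hadj)

end IsStarGluing

end PreAbstractSimplicialComplex

namespace PreAbstractSimplicialComplex

/-- A radial profile that doubles radius one. -/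
theorem exists_profile : ∃ ρ : ℝ → ℝ, Continuous ρ ∧ StrictMono ρ ∧ ρ 0 = 0 ∧ ρ 1 = 2 ∧
    ∀ t, 5 / 2 ≤ t → ρ t = t := by
  refine ⟨fun t => max t (min (2 * t) (2 + (t - 1) / 3)), by fun_prop, ?_, ?_, ?_, ?_⟩
  · intro a b hab
    exact max_lt_max hab (min_lt_min (by linarith) (by linarith))
  · norm_num
  · norm_num
  · intro t ht
    exact max_eq_left ((min_le_right _ _).trans (by linarith))

namespace IsStarGluing

variable {V X : Type*} {N : PreAbstractSimplicialComplex V} {Q : PreAbstractSimplicialComplex X}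
  {v u : V} {σ τ : X → V}

theorem notMem_ball_iff {n : ℕ} {e : EuclideanSpace ℝ (Fin n) → N.realization}
    (he : IsOpenEmbedding e) {p : V} (hr : range e = {x : N.realization | 0 < (x : V → ℝ) p})
    (hp : ∀ w, (e w : V → ℝ) p = (1 + ‖w‖)⁻¹) (x : N.realization) :
    x ∉ e '' ball 0 1 ↔ (x : V → ℝ) p ≤ 1 / 2 := by
  by_cases hx : x ∈ range e
  · obtain ⟨w, rfl⟩ := hx
    rw [he.injective.mem_set_image, mem_ball_zero_iff, hp, not_lt, one_div,
      inv_le_inv₀ (by positivity) two_pos]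
    constructor <;> intro h <;> linarith
  · have hxv : (x : V → ℝ) p = 0 := by
      rw [hr] at hx
      exact le_antisymm (not_lt.1 hx) (x.2.1 p)
    rw [hxv]
    exact ⟨fun _ => by norm_num, fun _ h => hx (image_subset_range _ _ h)⟩

theorem eq_zero_of_ne_zero (h : IsStarGluing N Q v u σ τ) {x : V → ℝ} (hx : x ∈ N.realization)
    (hv : x v ≠ 0) : x u = 0 := by
  by_contra hu
  exact h.not_near (near_of_ne_zero hx hv hu)

theorem apply_eq_zero_of_link {p : V} {x : V → ℝ} (hx : x ∈ (N.link {p}).realization) : x p = 0 :=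
  eq_zero_of_mem_coneSet_link (mem_coneSet_of_mem_realization hx)

/-- The realization of a star gluing is the original manifold with a hollow handle attached. -/
theorem isHollowHandleAttachment (h : IsStarGluing N Q v u σ τ) {d : ℕ}
    (hN : N.IsSimplicialManifold d) :
    IsHollowHandleAttachment d N.realization Q.realization := by
  classical
  obtain ⟨F, hF⟩ := exists_supportedOn hN.finite
  have hcomp : CompactSpace N.realization := hN.isManifold.compact
  obtain ⟨ψ'⟩ := hN.link_sphere _ h.mem_left
  rw [Finset.card_singleton, Nat.add_sub_cancel] at ψ'
  let ψ := ψ'.symm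
  have hcovσ : ∀ w ∈ (N.link {v}).vertexSet, ∃ x, σ x = w := fun w hw => h.cover_left w fun huw =>
    h.far_four (Or.inr (adj_iff_mem_link.2 hw)) (Or.inr huw.symm) (Near.refl _) (Near.refl _)
  have hcovτ : ∀ w ∈ (N.link {u}).vertexSet, ∃ x, τ x = w := fun w hw => h.cover_right w fun hvw =>
    h.far_four (Or.inr hvw) (Or.inr (adj_iff_mem_link.2 hw).symm) (Near.refl _) (Near.refl _)
  have hiff : ∀ t : Finset X, t.image τ ∈ (N.link {u}).faces ↔ t.image σ ∈ (N.link {v}).faces := by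
    intro t
    constructor
    · intro ht
      have hadj : ∀ x ∈ t, N.skeletonGraph.Adj v (σ x) := fun x hx => (h.adj_iff x).2
        (adj_iff_mem_link.2 (mem_vertexSet_of_mem ht (Finset.mem_image_of_mem τ hx)))
      have := h.link_iff t hadj
      convert this.2 (by convert ht)
    · intro ht
      have hadj : ∀ x ∈ t, N.skeletonGraph.Adj v (σ x) := fun x hx =>
        adj_iff_mem_link.2 (mem_vertexSet_of_mem ht (Finset.mem_image_of_mem σ hx))
      have := h.link_iff t hadj
      convert this.1 (by convert ht)
  obtain ⟨Λ, hΛ⟩ := exists_transfer_homeomorph h.right_injective h.left_injective hcovτ hcovσ hiff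
  have hΛc : ∀ y : (N.link {v}).realization, (y : V → ℝ) ∘ σ = (Λ y : V → ℝ) ∘ τ := fun y => by
    rw [hΛ]
    exact (Function.extend_comp h.right_injective _ _).symm
  have hΛu : ∀ (y : (N.link {v}).realization) (y' : V → ℝ), y' ∈ (N.link {u}).realization →
      (y : V → ℝ) ∘ σ = y' ∘ τ → y' = Λ y := fun y y' hy' heq => by
    rw [hΛ, heq, extend_comp_eq h.right_injective hcovτ hy']
  obtain ⟨e₀, a1, a2, a3, a4⟩ := exists_star_embedding hF hN.finite h.mem_left ψ
  -- The second ball is parametrised by `ψ` followed by the identification of the links, so that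
  -- equal parameters on the two boundary spheres are glued.
  obtain ⟨e₁, b1, b2, b3, b4⟩ := exists_star_embedding hF hN.finite h.mem_right (ψ.trans Λ)
  have hball₀ := notMem_ball_iff a1 a2 a3
  have hball₁ := notMem_ball_iff b1 b2 b3
  have hpos₀ : ∀ w, 0 < (e₀ w : V → ℝ) v := fun w => by rw [a3]; positivity
  have hpos₁ : ∀ w, 0 < (e₁ w : V → ℝ) u := fun w => by rw [b3]; positivity
  have hu₀ : ∀ w, (e₀ w : V → ℝ) u = 0 := fun w => h.eq_zero_of_ne_zero (e₀ w).2 (hpos₀ w).ne'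
  have hv₁ : ∀ w, (e₁ w : V → ℝ) v = 0 := fun w => h.symm.eq_zero_of_ne_zero (e₁ w).2 (hpos₁ w).ne'
  let D : HollowHandleData d N.realization := ⟨e₀, e₁, a1, b1, by
    rw [Set.disjoint_left]
    rintro _ ⟨w, -, rfl⟩ ⟨w', -, heq⟩
    exact (hpos₁ w').ne' (by rw [heq, hu₀])⟩
  have hC : ∀ x : N.realization, x ∈ D.complement ↔
      (x : V → ℝ) v ≤ 1 / 2 ∧ (x : V → ℝ) u ≤ 1 / 2 := by
    intro x
    rw [← hball₀, ← hball₁, HollowHandleData.complement, mem_compl_iff, mem_union, not_or]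
  obtain ⟨H, H1, H2, H3, H4⟩ := h.exists_collars hN
  obtain ⟨ρ, r1, r2, r3, r4, r5⟩ := exists_profile
  -- Doubling the radius at `v` moves the complement of the unit ball to the outside of radius 2,
  -- where the `v`-coordinate is at most 1/3. The shell between radius 1 and radius 2 is freed for
  -- the handle, which enters it with radius 2 - s.
  obtain ⟨J, J1, J2⟩ := a1.exists_radial_homeomorph r1 r2 r3 r5
  have hρpos : ∀ t, 0 ≤ t → 0 ≤ ρ t := fun t ht => r3 ▸ r2.monotone ht
  have hJe : ∀ w, (J (e₀ w) : V → ℝ) v = (1 + ρ ‖w‖)⁻¹ := fun w => by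
    rw [J1, a3, norm_radialMap r3 hρpos]
  have hJu : ∀ x : N.realization, (J x : V → ℝ) u = (x : V → ℝ) u := by
    intro x
    by_cases hx : x ∈ range e₀
    · obtain ⟨w, rfl⟩ := hx
      rw [J1, hu₀, hu₀]
    · rw [J2 x hx]
  have hJv : ∀ x : N.realization, (x : V → ℝ) v ≤ 1 / 2 ↔ (J x : V → ℝ) v ≤ 1 / 3 := by
    intro x
    by_cases hx : x ∈ range e₀
    · obtain ⟨w, rfl⟩ := hx
      have hw := hρpos _ (norm_nonneg w)
      rw [hJe, a3, one_div, one_div, inv_le_inv₀ (by positivity) two_pos,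
        inv_le_inv₀ (by positivity) three_pos]
      have : 1 ≤ ‖w‖ ↔ 2 ≤ ρ ‖w‖ := by rw [← r4, r2.le_iff_le]
      constructor
      · intro h1
        linarith [this.1 (by linarith)]
      · intro h1
        linarith [this.2 (by linarith)]
    · rw [J2 x hx]
      have hxv : (x : V → ℝ) v = 0 := by
        rw [a2] at hx
        exact le_antisymm (not_lt.1 hx) (x.2.1 v)
      rw [hxv]
      norm_num
  -- the boundary spheres
  have hHψ : ∀ p : sphere (0 : EuclideanSpace ℝ (Fin d)) 1,
      H ⟨ψ p, realization_mono link_faces_subset (ψ p).2⟩ = e₀ p := by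
    intro p
    refine Subtype.ext ?_
    have h1 := a4 1 p one_pos
    rw [one_smul, one_smul] at h1
    rw [H3 _ (ψ p).2, h1, push, one_smul, add_comm (vtx v)]
  have hHψ' : ∀ p : sphere (0 : EuclideanSpace ℝ (Fin d)) 1,
      H ⟨Λ (ψ p), realization_mono link_faces_subset (Λ (ψ p)).2⟩ = e₁ p := by
    intro p
    refine Subtype.ext ?_
    have h1 := b4 1 p one_pos
    rw [one_smul, one_smul] at h1
    rw [H4 _ (Λ (ψ p)).2, h1, push, one_smul, add_comm (vtx u)]
    rfl
  have hJe₁ : ∀ w, J (e₁ w) = e₁ w := fun w => J2 _ fun hx => by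
    rw [a2] at hx
    exact hx.ne' (hv₁ w)
  -- the map to the deletion, as points of the collared complex
  let m : D.complement ⊕ (sphere (0 : EuclideanSpace ℝ (Fin d)) 1 × unitInterval) → N.realization :=
    Sum.elim (fun c => J c) fun q => e₀ ((2 - (q.2 : ℝ)) • (q.1 : EuclideanSpace ℝ (Fin d)))
  have hnorm : ∀ (p : sphere (0 : EuclideanSpace ℝ (Fin d)) 1) (s : unitInterval),
      ‖(2 - (s : ℝ)) • (p : EuclideanSpace ℝ (Fin d))‖ = 2 - s := by
    intro p s
    have := s.2.2
    rw [norm_smul, norm_eq_of_mem_sphere p, mul_one, Real.norm_of_nonneg (by linarith)]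
  have hminr : ∀ p s, (m (Sum.inr (p, s)) : V → ℝ) v = (1 + (2 - (s : ℝ)))⁻¹ := fun p s => by
    change (e₀ _ : V → ℝ) v = _
    rw [a3, hnorm]
  have hminl : ∀ c, (m (Sum.inl c) : V → ℝ) v ≤ 1 / 3 := fun c => (hJv c).1 ((hC c).1 c.2).1
  have hmu : ∀ q, (m (Sum.inr q) : V → ℝ) u = 0 := fun q => hu₀ _
  have hmc : Continuous m := Continuous.sumElim (J.continuous.comp continuous_subtype_val)
    (a1.continuous.comp (by fun_prop))
  have hm : ∀ z, (m z : V → ℝ) v ≤ 1 / 2 ∧ (m z : V → ℝ) u ≤ 1 / 2 := by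
    rintro (c | ⟨p, s⟩)
    · refine ⟨(hminl c).trans (by norm_num), ?_⟩
      change (J c : V → ℝ) u ≤ _
      rw [hJu]
      exact ((hC c).1 c.2).2
    · rw [hmu, hminr]
      have := s.2.2
      refine ⟨?_, by norm_num⟩
      rw [one_div, inv_le_inv₀ (by linarith) two_pos]
      linarith
  let k : D.complement ⊕ (sphere (0 : EuclideanSpace ℝ (Fin d)) 1 × unitInterval) → N.realization :=
    fun z => H.symm (m z)
  have hk : ∀ z, H (k z) = m z := fun z => H.apply_symm_apply _
  have hkv : ∀ z, (k z : V → ℝ) v = 0 := fun z => (H1 _).2 (by rw [hk]; exact (hm z).1)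
  have hku : ∀ z, (k z : V → ℝ) u = 0 := fun z => (H2 _).2 (by rw [hk]; exact (hm z).2)
  let Φ : D.complement ⊕ (sphere (0 : EuclideanSpace ℝ (Fin d)) 1 × unitInterval) → Q.realization :=
    fun z => ⟨foldMap N v σ τ (k z), h.foldMap_mem (k z).2 (hkv z) (hku z)⟩
  have hΦc : Continuous Φ := ((continuous_foldMap N v σ τ).comp
    (continuous_subtype_val.comp (H.symm.continuous.comp hmc))).subtype_mk _
  have hΦs : Function.Surjective Φ := by
    rintro ⟨y, hy⟩
    obtain ⟨x, hx, hxv, hxu, rfl⟩ := h.exists_foldMap_eq hy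
    have hv := (H1 ⟨x, hx⟩).1 hxv
    have hu := (H2 ⟨x, hx⟩).1 hxu
    suffices hz : ∃ z, m z = H ⟨x, hx⟩ by
      obtain ⟨z, hz⟩ := hz
      refine ⟨z, Subtype.ext ?_⟩
      change foldMap N v σ τ (H.symm (m z)) = _
      rw [hz, Homeomorph.symm_apply_apply]
    -- The value 1/3 marks radius 2: points beyond it come from the complement, points of the shell
    -- from the handle.
    by_cases h3 : (H ⟨x, hx⟩ : V → ℝ) v ≤ 1 / 3
    · refine ⟨Sum.inl ⟨J.symm (H ⟨x, hx⟩), (hC _).2 ⟨?_, ?_⟩⟩, J.apply_symm_apply _⟩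
      · rw [hJv, Homeomorph.apply_symm_apply]
        exact h3
      · rw [← hJu, Homeomorph.apply_symm_apply]
        exact hu
    · have hr : H ⟨x, hx⟩ ∈ range e₀ := by
        rw [a2]
        exact lt_trans (by norm_num) (not_le.1 h3)
      obtain ⟨w, hw⟩ := hr
      rw [← hw, a3, one_div, inv_le_inv₀ (by positivity) three_pos] at h3
      rw [← hw, a3, one_div, inv_le_inv₀ (by positivity) two_pos] at hv
      have hw0 : 0 < ‖w‖ := by linarith
      refine ⟨Sum.inr (⟨‖w‖⁻¹ • w, ?_⟩, ⟨2 - ‖w‖, by linarith, by linarith⟩), ?_⟩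
      · rw [mem_sphere_zero_iff_norm, norm_smul, norm_inv, norm_norm, inv_mul_cancel₀ hw0.ne']
      · rw [← hw]
        change e₀ ((2 - (2 - ‖w‖)) • ‖w‖⁻¹ • w) = e₀ w
        rw [sub_sub_cancel, smul_smul, mul_inv_cancel₀ hw0.ne', one_smul]
  have hrel : ∀ z z', D.Rel z z' → Φ z = Φ z' := by
    rintro _ _ (⟨x, p, hx⟩ | ⟨x, p, hx⟩)
    · refine Subtype.ext (congrArg (fun y : N.realization => foldMap N v σ τ (H.symm y)) ?_)
      change J x = e₀ ((2 - (0 : ℝ)) • (p : EuclideanSpace ℝ (Fin d)))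
      have hx' : (x : N.realization) = e₀ p := hx
      rw [hx', J1, radialMap, norm_eq_of_mem_sphere p, r4, sub_zero, div_one]
    · refine Subtype.ext ?_
      have h1 : k (Sum.inl x) = ⟨Λ (ψ p), realization_mono link_faces_subset (Λ (ψ p)).2⟩ := by
        apply H.injective
        rw [hk, hHψ']
        change J x = _
        have hx' : (x : N.realization) = e₁ p := hx
        rw [hx', hJe₁]
      have h2 : k (Sum.inr (p, 1)) = ⟨ψ p, realization_mono link_faces_subset (ψ p).2⟩ := by
        apply H.injective
        rw [hk, hHψ]
        change e₀ ((2 - (1 : ℝ)) • (p : EuclideanSpace ℝ (Fin d))) = _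
        norm_num
      change foldMap N v σ τ (k (Sum.inl x)) = foldMap N v σ τ (k (Sum.inr (p, 1)))
      rw [h1, h2]
      exact (h.foldMap_eq_of_mem_link (ψ p).2 (Λ (ψ p)).2 (hΛc _)).symm
  -- points over the common link
  have hkl : ∀ z, (k z : V → ℝ) ∈ (N.link {v}).realization →
      ∃ p, z = Sum.inr (p, 1) ∧ (k z : V → ℝ) = ψ p := by
    intro z hz
    have h1 : (m z : V → ℝ) v = 1 / 2 := by
      rw [← hk, H3 _ hz, push_self (apply_eq_zero_of_link hz)]
      norm_num
    rcases z with c | ⟨p, s⟩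
    · have := hminl c
      rw [h1] at this
      norm_num at this
    · rw [hminr, one_div, inv_inj] at h1
      have hs : s = 1 := Subtype.ext (by change (s : ℝ) = 1; linarith)
      subst hs
      refine ⟨p, rfl, ?_⟩
      have h2 : k (Sum.inr (p, 1)) = ⟨ψ p, realization_mono link_faces_subset (ψ p).2⟩ := by
        apply H.injective
        rw [hk, hHψ]
        change e₀ ((2 - (1 : ℝ)) • (p : EuclideanSpace ℝ (Fin d))) = _
        norm_num
      rw [h2]
  have hcross : ∀ z z', (k z : V → ℝ) ∈ (N.link {v}).realization →
      (k z' : V → ℝ) ∈ (N.link {u}).realization → (k z : V → ℝ) ∘ σ = (k z' : V → ℝ) ∘ τ →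
      Quot.mk D.Rel z = Quot.mk D.Rel z' := by
    intro z z' hz hz' heq
    obtain ⟨p, rfl, hp⟩ := hkl z hz
    rw [hp] at heq
    have h1 := hΛu (ψ p) _ hz' heq
    have h2 : m z' = e₁ p := by
      rw [← hk, ← hHψ']
      congr 1
      exact Subtype.ext h1
    rcases z' with c | q
    · have h3 : (c : N.realization) = e₁ p := by
        apply J.injective
        rw [hJe₁]
        exact h2
      exact (Quot.sound (HollowHandleData.Rel.one c p h3)).symm
    · have := hmu q
      rw [h2] at this
      exact absurd this (hpos₁ _).ne'
  have hmixed : ∀ c p s, m (Sum.inl c) = m (Sum.inr (p, s)) →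
      Quot.mk D.Rel (Sum.inl c) = Quot.mk D.Rel (Sum.inr (p, s)) := by
    intro c p s heq
    have h1 := hminl c
    rw [heq, hminr, one_div, inv_le_inv₀ (by linarith [s.2.2]) three_pos] at h1
    have hs : s = 0 := Subtype.ext (le_antisymm (by change (s : ℝ) ≤ 0; linarith) s.2.1)
    subst hs
    refine Quot.sound (HollowHandleData.Rel.zero c p (J.injective ?_))
    refine Eq.trans (show J c = e₀ ((2 - (0 : ℝ)) • (p : EuclideanSpace ℝ (Fin d))) from heq) ?_
    change _ = J (e₀ p)
    rw [J1, radialMap, norm_eq_of_mem_sphere p, r4, sub_zero, div_one]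
  have hinj : ∀ z z', Φ z = Φ z' → Quot.mk D.Rel z = Quot.mk D.Rel z' := by
    intro z z' heq
    have heq' : foldMap N v σ τ (k z) = foldMap N v σ τ (k z') := congrArg Subtype.val heq
    rcases h.eq_or_mem_link_of_foldMap_eq (k z).2 (k z').2 (hkv z) (hku z) (hkv z') (hku z') heq'
      with h1 | h1 | h1
    · have h2 : m z = m z' := H.symm.injective (Subtype.ext h1)
      rcases z with c | ⟨p, s⟩ <;> rcases z' with c' | ⟨p', s'⟩
      · rw [Subtype.ext (J.injective h2)]
      · exact hmixed c p' s' h2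
      · exact (hmixed c' p s h2.symm).symm
      · have h3 : (2 - (s : ℝ)) • (p : EuclideanSpace ℝ (Fin d)) =
            (2 - (s' : ℝ)) • (p' : EuclideanSpace ℝ (Fin d)) := a1.injective h2
        have h4 := congrArg norm h3
        rw [hnorm, hnorm] at h4
        rw [h4] at h3
        have h5 : (2 - (s' : ℝ)) ≠ 0 := by linarith [s'.2.2]
        have hp : p = p' := Subtype.ext (smul_right_injective _ h5 h3)
        have hs : s = s' := Subtype.ext (by linarith)
        rw [hp, hs]
    · exact hcross z z' h1.1 h1.2.1 h1.2.2
    · exact (hcross z' z h1.1 h1.2.1 h1.2.2).symm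
  have hCc : IsClosed D.complement := by
    rw [HollowHandleData.complement, isClosed_compl_iff]
    exact (a1.isOpenMap _ isOpen_ball).union (b1.isOpenMap _ isOpen_ball)
  have hcC : CompactSpace D.complement := isCompact_iff_compactSpace.1 hCc.isCompact
  let Ψ : D.Attached → Q.realization := Quot.lift Φ hrel
  have hΨc : Continuous Ψ := continuous_quot_lift hrel hΦc
  have hΨb : Function.Bijective Ψ := by
    refine ⟨?_, fun y => ?_⟩
    · rintro ⟨z⟩ ⟨z'⟩ heq
      exact hinj z z' heq
    · obtain ⟨z, hz⟩ := hΦs y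
      exact ⟨Quot.mk _ z, hz⟩
  exact ⟨D, ⟨(hΨc.homeoOfEquivCompactToT2 (f := Equiv.ofBijective Ψ hΨb)).symm⟩⟩

end IsStarGluing

end PreAbstractSimplicialComplex

/-! ### Assembling the lemma. -/

open PreAbstractSimplicialComplex in
theorem lemma1p3 {V : Type*} (N : PreAbstractSimplicialComplex V)
    (hN : N.IsSimplicialManifold 4) (hfns : N.IsFns) (hconn : IsConnected N.realization)
    (o : N.Orientation 4) (v u : V) (hv : v ∈ N.vertexSet) (hu : u ∈ N.vertexSet)
    (hdist : 7 ≤ N.skeletonGraph.dist v u)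
    (φ : (N.link {v}).Iso (N.link {u})) (hφ : o.IsReversedBy φ) :
    (N.starHandle φ).IsFns ∧
    (N.starHandle φ).IsSimplicialManifold 4 ∧
    (N.starHandle φ).IsOrientable 4 ∧
    IsHollowHandleAttachment 4 N.realization (N.starHandle φ).realization ∧
    (N.starHandle φ).eulerChar = N.eulerChar - 2 := by
  obtain ⟨σ, τ, h, hτ⟩ := exists_isStarGluing hfns.1 hv hu hdist φ
  refine ⟨h.isFns hfns.2, h.isSimplicialManifold hN, ?_, h.isHollowHandleAttachment hN, ?_⟩
  · refine h.isOrientable (by norm_num) o hN.card_le fun y hy => ?_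
    have hmem : ∀ i, σ (y i) ∈ (N.link {v}).vertexSet := by
      intro i
      obtain ⟨-, s, hs, hsy⟩ := hy
      refine mem_vertexSet_of_mem hs ?_
      rw [← Finset.mem_coe, hsy]
      exact ⟨i, rfl⟩
    have h1 := hφ (fun i => ⟨σ (y i), hmem i⟩) hy
    have h2 : τ ∘ y = fun i => (φ.toEquiv ⟨σ (y i), hmem i⟩ : V) :=
      funext fun i => hτ (y i) (hmem i)
    rw [h2]
    exact h1
  · have hsphere : ∀ p ∈ N.vertexSet, (N.link {p}).eulerChar = 0 := fun p hp => by
      have := hN.isSphereComplex_link hp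
      rw [Finset.card_singleton] at this
      exact this.eulerChar_eq_zero_of_four
    have h1 := h.eulerChar_eq hN.finite
    have h2 := h.eulerChar_eq_deletion_deletion hN.finite
    rw [hsphere v hv] at h1 h2
    rw [hsphere u hu] at h2
    linarith
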